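/- Let $a>0$ be a constant. For $n\in\mathbb{N}$ with $n\ge a$, consider the following rumor spreading process on $n$ nodes. Initially exactly one node is informed. In each round, independently of the other rounds, a fresh communication graph is sampled from $G(n,p)$ with $p=a/n$, that is, each of the $\binom n2$ possible edges is present independently with probability $a/n$. Then every informed node, independently of the other nodes, chooses a communication partner uniformly at random from its neighbors in this graph and informs it (the partner counts as informed from the next round on); isolated nodes do not communicate. Informed nodes stay informed. Let $T$ be the number of rounds until all $n$ nodes are informed. Then $T$ is almost surely finite and integrable, and $$\mathbb{E}[T]=\log_{2-e^{-a}} n+\frac{1}{1-e^{-a}}\ln n\pm O(1),$$ where the $O(1)$ term is bounded in absolute value by a constant depending only on $a$. In addition, there are constants $A',\alpha'>0$, depending only on $a$, such that for all $n\ge a$ and all $r\in\mathbb{N}$, $$\Pr\bigl[|T-\mathbb{E}[T]|\ge r\bigr]\le A'e^{-\alpha' r}.$$ -/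

import Mathlib

open MeasureTheory ProbabilityTheory

namespace PushDynamic

/-- The edge probability `a / n`, which is a probability as soon as `a ≤ n`. -/
noncomputable def edgeProb (a : ℝ) (n : ℕ) (ha : 0 < a) (hn : a ≤ n) : unitInterval :=
  ⟨a / n, div_nonneg ha.le n.cast_nonneg, div_le_one_of_le₀ hn n.cast_nonneg⟩

open scoped Classical in
/-- The law of the communication partner of the node `v` when the communication graph is `G`:
uniform on the neighbors of `v`. An isolated node does not communicate; this is encoded by letting
it draw itself, which has no effect on the set of informed nodes. -/
noncomputable def partnerLaw {n : ℕ} (G : SimpleGraph (Fin n)) (v : Fin n) : Measure (Fin n) :=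
  if (G.neighborSet v).Nonempty then uniformOn (G.neighborSet v) else Measure.dirac v

instance {n : ℕ} (G : SimpleGraph (Fin n)) (v : Fin n) :
    IsProbabilityMeasure (partnerLaw G v) := by
  unfold partnerLaw
  split_ifs with h
  · exact isProbabilityMeasure_uniformOn (Set.toFinite _) h
  · infer_instance

/-- The law of the choices made in one round: a graph `G` is sampled from `G(n,p)`, and given `G`
all nodes draw their partners independently of each other (only the draws of the informed nodes are
carried out as calls, see `informed`). -/
noncomputable def roundLaw (n : ℕ) (p : unitInterval) : Measure (Fin n → Fin n) :=
  (SimpleGraph.binomialRandom (Fin n) p).bind fun G => Measure.pi fun v => partnerLaw G v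

theorem measurable_of_simpleGraph {n : ℕ} {β : Type*} [MeasurableSpace β]
    (f : SimpleGraph (Fin n) → β) : Measurable f := by
  have : MeasurableSingletonClass (SimpleGraph (Fin n)) := ⟨fun G => by
    have h := SimpleGraph.measurable_edgeSet (V := Fin n)
      (measurableSet_singleton (G.edgeSet))
    have e : SimpleGraph.edgeSet ⁻¹' {G.edgeSet} = {G} := by
      ext H; simp
    rwa [e] at h⟩
  exact measurable_of_countable f

instance (n : ℕ) (p : unitInterval) : IsProbabilityMeasure (roundLaw n p) :=
  isProbabilityMeasure_bind (measurable_of_simpleGraph _).aemeasurable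
    (Filter.Eventually.of_forall fun _ => inferInstance)

/-- The sample space of the process is `ℕ → Fin n → Fin n`: for `ω` in it, `ω t v` is the partner
drawn by `v` in round `t + 1`. The rounds are independent and identically distributed; in
particular, each round uses a freshly sampled communication graph. -/
noncomputable def processLaw (n : ℕ) (p : unitInterval) : Measure (ℕ → Fin n → Fin n) :=
  Measure.infinitePi fun _ => roundLaw n p

/-- The set of informed nodes after `t` rounds of the push protocol, when at the beginning exactly
the node `s` is informed: in each round every informed node informs its partner. -/
def informed {n : ℕ} (s : Fin n) : ℕ → (ℕ → Fin n → Fin n) → Finset (Fin n)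
  | 0, _ => {s}
  | t + 1, ω => informed s t ω ∪ (informed s t ω).image (ω t)

/-- The rumor spreading time: the first `t` such that all nodes are informed after `t` rounds
(`⊤` if there is no such `t`). -/
noncomputable def spreadingTime {n : ℕ} (s : Fin n) : (ℕ → Fin n → Fin n) → WithTop ℕ :=
  hittingAfter (informed s) {Finset.univ} 0

/-- The rumor spreading time as a real number (`0` where it is infinite). -/
noncomputable def spreadingTimeReal {n : ℕ} (s : Fin n) (ω : ℕ → Fin n → Fin n) : ℝ :=
  ((spreadingTime s ω).untopD 0 : ℕ)

end PushDynamic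

namespace PushDynamic

/-! Write `k` for the number of informed nodes, `y = n - k`, and `Q = 1 - exp(-a)`, the limiting
probability that a node is not isolated. A call from an informed node hits a given other node with
probability about `Q / n`. If calls were independent, one round would leave about `y exp(-Q k / n)`
nodes uninformed: growth by the factor `1 + Q = 2 - exp(-a)` while `k` is small, and shrinking of
`y` by the factor `exp(-Q)` once `y` is small. The two regimes take `log n / log (1 + Q)` and `log n
/ Q` rounds, which is the estimate.

The first task is to control the dependence that the common graph creates. Given the coins of the
pairs inside the informed set `I`, the calls out of `I` made by different nodes are independent,
since each depends on its own row of coins between `I` and its complement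
(`integral_prod_callProb`). Each inside coin influences only two callers, by at most `p` each, so by
an Efron-Stein inequality the inside coins contribute variance at most `4 k² p³`. This yields
`OneStep`: the mean of the uninformed count up to an error `O(y k / n²)`, and variance `O(k y / n)`.
The asymptotic tail bounds use only `OneStep`.

Both tails come from potentials of the Markov chain of informed sets, through the operator
`stepMean`. For the upper tail, `exists_slowProb_le_of_contraction` treats a quantity `w` that
contracts up to a relative error of order `w`: the potential `√w + w` contracts exactly at rate
`√ρ`, so no additive loss accumulates over the rounds. It is used with `w = 1/k - B/n` and `w =
y/n`; the stretches in between take `O(1)` rounds. For the lower tail, the first moment bounds how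
fast `n/4` nodes can be informed, and the potential `(D + y)^(-1/4) - (D + y)^(-1/2)` bounds how
fast the rest can be finished.

The tails hold for large `n`; the finitely many smaller `n` are covered by a crude lower bound on
the progress per round. Exponential tails around the estimate then give integrability, the mean and
concentration (`concentration_of_tails`). -/

/-! ### The binomial random graph as a function of independent coins -/

/-- The Bernoulli distribution on `Prop`. -/
noncomputable def coin (p : unitInterval) : Measure Prop :=
  unitInterval.toNNReal p • Measure.dirac True +
    unitInterval.toNNReal (unitInterval.symm p) • Measure.dirac False

instance (p : unitInterval) : IsProbabilityMeasure (coin p) := by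
  unfold coin
  infer_instance

theorem integral_coin (p : unitInterval) (f : Prop → ℝ) :
    ∫ b, f b ∂coin p = p * f True + (1 - p) * f False := by
  rw [coin, integral_add_measure .of_finite .of_finite, integral_smul_nnreal_measure,
    integral_smul_nnreal_measure, integral_dirac, integral_dirac]
  simp [NNReal.smul_def]

theorem coin_real_singleton_true (p : unitInterval) : (coin p).real {b | b} = p := by
  rw [← integral_indicator_one .of_discrete, integral_coin]
  simp

theorem coin_real_singleton_false (p : unitInterval) : (coin p).real {b | ¬ b} = 1 - p := by
  rw [← integral_indicator_one .of_discrete, integral_coin]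
  simp

/-- A coin is tossed for the diagonal elements of `Sym2` as well; `fromEdgeSet` discards loops, so
they have no effect and the product can run over all of `Sym2`. -/
theorem binomialRandom_eq_map_coin (n : ℕ) (p : unitInterval) :
    SimpleGraph.binomialRandom (Fin n) p =
      (Measure.pi fun _ : Sym2 (Fin n) => coin p).map
        fun b => SimpleGraph.fromEdgeSet {e | b e} := by
  have h := Measure.infinitePi_map_pi (ι := Sym2 (Fin n)) (fun _ => coin p)
    (f := fun e b => b ∧ e ∈ Sym2.diagSetᶜ) (fun _ => .of_discrete)
  have h2 : ∀ e : Sym2 (Fin n), (coin p).map (fun b => b ∧ e ∈ Sym2.diagSetᶜ) =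
      unitInterval.toNNReal p • Measure.dirac (e ∈ Sym2.diagSetᶜ) +
        unitInterval.toNNReal (unitInterval.symm p) • Measure.dirac False := by
    intro e
    rw [coin, Measure.map_add _ _ .of_discrete]
    simp [Measure.map_smul, Measure.map_dirac' (Measurable.of_discrete)]
  simp only [h2] at h
  rw [SimpleGraph.binomialRandom_eq_map, setBernoulli_eq_map, ← h, Measure.map_map (by fun_prop)
    .of_discrete, Measure.map_map .of_discrete .of_discrete, ← Measure.infinitePi_eq_pi]
  congr 1
  ext b
  simp [SimpleGraph.fromEdgeSet_adj]

/-- Replaces the coins of the pairs between `I` and its complement by the coins `S`. -/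
def splice {n : ℕ} (I : Finset (Fin n)) (x : (Sym2 (Fin n) → Prop) × (Fin n → Fin n → Prop)) :
    Sym2 (Fin n) → Prop := fun e =>
  (x.1 e ∧ ¬ ∃ u ∈ I, ∃ w ∉ I, e = s(u, w)) ∨ ∃ u ∈ I, ∃ w ∉ I, e = s(u, w) ∧ x.2 u w

theorem splice_cross {n : ℕ} {I : Finset (Fin n)}
    (x : (Sym2 (Fin n) → Prop) × (Fin n → Fin n → Prop)) {u w : Fin n} (hu : u ∈ I) (hw : w ∉ I) :
    splice I x s(u, w) ↔ x.2 u w := by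
  unfold splice
  constructor
  · rintro (⟨-, h⟩ | ⟨u', hu', w', hw', h, h'⟩)
    · exact absurd ⟨u, hu, w, hw, rfl⟩ h
    · rw [Sym2.eq_iff] at h
      rcases h with ⟨rfl, rfl⟩ | ⟨rfl, rfl⟩
      · exact h'
      · exact absurd hu hw'
  · exact fun h => Or.inr ⟨u, hu, w, hw, rfl, h⟩

theorem splice_of_not_cross {n : ℕ} {I : Finset (Fin n)}
    (x : (Sym2 (Fin n) → Prop) × (Fin n → Fin n → Prop)) {e : Sym2 (Fin n)}
    (he : ¬ ∃ u ∈ I, ∃ w ∉ I, e = s(u, w)) : splice I x e ↔ x.1 e := by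
  unfold splice
  constructor
  · rintro (⟨h, -⟩ | ⟨u', hu', w', hw', h, h'⟩)
    · exact h
    · exact absurd ⟨u', hu', w', hw', h⟩ he
  · exact fun h => Or.inl ⟨h, he⟩

/-- Each crossing pair has exactly one orientation `(u, w)` with `u ∈ I` and `w ∉ I`, so it receives
exactly one fresh coin. The gain is that the crossing coins are now arranged in independent rows,
one for each informed node. -/
theorem pi_coin_eq_map_splice (n : ℕ) (p : unitInterval) (I : Finset (Fin n)) :
    (Measure.pi fun _ : Sym2 (Fin n) => coin p) =
      ((Measure.pi fun _ : Sym2 (Fin n) => coin p).prod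
        (Measure.pi fun _ : Fin n => Measure.pi fun _ : Fin n => coin p)).map (splice I) := by
  classical
  refine Measure.pi_eq fun t ht => ?_
  rw [Measure.map_apply .of_discrete .of_discrete]
  have key : splice I ⁻¹' Set.univ.pi t =
      (Set.univ.pi fun e => if ∃ u ∈ I, ∃ w ∉ I, e = s(u, w) then Set.univ else t e) ×ˢ
      (Set.univ.pi fun u => Set.univ.pi fun w =>
        if u ∈ I ∧ w ∉ I then t s(u, w) else Set.univ) := by
    ext x
    simp only [Set.mem_preimage, Set.mem_pi, Set.mem_univ, forall_true_left, Set.mem_prod]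
    constructor
    · intro h
      refine ⟨fun e => ?_, fun u w => ?_⟩
      · split_ifs with he
        · trivial
        · have := h e
          rwa [eq_iff_iff.2 (splice_of_not_cross x he)] at this
      · split_ifs with huw
        · have := h s(u, w)
          rwa [eq_iff_iff.2 (splice_cross x huw.1 huw.2)] at this
        · trivial
    · rintro ⟨h1, h2⟩ e
      by_cases he : ∃ u ∈ I, ∃ w ∉ I, e = s(u, w)
      · obtain ⟨u, hu, w, hw, rfl⟩ := he
        have := h2 u w
        rw [if_pos ⟨hu, hw⟩] at this
        rwa [eq_iff_iff.2 (splice_cross x hu hw)]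
      · have := h1 e
        rw [if_neg he] at this
        rwa [eq_iff_iff.2 (splice_of_not_cross x he)]
  rw [key, Measure.prod_prod, Measure.pi_pi, Measure.pi_pi]
  simp only [Measure.pi_pi, apply_ite (coin p), measure_univ]
  rw [← Finset.prod_product', Finset.univ_product_univ]
  -- The bijection between oriented and unoriented crossing pairs.
  have h3 : ∏ x : Fin n × Fin n, (if x.1 ∈ I ∧ x.2 ∉ I then coin p (t s(x.1, x.2)) else 1) =
      ∏ e : Sym2 (Fin n), (if ∃ u ∈ I, ∃ w ∉ I, e = s(u, w) then coin p (t e) else 1) := by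
    rw [← Finset.prod_filter, ← Finset.prod_filter]
    refine Finset.prod_bij (fun x _ => s(x.1, x.2)) ?_ ?_ ?_ ?_
    · rintro ⟨u, w⟩ h
      simp only [Finset.mem_filter, Finset.mem_univ, true_and] at h ⊢
      exact ⟨u, h.1, w, h.2, rfl⟩
    · rintro ⟨u, w⟩ h ⟨u', w'⟩ h' e
      simp only [Finset.mem_filter, Finset.mem_univ, true_and] at h h'
      rw [Sym2.eq_iff] at e
      rcases e with ⟨rfl, rfl⟩ | ⟨rfl, rfl⟩
      · rfl
      · exact absurd h.1 h'.2
    · rintro e h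
      simp only [Finset.mem_filter, Finset.mem_univ, true_and] at h
      obtain ⟨u, hu, w, hw, rfl⟩ := h
      exact ⟨(u, w), by simp [hu, hw], rfl⟩
    · rintro ⟨u, w⟩ h
      rfl
  rw [h3, ← Finset.prod_mul_distrib]
  refine Finset.prod_congr rfl fun e _ => ?_
  split_ifs <;> simp

/-- The graph with the coins `x.2` between `I` and its complement and `x.1` elsewhere. -/
def spliceGraph {n : ℕ} (I : Finset (Fin n))
    (x : (Sym2 (Fin n) → Prop) × (Fin n → Fin n → Prop)) : SimpleGraph (Fin n) :=
  SimpleGraph.fromEdgeSet {e | splice I x e}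

theorem integral_binomialRandom (n : ℕ) (p : unitInterval) (I : Finset (Fin n))
    (F : SimpleGraph (Fin n) → ℝ) :
    ∫ G, F G ∂SimpleGraph.binomialRandom (Fin n) p =
      ∫ H, ∫ S, F (spliceGraph I (H, S))
        ∂(Measure.pi fun _ : Fin n => Measure.pi fun _ : Fin n => coin p)
        ∂(Measure.pi fun _ : Sym2 (Fin n) => coin p) := by
  rw [binomialRandom_eq_map_coin, integral_map (Measurable.of_discrete).aemeasurable
    (measurable_of_simpleGraph F).aestronglyMeasurable]
  conv_lhs => rw [pi_coin_eq_map_splice n p I]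
  rw [integral_map (Measurable.of_discrete).aemeasurable .of_discrete, integral_prod _ .of_finite]
  rfl

theorem spliceGraph_adj_of_mem_of_notMem {n : ℕ} {I : Finset (Fin n)}
    (x : (Sym2 (Fin n) → Prop) × (Fin n → Fin n → Prop)) {u w : Fin n} (hu : u ∈ I) (hw : w ∉ I) :
    (spliceGraph I x).Adj u w ↔ x.2 u w := by
  rw [spliceGraph, SimpleGraph.fromEdgeSet_adj]
  simp only [Set.mem_ofPred_eq, splice_cross x hu hw, and_iff_left_iff_imp]
  rintro - rfl
  exact hw hu

theorem spliceGraph_adj_of_mem_of_mem {n : ℕ} {I : Finset (Fin n)}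
    (x : (Sym2 (Fin n) → Prop) × (Fin n → Fin n → Prop)) {u w : Fin n} (hu : u ∈ I) (hw : w ∈ I) :
    (spliceGraph I x).Adj u w ↔ x.1 s(u, w) ∧ u ≠ w := by
  rw [spliceGraph, SimpleGraph.fromEdgeSet_adj]
  have : ¬ ∃ u' ∈ I, ∃ w' ∉ I, s(u, w) = s(u', w') := by
    rintro ⟨u', hu', w', hw', h⟩
    rw [Sym2.eq_iff] at h
    rcases h with ⟨rfl, rfl⟩ | ⟨rfl, rfl⟩
    · exact hw' hw
    · exact hw' hu
  simp only [Set.mem_ofPred_eq, splice_of_not_cross x this]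

/-! ### Calls made in one round -/

theorem partnerLaw_congr {n : ℕ} {G G' : SimpleGraph (Fin n)} {u : Fin n}
    (h : G.neighborSet u = G'.neighborSet u) : partnerLaw G u = partnerLaw G' u := by
  unfold partnerLaw
  rw [h]

theorem partnerLaw_real_singleton_of_adj {n : ℕ} {G : SimpleGraph (Fin n)} {u v : Fin n}
    (h : G.Adj u v) : (partnerLaw G u).real {v} = ((G.neighborSet u).ncard : ℝ)⁻¹ := by
  have hv : v ∈ G.neighborSet u := h
  rw [partnerLaw, if_pos ⟨v, hv⟩, measureReal_def, uniformOn,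
    cond_apply (Set.toFinite _).measurableSet, Set.inter_singleton_of_mem hv, Measure.count_singleton,
    mul_one, Measure.count_apply_finite _ (Set.toFinite _), ENNReal.toReal_inv,
    ENNReal.toReal_natCast, Set.ncard_eq_toFinset_card _ (Set.toFinite _)]

theorem partnerLaw_real_singleton_of_not_adj {n : ℕ} {G : SimpleGraph (Fin n)} {u v : Fin n}
    (h : ¬ G.Adj u v) (huv : u ≠ v) : (partnerLaw G u).real {v} = 0 := by
  have hv : v ∉ G.neighborSet u := h
  rw [partnerLaw, measureReal_def]
  split_ifs with h'
  · rw [uniformOn, cond_apply (Set.toFinite _).measurableSet, Set.inter_singleton_eq_empty.2 hv]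
    simp
  · simp [huv]

theorem roundLaw_real_eq_integral {n : ℕ} (p : unitInterval) (A : Set (Fin n → Fin n)) :
    (roundLaw n p).real A =
      ∫ G, (Measure.pi fun v => partnerLaw G v).real A ∂SimpleGraph.binomialRandom (Fin n) p := by
  rw [measureReal_def, roundLaw, Measure.bind_apply .of_discrete
    (measurable_of_simpleGraph _).aemeasurable]
  exact (integral_toReal (measurable_of_simpleGraph _).aemeasurable
    (.of_forall fun _ => measure_lt_top _ _)).symm

theorem roundLaw_real_forall_notMem {n : ℕ} (p : unitInterval) (I V : Finset (Fin n)) :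
    (roundLaw n p).real {c | ∀ u ∈ I, c u ∉ V} =
      ∫ G, ∏ u ∈ I, (1 - ∑ v ∈ V, (partnerLaw G u).real {v})
        ∂SimpleGraph.binomialRandom (Fin n) p := by
  rw [roundLaw_real_eq_integral]
  congr 1 with G
  have : {c : Fin n → Fin n | ∀ u ∈ I, c u ∉ V} = (I : Set (Fin n)).pi fun _ => (V : Set (Fin n))ᶜ := by
    ext c; simp [Set.mem_pi]
  rw [this, measureReal_def, Measure.pi_pi_finset, ENNReal.toReal_prod]
  refine Finset.prod_congr rfl fun u _ => ?_
  rw [← measureReal_def, probReal_compl_eq_one_sub V.measurableSet, sum_measureReal_singleton]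

theorem roundLaw_real_call {n : ℕ} (p : unitInterval) (u v : Fin n) :
    (roundLaw n p).real {c | c u = v} =
      ∫ G, (partnerLaw G u).real {v} ∂SimpleGraph.binomialRandom (Fin n) p := by
  rw [roundLaw_real_eq_integral]
  congr 1 with G
  have : {c : Fin n → Fin n | c u = v} = ((({u} : Finset (Fin n)) : Set (Fin n))).pi
      fun _ => ({v} : Set (Fin n)) := by
    ext c; simp
  rw [this, measureReal_def, Measure.pi_pi_finset, Finset.prod_singleton, measureReal_def]

/-- The probability that `u ∈ I` calls `v ∉ I`, given the coins `H` inside `I`. -/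
noncomputable def callProb {n : ℕ} (p : unitInterval) (I : Finset (Fin n))
    (u v : Fin n) (H : Sym2 (Fin n) → Prop) : ℝ :=
  ∫ s, (partnerLaw (spliceGraph I (H, fun _ => s)) u).real {v} ∂Measure.pi fun _ : Fin n => coin p

/-- The neighbors of `u ∈ I` are determined by the coins inside `I` and by row `u` of the crossing
coins; pairs outside `I` and other rows play no role. -/
theorem partnerLaw_spliceGraph {n : ℕ} {I : Finset (Fin n)} (H : Sym2 (Fin n) → Prop)
    (S : Fin n → Fin n → Prop) {u : Fin n} (hu : u ∈ I) :
    partnerLaw (spliceGraph I (H, S)) u = partnerLaw (spliceGraph I (H, fun _ => S u)) u := by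
  refine partnerLaw_congr ?_
  ext w
  by_cases hw : w ∈ I
  · simp [spliceGraph_adj_of_mem_of_mem _ hu hw]
  · simp [spliceGraph_adj_of_mem_of_notMem _ hu hw]

/-- For fixed `H` the factors depend on different rows of crossing coins, so the expectation of the
product factorizes; only the average over `H` remains outside. -/
theorem integral_prod_callProb {n : ℕ} (p : unitInterval) (I V : Finset (Fin n)) :
    ∫ G, ∏ u ∈ I, (1 - ∑ v ∈ V, (partnerLaw G u).real {v})
        ∂SimpleGraph.binomialRandom (Fin n) p =
      ∫ H, ∏ u ∈ I, (1 - ∑ v ∈ V, callProb p I u v H)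
        ∂Measure.pi fun _ : Sym2 (Fin n) => coin p := by
  rw [integral_binomialRandom n p I]
  congr 1 with H
  have h1 : ∀ S : Fin n → Fin n → Prop,
      ∏ u ∈ I, (1 - ∑ v ∈ V, (partnerLaw (spliceGraph I (H, S)) u).real {v}) =
      ∏ u, (if u ∈ I then
        (1 - ∑ v ∈ V, (partnerLaw (spliceGraph I (H, fun _ => S u)) u).real {v}) else 1) := by
    intro S
    rw [← Finset.prod_filter, Finset.filter_mem_eq_inter, Finset.univ_inter]
    refine Finset.prod_congr rfl fun u hu => ?_
    rw [partnerLaw_spliceGraph H S hu]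
  simp only [h1]
  rw [integral_fintype_prod_eq_prod (μ := fun _ : Fin n => Measure.pi fun _ : Fin n => coin p)
    (fun u s => if u ∈ I then
        (1 - ∑ v ∈ V, (partnerLaw (spliceGraph I (H, fun _ => s)) u).real {v}) else 1)]
  conv_rhs => rw [← Finset.univ_inter I, ← Finset.filter_mem_eq_inter, Finset.prod_filter]
  refine Finset.prod_congr rfl fun u _ => ?_
  split_ifs with hu
  · rw [integral_sub .of_finite .of_finite, integral_finsetSum _ fun _ _ => .of_finite]
    simp [callProb]
  · simp

theorem integral_callProb {n : ℕ} (p : unitInterval) {I : Finset (Fin n)} {u : Fin n} (hu : u ∈ I)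
    (v : Fin n) :
    ∫ H, callProb p I u v H ∂(Measure.pi fun _ : Sym2 (Fin n) => coin p) =
      ∫ G, (partnerLaw G u).real {v} ∂SimpleGraph.binomialRandom (Fin n) p := by
  rw [integral_binomialRandom n p I]
  congr 1 with H
  simp only [partnerLaw_spliceGraph H _ hu]
  rw [callProb, ← integral_map (φ := fun S : Fin n → Fin n → Prop => S u)
    (f := fun s => (partnerLaw (spliceGraph I (H, fun _ => s)) u).real {v})
    (Measurable.of_discrete).aemeasurable .of_discrete]
  rw [(measurePreserving_eval (fun _ : Fin n => Measure.pi fun _ : Fin n => coin p) u).map_eq]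

theorem callProb_nonneg {n : ℕ} (p : unitInterval) (I : Finset (Fin n)) (u v : Fin n)
    (H : Sym2 (Fin n) → Prop) : 0 ≤ callProb p I u v H :=
  integral_nonneg fun _ => measureReal_nonneg

/-- A call needs the edge between `u` and `v`, whose coin is a crossing coin and therefore not fixed
by `H`. -/
theorem callProb_le {n : ℕ} (p : unitInterval) {I : Finset (Fin n)} {u v : Fin n} (hu : u ∈ I)
    (hv : v ∉ I) (H : Sym2 (Fin n) → Prop) : callProb p I u v H ≤ p := by
  have h1 : ∫ s, Set.indicator {b : Prop | b} 1 (s v) ∂(Measure.pi fun _ : Fin n => coin p) =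
      (p : ℝ) := by
    rw [← integral_map (φ := fun s : Fin n → Prop => s v)
      (f := Set.indicator {b : Prop | b} (1 : Prop → ℝ))
      (Measurable.of_discrete).aemeasurable .of_discrete,
      (measurePreserving_eval (fun _ : Fin n => coin p) v).map_eq,
      integral_indicator_one .of_discrete, coin_real_singleton_true]
  rw [← h1]
  refine integral_mono .of_finite .of_finite fun s => ?_
  by_cases hs : s v
  · simp [hs, measureReal_le_one]
  · rw [partnerLaw_real_singleton_of_not_adj]
    · simp [hs]
    · rwa [spliceGraph_adj_of_mem_of_notMem _ hu hv]
    · rintro rfl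
      exact hv hu

theorem callProb_update {n : ℕ} (p : unitInterval) {I : Finset (Fin n)} {u : Fin n} (hu : u ∈ I)
    (v : Fin n) (H H' : Sym2 (Fin n) → Prop) (h : ∀ w ∈ I, u ≠ w → H s(u, w) = H' s(u, w)) :
    callProb p I u v H = callProb p I u v H' := by
  unfold callProb
  congr 1 with s
  rw [partnerLaw_congr]
  ext w
  by_cases hw : w ∈ I
  · by_cases huw : u = w
    · simp [huw]
    · simp [spliceGraph_adj_of_mem_of_mem _ hu hw, h w hw huw]
  · simp [spliceGraph_adj_of_mem_of_notMem _ hu hw]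

/-- The probability that a given node is not isolated. -/
noncomputable def nonisolatedProb (n : ℕ) (p : unitInterval) : ℝ := 1 - (1 - (p : ℝ)) ^ (n - 1)

/-- For `I = {u}` there is no pair of distinct nodes inside `I`, so nothing depends on `H` and only
the row of `u` is averaged. -/
theorem integral_partnerLaw_eq_callProb {n : ℕ} (p : unitInterval) (u v : Fin n) :
    ∫ G, (partnerLaw G u).real {v} ∂SimpleGraph.binomialRandom (Fin n) p =
      callProb p {u} u v fun _ => False := by
  rw [← integral_callProb p (Finset.mem_singleton_self u) v]
  have : ∀ H, callProb p {u} u v H = callProb p {u} u v fun _ => False := fun H =>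
    callProb_update p (Finset.mem_singleton_self u) v _ _ fun w hw huw =>
      absurd (Finset.mem_singleton.1 hw).symm huw
  simp [this]

theorem neighborSet_spliceGraph_singleton {n : ℕ} (u : Fin n) (H : Sym2 (Fin n) → Prop)
    (s : Fin n → Prop) :
    (spliceGraph {u} (H, fun _ => s)).neighborSet u = {w | w ≠ u ∧ s w} := by
  ext w
  by_cases hw : w ∈ ({u} : Finset (Fin n))
  · rw [Finset.mem_singleton] at hw
    simp [hw]
  · have := spliceGraph_adj_of_mem_of_notMem (H, fun _ => s) (Finset.mem_singleton_self u) hw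
    rw [Finset.mem_singleton] at hw
    simp [this, hw]

/-- The partner differs from `u` exactly when `u` has a neighbor, that is, when some coin in its row
shows an edge. -/
theorem sum_integral_partnerLaw {n : ℕ} (p : unitInterval) (u : Fin n) :
    ∑ v ∈ {u}ᶜ, ∫ G, (partnerLaw G u).real {v} ∂SimpleGraph.binomialRandom (Fin n) p =
      nonisolatedProb n p := by
  classical
  simp only [integral_partnerLaw_eq_callProb]
  unfold callProb
  rw [← integral_finsetSum _ fun _ _ => .of_finite]
  have h1 : ∀ s : Fin n → Prop,
      ∑ v ∈ {u}ᶜ, (partnerLaw (spliceGraph {u} (fun _ => False, fun _ => s)) u).real {v} =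
        1 - ∏ w, (if w ≠ u then Set.indicator {b : Prop | ¬ b} 1 (s w) else (1 : ℝ)) := by
    intro s
    rw [sum_measureReal_singleton, Finset.coe_compl, Finset.coe_singleton,
      probReal_compl_eq_one_sub .of_discrete]
    congr 1
    rw [← Finset.prod_filter]
    by_cases hs : ∃ w, w ≠ u ∧ s w
    · obtain ⟨w, hw, hsw⟩ := hs
      rw [Finset.prod_eq_zero (i := w) (by simp [hw]) (by simp [hsw]), partnerLaw, if_pos,
        measureReal_def, uniformOn, cond_apply (Set.toFinite _).measurableSet,
        Set.inter_singleton_eq_empty.2 (by simp)]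
      · simp
      · rw [neighborSet_spliceGraph_singleton]
        exact ⟨w, hw, hsw⟩
    · rw [Finset.prod_eq_one, partnerLaw, if_neg]
      · rw [measureReal_def, Measure.dirac_apply_of_mem (Set.mem_singleton u), ENNReal.toReal_one]
      · rw [neighborSet_spliceGraph_singleton]
        rintro ⟨w, hw⟩
        exact hs ⟨w, hw⟩
      · intro w hw
        have : ¬ s w := fun h => hs ⟨w, by simpa using hw, h⟩
        simp [this]
  simp only [h1]
  rw [integral_sub .of_finite .of_finite,
    integral_fintype_prod_eq_prod (μ := fun _ : Fin n => coin p)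
      (fun w b => if w ≠ u then Set.indicator {b : Prop | ¬ b} 1 b else (1 : ℝ))]
  have h2 : ∀ w : Fin n, ∫ b, (if w ≠ u then Set.indicator {b : Prop | ¬ b} 1 b else (1 : ℝ)) ∂coin p =
      if w ≠ u then 1 - (p : ℝ) else 1 := by
    intro w
    split_ifs
    · rw [integral_indicator_one .of_discrete, coin_real_singleton_false]
    · simp
  simp only [h2]
  rw [← Finset.prod_filter, Finset.prod_const, nonisolatedProb, Finset.filter_ne']
  simp

/-- Exchanging the coins of `v` and `v'` preserves the product law and the number of neighbors of
`u`. -/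
theorem callProb_singleton_eq {n : ℕ} (p : unitInterval) {u v v' : Fin n} (hv : v ≠ u)
    (hv' : v' ≠ u) :
    (callProb p {u} u v fun _ => False) = callProb p {u} u v' fun _ => False := by
  classical
  have hT : (Measure.pi fun _ : Fin n => coin p) =
      (Measure.pi fun _ : Fin n => coin p).map fun s => s ∘ Equiv.swap v v' := by
    refine Measure.pi_eq fun t _ => ?_
    rw [Measure.map_apply .of_discrete .of_discrete]
    have : (fun s : Fin n → Prop => s ∘ Equiv.swap v v') ⁻¹' Set.univ.pi t =
        Set.univ.pi (t ∘ Equiv.swap v v') := by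
      ext s
      simp only [Set.mem_preimage, Set.mem_univ_pi, Function.comp]
      constructor
      · intro h w
        simpa using h (Equiv.swap v v' w)
      · intro h w
        simpa using h (Equiv.swap v v' w)
    rw [this, Measure.pi_pi]
    exact Equiv.prod_comp (Equiv.swap v v') fun w => coin p (t w)
  unfold callProb
  conv_lhs => rw [hT]
  rw [integral_map (Measurable.of_discrete).aemeasurable .of_discrete]
  congr 1 with s
  have hset : {w | w ≠ u ∧ s (Equiv.swap v v' w)} =
      Equiv.swap v v' ⁻¹' {w | w ≠ u ∧ s w} := by
    ext w
    simp only [Set.mem_ofPred_eq, Set.mem_preimage]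
    refine and_congr_left fun _ => not_congr ?_
    rw [Equiv.swap_apply_eq_iff, Equiv.swap_apply_of_ne_of_ne hv.symm hv'.symm]
  have hadj : ∀ (s : Fin n → Prop) {w : Fin n}, w ≠ u →
      ((spliceGraph {u} (fun _ => False, fun _ => s)).Adj u w ↔ s w) := fun s w hw =>
    spliceGraph_adj_of_mem_of_notMem _ (Finset.mem_singleton_self u) (by simpa using hw)
  by_cases hs : s v'
  · rw [partnerLaw_real_singleton_of_adj, partnerLaw_real_singleton_of_adj,
      neighborSet_spliceGraph_singleton, neighborSet_spliceGraph_singleton]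
    · simp only [Function.comp]
      rw [hset, Set.ncard_preimage_of_injective_subset_range (Equiv.injective _)]
      simp
    · exact (hadj _ hv').2 hs
    · exact (hadj _ hv).2 (by simpa using hs)
  · rw [partnerLaw_real_singleton_of_not_adj _ hv.symm,
      partnerLaw_real_singleton_of_not_adj _ hv'.symm]
    · rwa [hadj _ hv']
    · rw [hadj _ hv]
      simpa using hs

theorem integral_partnerLaw {n : ℕ} (p : unitInterval) {u v : Fin n} (hv : v ≠ u) :
    ∫ G, (partnerLaw G u).real {v} ∂SimpleGraph.binomialRandom (Fin n) p =
      nonisolatedProb n p / (n - 1) := by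
  have h := sum_integral_partnerLaw p u
  simp only [integral_partnerLaw_eq_callProb] at h ⊢
  rw [Finset.sum_congr rfl fun w hw => callProb_singleton_eq p (v' := v) (by simpa using hw) hv,
    Finset.sum_const, Finset.card_compl, Finset.card_singleton, Fintype.card_fin, nsmul_eq_mul] at h
  have hn : 1 < n := by
    have := u.2; have := v.2
    by_contra hn
    exact hv (Fin.ext (by omega))
  have h1 : (1 : ℝ) < n := by exact_mod_cast hn
  rw [← h, Nat.cast_sub hn.le, Nat.cast_one, mul_div_cancel_left₀ _ (by linarith)]

/-! ### Variance of functions of independent coins with bounded differences -/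

theorem integral_sub_sq {Ω : Type*} [MeasurableSpace Ω] (μ : Measure Ω)
    [IsProbabilityMeasure μ] [Finite Ω] [DiscreteMeasurableSpace Ω] (f : Ω → ℝ) :
    ∫ x, (f x - ∫ y, f y ∂μ) ^ 2 ∂μ = ∫ x, f x ^ 2 ∂μ - (∫ x, f x ∂μ) ^ 2 := by
  have h : ∀ x, (f x - ∫ y, f y ∂μ) ^ 2 =
      f x ^ 2 - 2 * (∫ y, f y ∂μ) * f x + (∫ y, f y ∂μ) ^ 2 := fun x => by ring
  simp only [h]
  rw [integral_add .of_finite .of_finite, integral_sub .of_finite .of_finite, integral_const_mul]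
  simp
  ring

theorem integral_pi_coin_succ (p : unitInterval) (m : ℕ) (f : (Fin (m + 1) → Prop) → ℝ) :
    ∫ b, f b ∂(Measure.pi fun _ : Fin (m + 1) => coin p) =
      p * (∫ b, f (Fin.cons True b) ∂Measure.pi fun _ : Fin m => coin p) +
      (1 - p) * ∫ b, f (Fin.cons False b) ∂Measure.pi fun _ : Fin m => coin p := by
  rw [← integral_coin p fun x => ∫ b, f (Fin.cons x b) ∂Measure.pi fun _ : Fin m => coin p,
    ← ((measurePreserving_piFinSuccAbove (fun _ : Fin (m + 1) => coin p) 0).symm).integral_comp',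
    integral_prod _ .of_finite]
  simp_rw [MeasurableEquiv.piFinSuccAbove_symm_apply, Fin.insertNthEquiv, Equiv.coe_fn_mk,
    Fin.insertNth_zero]
  rfl

/-- Efron-Stein by induction: conditioning on the first coin, with conditional means `A` and `B`,
splits the variance into the averaged conditional variances plus `p (1 - p) (A - B)²`. The factor
`p` in front of the sum is essential later, because the number of relevant coins is quadratic in the
number of informed nodes. -/
theorem variance_le_of_bounded_differences_fin (p : unitInterval) (m : ℕ) (c : Fin m → ℝ)
    (f : (Fin m → Prop) → ℝ)
    (hf : ∀ i b b', (∀ j, j ≠ i → b j = b' j) → |f b - f b'| ≤ c i) :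
    ∫ b, f b ^ 2 ∂(Measure.pi fun _ : Fin m => coin p) -
      (∫ b, f b ∂Measure.pi fun _ : Fin m => coin p) ^ 2 ≤ p * ∑ i, c i ^ 2 := by
  induction m with
  | zero =>
    have : ∀ b, f b = f default := fun b => congrArg f (Subsingleton.elim _ _)
    simp [this]
  | succ m ih =>
    rw [integral_pi_coin_succ, integral_pi_coin_succ, Fin.sum_univ_succ]
    have hs : ∀ x, ∀ i b b', (∀ j, j ≠ i → b j = b' j) →
        |f (Fin.cons x b) - f (Fin.cons x b')| ≤ c (Fin.succ i) := by
      intro x i b b' h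
      refine hf _ _ _ fun j hj => ?_
      induction j using Fin.cases with
      | zero => rfl
      | succ j =>
        simp only [Fin.cons_succ]
        exact h j fun e => hj (by rw [e])
    have h1 := ih (fun i => c i.succ) (fun b => f (Fin.cons True b)) (hs True)
    have h2 := ih (fun i => c i.succ) (fun b => f (Fin.cons False b)) (hs False)
    have h3 : |(∫ b, f (Fin.cons True b) ∂Measure.pi fun _ : Fin m => coin p) -
        ∫ b, f (Fin.cons False b) ∂Measure.pi fun _ : Fin m => coin p| ≤ c 0 := by
      rw [← integral_sub .of_finite .of_finite]
      refine (abs_integral_le_integral_abs).trans ?_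
      calc _ ≤ ∫ b, c 0 ∂Measure.pi fun _ : Fin m => coin p := by
            refine integral_mono .of_finite .of_finite fun b => ?_
            refine hf _ _ _ fun j hj => ?_
            induction j using Fin.cases with
            | zero => exact absurd rfl hj
            | succ j => simp
        _ = c 0 := by simp
    set A := ∫ b, f (Fin.cons True b) ∂Measure.pi fun _ : Fin m => coin p
    set B := ∫ b, f (Fin.cons False b) ∂Measure.pi fun _ : Fin m => coin p
    have h4 : (A - B) ^ 2 ≤ c 0 ^ 2 := by
      rw [← sq_abs]
      exact pow_le_pow_left₀ (abs_nonneg _) h3 2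
    have hp0 : (0 : ℝ) ≤ p := p.2.1
    have hp1 : (0 : ℝ) ≤ 1 - p := by linarith [p.2.2]
    have h5 : (p : ℝ) * (1 - p) * (A - B) ^ 2 ≤ p * c 0 ^ 2 := by
      rw [mul_assoc]
      refine mul_le_mul_of_nonneg_left ?_ hp0
      nlinarith [sq_nonneg (A - B)]
    have h6 := mul_le_mul_of_nonneg_left h1 hp0
    have h7 := mul_le_mul_of_nonneg_left h2 hp1
    nlinarith

theorem variance_le_of_bounded_differences {ι : Type*} [Fintype ι] (p : unitInterval)
    (c : ι → ℝ) (f : (ι → Prop) → ℝ)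
    (hf : ∀ i b b', (∀ j, j ≠ i → b j = b' j) → |f b - f b'| ≤ c i) :
    ∫ b, (f b - ∫ b', f b' ∂Measure.pi fun _ : ι => coin p) ^ 2
      ∂(Measure.pi fun _ : ι => coin p) ≤ p * ∑ i, c i ^ 2 := by
  rw [integral_sub_sq]
  let e := (Fintype.equivFin ι).symm
  have hT := measurePreserving_piCongrLeft (α := fun _ : ι => Prop) (fun _ => coin p) e
  rw [← hT.integral_comp', ← hT.integral_comp', ← e.sum_comp]
  refine variance_le_of_bounded_differences_fin p _ (fun i => c (e i)) _ fun i b b' h => ?_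
  refine hf _ _ _ fun j hj => ?_
  have := h (e.symm j) fun h' => hj (by rw [← h', Equiv.apply_symm_apply])
  rw [MeasurableEquiv.coe_piCongrLeft, ← e.apply_symm_apply j, Equiv.piCongrLeft_apply_apply,
    Equiv.piCongrLeft_apply_apply]
  exact this

/-! ### The probability of not being called -/

theorem abs_prod_sub_prod_le {ι : Type*} (s : Finset ι) (x y : ι → ℝ)
    (hx : ∀ i ∈ s, |x i| ≤ 1) (hy : ∀ i ∈ s, |y i| ≤ 1) :
    |∏ i ∈ s, x i - ∏ i ∈ s, y i| ≤ ∑ i ∈ s, |x i - y i| := by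
  classical
  induction s using Finset.induction_on with
  | empty => simp
  | insert j s hj ih =>
    rw [Finset.prod_insert hj, Finset.prod_insert hj, Finset.sum_insert hj]
    have h1 := ih (fun i hi => hx i (Finset.mem_insert_of_mem hi))
      (fun i hi => hy i (Finset.mem_insert_of_mem hi))
    have h2 : |∏ i ∈ s, y i| ≤ 1 := by
      rw [Finset.abs_prod]
      exact Finset.prod_le_one (fun _ _ => abs_nonneg _)
        fun i hi => hy i (Finset.mem_insert_of_mem hi)
    have h3 := hx j (Finset.mem_insert_self _ _)
    calc |x j * ∏ i ∈ s, x i - y j * ∏ i ∈ s, y i|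
        = |x j * (∏ i ∈ s, x i - ∏ i ∈ s, y i) + (x j - y j) * ∏ i ∈ s, y i| := by ring_nf
      _ ≤ |x j| * |∏ i ∈ s, x i - ∏ i ∈ s, y i| + |x j - y j| * |∏ i ∈ s, y i| := by
          rw [← abs_mul, ← abs_mul]
          exact abs_add_le _ _
      _ ≤ 1 * |∏ i ∈ s, x i - ∏ i ∈ s, y i| + |x j - y j| * 1 := by gcongr
      _ ≤ _ := by linarith

/-- The coin of a pair inside `I` is visible only to its at most two endpoints, and each of their
call probabilities stays in `[0, p]`. -/
theorem sum_abs_callProb_sub_le {n : ℕ} (p : unitInterval) {I : Finset (Fin n)} {v : Fin n}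
    (hv : v ∉ I) (e : Sym2 (Fin n)) (H H' : Sym2 (Fin n) → Prop)
    (h : ∀ j, j ≠ e → H j = H' j) :
    ∑ u ∈ I, |callProb p I u v H - callProb p I u v H'| ≤ if e ∈ I.sym2 then 2 * (p : ℝ) else 0 := by
  classical
  have h0 : ∀ u ∈ I, (u ∉ e ∨ e ∉ I.sym2) → callProb p I u v H = callProb p I u v H' := by
    intro u hu hue
    refine callProb_update p hu v _ _ fun w hw _ => h _ ?_
    rintro rfl
    rcases hue with hue | hue
    · exact hue (Sym2.mem_mk_left _ _)
    · exact hue (Finset.mk_mem_sym2_iff.2 ⟨hu, hw⟩)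
  split_ifs with he
  · induction e with | _ x y
    have hxy := Finset.mk_mem_sym2_iff.1 he
    have h1 : ∀ u ∈ I, u ∉ ({x, y} : Finset (Fin n)) →
        |callProb p I u v H - callProb p I u v H'| = 0 := by
      intro u hu huxy
      rw [h0 u hu (Or.inl (by simpa using huxy)), sub_self, abs_zero]
    have hsub : ({x, y} : Finset (Fin n)) ⊆ I := by
      intro z hz
      simp only [Finset.mem_insert, Finset.mem_singleton] at hz
      rcases hz with rfl | rfl
      exacts [hxy.1, hxy.2]
    rw [← Finset.sum_subset hsub h1]
    have h2 : ∀ u ∈ ({x, y} : Finset (Fin n)),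
        |callProb p I u v H - callProb p I u v H'| ≤ p := by
      intro u hu
      have := hsub hu
      rw [abs_le]
      constructor <;> linarith [callProb_nonneg p I u v H, callProb_nonneg p I u v H',
        callProb_le p this hv H, callProb_le p this hv H']
    refine (Finset.sum_le_card_nsmul _ _ _ h2).trans ?_
    rw [nsmul_eq_mul]
    refine mul_le_mul_of_nonneg_right ?_ p.2.1
    exact_mod_cast Finset.card_le_two
  · exact (Finset.sum_eq_zero fun u hu => by rw [h0 u hu (Or.inr he), sub_self, abs_zero]).le

theorem sum_sq_sym2_le {n : ℕ} (p : unitInterval) (I : Finset (Fin n)) :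
    p * ∑ e : Sym2 (Fin n), (if e ∈ I.sym2 then 2 * (p : ℝ) else 0) ^ 2 ≤
      4 * (I.card : ℝ) ^ 2 * p ^ 3 := by
  have h : ∀ e : Sym2 (Fin n), (if e ∈ I.sym2 then 2 * (p : ℝ) else 0) ^ 2 =
      if e ∈ I.sym2 then 4 * (p : ℝ) ^ 2 else 0 := by
    intro e
    split_ifs <;> ring
  simp only [h]
  rw [← Finset.sum_filter, Finset.filter_mem_eq_inter, Finset.univ_inter, Finset.sum_const,
    nsmul_eq_mul, Finset.card_sym2]
  have h1 : (I.card + 1).choose 2 ≤ I.card ^ 2 := by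
    rw [Nat.choose_two_right]
    apply Nat.div_le_of_le_mul
    rcases Nat.eq_zero_or_pos I.card with h | h
    · simp [h]
    · simp only [Nat.add_sub_cancel]
      nlinarith
  have h2 : (((I.card + 1).choose 2 : ℕ) : ℝ) ≤ (I.card : ℝ) ^ 2 := by exact_mod_cast h1
  have hp0 : (0 : ℝ) ≤ p := p.2.1
  calc (p : ℝ) * (((I.card + 1).choose 2 : ℕ) * (4 * (p : ℝ) ^ 2))
      ≤ p * ((I.card : ℝ) ^ 2 * (4 * (p : ℝ) ^ 2)) := by gcongr
    _ = _ := by ring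

theorem variance_sum_callProb_le {n : ℕ} (p : unitInterval) {I : Finset (Fin n)} {v : Fin n}
    (hv : v ∉ I) :
    ∫ H, (∑ u ∈ I, callProb p I u v H -
        ∫ H', ∑ u ∈ I, callProb p I u v H' ∂Measure.pi fun _ : Sym2 (Fin n) => coin p) ^ 2
      ∂(Measure.pi fun _ : Sym2 (Fin n) => coin p) ≤ 4 * (I.card : ℝ) ^ 2 * p ^ 3 := by
  refine (variance_le_of_bounded_differences p (fun e => if e ∈ I.sym2 then 2 * (p : ℝ) else 0) _
    fun e H H' h => ?_).trans (sum_sq_sym2_le p I)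
  rw [← Finset.sum_sub_distrib]
  exact (Finset.abs_sum_le_sum_abs _ _).trans (sum_abs_callProb_sub_le p hv e H H' h)

/-- Factors of absolute value at most 1 make the product no more sensitive to a coin than the sum of
the call probabilities is. -/
theorem variance_prod_callProb_le {n : ℕ} (p : unitInterval) {I : Finset (Fin n)} {v : Fin n}
    (hv : v ∉ I) :
    ∫ H, (∏ u ∈ I, (1 - callProb p I u v H) -
        ∫ H', ∏ u ∈ I, (1 - callProb p I u v H') ∂Measure.pi fun _ : Sym2 (Fin n) => coin p) ^ 2
      ∂(Measure.pi fun _ : Sym2 (Fin n) => coin p) ≤ 4 * (I.card : ℝ) ^ 2 * p ^ 3 := by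
  refine (variance_le_of_bounded_differences p (fun e => if e ∈ I.sym2 then 2 * (p : ℝ) else 0) _
    fun e H H' h => ?_).trans (sum_sq_sym2_le p I)
  have h1 : ∀ H, ∀ u ∈ I, |1 - callProb p I u v H| ≤ 1 := by
    intro H u hu
    rw [abs_le]
    constructor <;> linarith [callProb_nonneg p I u v H, callProb_le p hu hv H, p.2.2]
  refine (abs_prod_sub_prod_le I _ _ (h1 H) (h1 H')).trans ?_
  refine le_trans (le_of_eq (Finset.sum_congr rfl fun u _ => ?_))
    (sum_abs_callProb_sub_le p hv e H H' h)
  rw [sub_sub_sub_cancel_left, abs_sub_comm]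

/-- The probability that no node of `I` calls a node of `V`. -/
noncomputable def missProb {n : ℕ} (p : unitInterval) (I V : Finset (Fin n)) : ℝ :=
  (roundLaw n p).real {c | ∀ u ∈ I, c u ∉ V}

theorem missProb_eq_integral {n : ℕ} (p : unitInterval) (I V : Finset (Fin n)) :
    missProb p I V = ∫ H, ∏ u ∈ I, (1 - ∑ v ∈ V, callProb p I u v H)
        ∂Measure.pi fun _ : Sym2 (Fin n) => coin p := by
  rw [missProb, roundLaw_real_forall_notMem, integral_prod_callProb]

theorem missProb_singleton {n : ℕ} (p : unitInterval) (I : Finset (Fin n)) (v : Fin n) :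
    missProb p I {v} = ∫ H, ∏ u ∈ I, (1 - callProb p I u v H)
        ∂Measure.pi fun _ : Sym2 (Fin n) => coin p := by
  simp only [missProb_eq_integral, Finset.sum_singleton]

theorem integral_sum_callProb {n : ℕ} (p : unitInterval) {I : Finset (Fin n)} {v : Fin n}
    (hv : v ∉ I) :
    ∫ H, ∑ u ∈ I, callProb p I u v H ∂(Measure.pi fun _ : Sym2 (Fin n) => coin p) =
      I.card * (nonisolatedProb n p / (n - 1)) := by
  rw [integral_finsetSum _ fun _ _ => .of_finite, Finset.sum_congr rfl fun u hu =>
    (integral_callProb p hu v).trans (integral_partnerLaw p fun h => hv (h ▸ hu)),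
    Finset.sum_const, nsmul_eq_mul]

/-- Given `H`, a caller reaches at most one of the two nodes, and `1 - x - y ≤ (1 - x) (1 - y)`, so
positive correlation can come only from `H`. That covariance is at most the mean of the two
variances. The bound `p ≤ 1/2` makes the factors `1 - x - y` nonnegative. -/
theorem missProb_pair_le {n : ℕ} (p : unitInterval) {I : Finset (Fin n)} {v v' : Fin n}
    (hp : (p : ℝ) ≤ 1 / 2) (hv : v ∉ I) (hv' : v' ∉ I) (hvv' : v ≠ v') :
    missProb p I {v, v'} - missProb p I {v} * missProb p I {v'} ≤ 4 * (I.card : ℝ) ^ 2 * p ^ 3 := by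
  have hV := variance_prod_callProb_le p hv
  have hV' := variance_prod_callProb_le p hv'
  rw [← missProb_singleton] at hV hV'
  have h1 : missProb p I {v, v'} ≤
      ∫ H, (∏ u ∈ I, (1 - callProb p I u v H)) * (∏ u ∈ I, (1 - callProb p I u v' H))
        ∂Measure.pi fun _ : Sym2 (Fin n) => coin p := by
    rw [missProb_eq_integral]
    refine integral_mono .of_finite .of_finite fun H => ?_
    simp only [← Finset.prod_mul_distrib, Finset.sum_pair hvv']
    refine Finset.prod_le_prod (fun u hu => ?_) fun u hu => ?_
    · linarith [callProb_le p hu hv H, callProb_le p hu hv' H]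
    · nlinarith [callProb_nonneg p I u v H, callProb_nonneg p I u v' H]
  set f := fun H => ∏ u ∈ I, (1 - callProb p I u v H)
  set g := fun H => ∏ u ∈ I, (1 - callProb p I u v' H)
  have hf : missProb p I {v} = ∫ H, f H ∂Measure.pi fun _ : Sym2 (Fin n) => coin p :=
    missProb_singleton p I v
  have hg : missProb p I {v'} = ∫ H, g H ∂Measure.pi fun _ : Sym2 (Fin n) => coin p :=
    missProb_singleton p I v'
  set α := missProb p I {v}
  set β := missProb p I {v'}
  have h2 : ∫ H, f H * g H ∂(Measure.pi fun _ : Sym2 (Fin n) => coin p) - α * β =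
      ∫ H, (f H - α) * (g H - β) ∂Measure.pi fun _ : Sym2 (Fin n) => coin p := by
    have : ∀ H, (f H - α) * (g H - β) = f H * g H - β * f H - α * g H + α * β := fun H => by ring
    simp only [this]
    rw [integral_add .of_finite .of_finite, integral_sub .of_finite .of_finite,
      integral_sub .of_finite .of_finite, integral_const_mul, integral_const_mul, ← hf, ← hg]
    simp
    ring
  have h3 : ∫ H, (f H - α) * (g H - β) ∂(Measure.pi fun _ : Sym2 (Fin n) => coin p) ≤
      ∫ H, ((f H - α) ^ 2 / 2 + (g H - β) ^ 2 / 2) ∂Measure.pi fun _ : Sym2 (Fin n) => coin p := by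
    refine integral_mono .of_finite .of_finite fun H => ?_
    change (f H - α) * (g H - β) ≤ (f H - α) ^ 2 / 2 + (g H - β) ^ 2 / 2
    nlinarith [sq_nonneg ((f H - α) - (g H - β))]
  rw [integral_add .of_finite .of_finite, integral_div, integral_div] at h3
  linarith

/-! ### Two-sided bounds for the probability of missing a single node -/

theorem exp_neg_add_sq_le {x : ℝ} (h0 : 0 ≤ x) (h1 : x ≤ 1 / 2) : Real.exp (-(x + x ^ 2)) ≤ 1 - x := by
  rw [Real.exp_neg, inv_le_comm₀ (Real.exp_pos _) (by linarith)]
  refine le_trans ?_ (Real.quadratic_le_exp_of_nonneg (by positivity : 0 ≤ x + x ^ 2))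
  rw [inv_le_iff_one_le_mul₀ (by linarith)]
  have : 0 ≤ x ^ 2 * ((1 - x) * (1 + x) ^ 2 / 2 - x) :=
    mul_nonneg (sq_nonneg x) (by nlinarith [mul_nonneg h0 (by linarith : 0 ≤ 1 / 2 - x)])
  nlinarith

/-- With `S` the sum of the call probabilities and `m` its mean, the product is at least `exp(-S - k
p²)`, and `exp(m - S) ≥ 1 + m - S` has a right side of mean 1. This is Jensen's inequality; no
variance bound is needed in this direction. -/
theorem le_missProb_singleton {n : ℕ} (p : unitInterval) {I : Finset (Fin n)} {v : Fin n}
    (hp : (p : ℝ) ≤ 1 / 2) (hv : v ∉ I) :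
    Real.exp (-(I.card * (nonisolatedProb n p / (n - 1) + p ^ 2))) ≤ missProb p I {v} := by
  rw [missProb_singleton]
  set m := (I.card : ℝ) * (nonisolatedProb n p / (n - 1)) with hm
  have h1 : ∫ H, Real.exp (-(I.card * (nonisolatedProb n p / (n - 1) + p ^ 2))) *
      (1 + m - ∑ u ∈ I, callProb p I u v H) ∂(Measure.pi fun _ : Sym2 (Fin n) => coin p) =
      Real.exp (-(I.card * (nonisolatedProb n p / (n - 1) + p ^ 2))) := by
    rw [integral_const_mul, integral_sub .of_finite .of_finite, integral_sum_callProb p hv]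
    simp [hm]
  rw [← h1]
  refine integral_mono .of_finite .of_finite fun H => ?_
  have h2 : ∏ u ∈ I, Real.exp (-(callProb p I u v H + p ^ 2)) ≤
      ∏ u ∈ I, (1 - callProb p I u v H) := by
    refine Finset.prod_le_prod (fun _ _ => (Real.exp_pos _).le) fun u hu => ?_
    have h3 := callProb_nonneg p I u v H
    have h4 := callProb_le p hu hv H
    refine le_trans ?_ (exp_neg_add_sq_le h3 (h4.trans hp))
    apply Real.exp_le_exp.2
    have : callProb p I u v H ^ 2 ≤ (p : ℝ) ^ 2 := pow_le_pow_left₀ h3 h4 2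
    linarith
  refine le_trans ?_ h2
  rw [← Real.exp_sum, Finset.sum_neg_distrib, Finset.sum_add_distrib, Finset.sum_const,
    nsmul_eq_mul]
  set S := ∑ u ∈ I, callProb p I u v H
  have h5 : -(S + (I.card : ℝ) * (p : ℝ) ^ 2) =
      -(I.card * (nonisolatedProb n p / (n - 1) + p ^ 2)) + (m - S) := by rw [hm]; ring
  rw [h5, Real.exp_add]
  refine mul_le_mul_of_nonneg_left ?_ (Real.exp_pos _).le
  linarith [Real.add_one_le_exp (m - S)]

theorem exp_le_one_add_add_sq {y a : ℝ} (ha : 0 ≤ a) (h : y ≤ a) :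
    Real.exp y ≤ 1 + y + Real.exp a * y ^ 2 := by
  have h1 : 1 ≤ Real.exp a := Real.one_le_exp ha
  by_cases hy : |y| ≤ 1
  · have := abs_le.1 (Real.abs_exp_sub_one_sub_id_le hy)
    nlinarith [sq_nonneg y]
  · rw [abs_le, not_and_or, not_le, not_le] at hy
    rcases hy with hy | hy
    · have : Real.exp y ≤ 1 := Real.exp_le_one_iff.2 (by linarith)
      nlinarith [sq_nonneg y]
    · have : Real.exp y ≤ Real.exp a := Real.exp_le_exp.2 h
      nlinarith [mul_nonneg (Real.exp_pos a).le (by nlinarith : 0 ≤ y ^ 2 - 1)]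

/-- The product is at most `exp(-S)`. Since `m - S ≤ k p`, `exp(m - S)` has a one-sided second-order
bound whose linear term integrates to 0 and whose quadratic term is controlled by the variance of
`S`. -/
theorem missProb_singleton_le {n : ℕ} (p : unitInterval) {I : Finset (Fin n)} {v : Fin n}
    (hv : v ∉ I) :
    missProb p I {v} ≤ Real.exp (-(I.card * (nonisolatedProb n p / (n - 1)))) *
      (1 + Real.exp (I.card * p) * (4 * (I.card : ℝ) ^ 2 * p ^ 3)) := by
  rw [missProb_singleton]
  have hV := variance_sum_callProb_le p hv
  rw [integral_sum_callProb p hv] at hV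
  set m := (I.card : ℝ) * (nonisolatedProb n p / (n - 1)) with hm
  have hp0 : (0 : ℝ) ≤ p := p.2.1
  have hmp : m ≤ I.card * p := by
    rw [hm, ← integral_sum_callProb p hv]
    calc _ ≤ ∫ H, (I.card * p : ℝ) ∂(Measure.pi fun _ : Sym2 (Fin n) => coin p) := by
          refine integral_mono .of_finite .of_finite fun H => ?_
          refine (Finset.sum_le_card_nsmul _ _ _ fun u hu => callProb_le p hu hv H).trans ?_
          rw [nsmul_eq_mul]
      _ = _ := by simp
  have hle : ∫ H, ∏ u ∈ I, (1 - callProb p I u v H) ∂(Measure.pi fun _ : Sym2 (Fin n) => coin p) ≤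
      ∫ H, Real.exp (-m) * (1 + (m - ∑ u ∈ I, callProb p I u v H) +
        Real.exp (I.card * p) * (∑ u ∈ I, callProb p I u v H - m) ^ 2)
        ∂(Measure.pi fun _ : Sym2 (Fin n) => coin p) := by
    refine integral_mono .of_finite .of_finite fun H => ?_
    have h2 : ∏ u ∈ I, (1 - callProb p I u v H) ≤ ∏ u ∈ I, Real.exp (-(callProb p I u v H)) := by
      refine Finset.prod_le_prod (fun u hu => ?_) fun u hu => ?_
      · linarith [callProb_le p hu hv H, p.2.2]
      · linarith [Real.add_one_le_exp (-(callProb p I u v H))]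
    refine h2.trans ?_
    rw [← Real.exp_sum, Finset.sum_neg_distrib]
    have hS : 0 ≤ ∑ u ∈ I, callProb p I u v H :=
      Finset.sum_nonneg fun u _ => callProb_nonneg p I u v H
    set S := ∑ u ∈ I, callProb p I u v H
    rw [show -S = -m + (m - S) by ring, Real.exp_add, show (S - m) ^ 2 = (m - S) ^ 2 by ring]
    refine mul_le_mul_of_nonneg_left ?_ (Real.exp_pos _).le
    exact exp_le_one_add_add_sq (by positivity) (by linarith)
  refine hle.trans ?_
  rw [integral_const_mul]
  refine mul_le_mul_of_nonneg_left ?_ (Real.exp_pos _).le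
  rw [integral_add .of_finite .of_finite, integral_add .of_finite .of_finite,
    integral_sub .of_finite .of_finite, integral_sum_callProb p hv]
  simp only [integral_const, probReal_univ, one_smul, ← hm, sub_self, add_zero]
  rw [integral_const_mul]
  have := mul_le_mul_of_nonneg_left hV (Real.exp_pos (I.card * p)).le
  linarith

/-! ### One round of the protocol -/

/-- One round leaves, in expectation, about `|Iᶜ| exp (-Q |I| / n)` nodes uninformed, with variance
of order `|I| |Iᶜ| / n`. -/
def OneStep (C Q : ℝ) (n : ℕ) (μ : Measure (Fin n → Fin n)) : Prop :=
  ∀ I : Finset (Fin n),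
    |∫ c, ((I ∪ I.image c)ᶜ.card : ℝ) ∂μ - Iᶜ.card * Real.exp (-(Q * I.card / n))| ≤
      C * Iᶜ.card * I.card / n ^ 2 ∧
    ∫ c, (((I ∪ I.image c)ᶜ.card : ℝ) - ∫ c', ((I ∪ I.image c')ᶜ.card : ℝ) ∂μ) ^ 2 ∂μ ≤
      C * I.card * Iᶜ.card / n

theorem card_compl_step {n : ℕ} (I : Finset (Fin n)) (c : Fin n → Fin n) :
    ((I ∪ I.image c)ᶜ.card : ℝ) =
      ∑ v ∈ Iᶜ, Set.indicator {c : Fin n → Fin n | ∀ u ∈ I, c u ∉ ({v} : Finset (Fin n))} 1 c := by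
  classical
  have : (I ∪ I.image c)ᶜ = Iᶜ.filter fun v => ∀ u ∈ I, c u ∉ ({v} : Finset (Fin n)) := by
    ext v
    simp only [Finset.mem_compl, Finset.mem_union, Finset.mem_image, not_or, not_exists, not_and,
      Finset.mem_filter, Finset.mem_singleton]
  rw [this, Finset.card_filter, Nat.cast_sum]
  refine Finset.sum_congr rfl fun v _ => ?_
  by_cases h : ∀ u ∈ I, c u ∉ ({v} : Finset (Fin n))
  · rw [if_pos h, Set.indicator_of_mem (by exact h)]
    simp
  · rw [if_neg h, Set.indicator_of_notMem (by exact h)]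
    simp

theorem integral_card_compl_step {n : ℕ} (p : unitInterval) (I : Finset (Fin n)) :
    ∫ c, ((I ∪ I.image c)ᶜ.card : ℝ) ∂roundLaw n p = ∑ v ∈ Iᶜ, missProb p I {v} := by
  simp only [card_compl_step]
  rw [integral_finsetSum _ fun _ _ => .of_finite]
  refine Finset.sum_congr rfl fun v _ => ?_
  rw [integral_indicator_one .of_discrete, missProb]

theorem integral_card_compl_step_sq {n : ℕ} (p : unitInterval) (I : Finset (Fin n)) :
    ∫ c, ((I ∪ I.image c)ᶜ.card : ℝ) ^ 2 ∂roundLaw n p =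
      ∑ v ∈ Iᶜ, ∑ v' ∈ Iᶜ, missProb p I {v, v'} := by
  simp only [card_compl_step, sq, Finset.sum_mul_sum]
  rw [integral_finsetSum _ fun _ _ => .of_finite]
  refine Finset.sum_congr rfl fun v _ => ?_
  rw [integral_finsetSum _ fun _ _ => .of_finite]
  refine Finset.sum_congr rfl fun v' _ => ?_
  rw [missProb, ← integral_indicator_one .of_discrete]
  congr 1 with c
  rw [← Pi.mul_apply (Set.indicator _ 1), ← Set.inter_indicator_one]
  congr 1
  ext c
  simp only [Set.mem_inter_iff, Set.mem_ofPred_eq, Finset.mem_singleton, Finset.mem_insert, not_or,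
    forall_and]

/-- The variance is the double sum of covariances of the indicators of being missed. A diagonal term
is at most the probability of being called, and an off-diagonal one is bounded by
`missProb_pair_le`. -/
theorem variance_card_compl_step_le {n : ℕ} (p : unitInterval) (hp : (p : ℝ) ≤ 1 / 2)
    (I : Finset (Fin n)) :
    ∫ c, (((I ∪ I.image c)ᶜ.card : ℝ) -
        ∫ c', ((I ∪ I.image c')ᶜ.card : ℝ) ∂roundLaw n p) ^ 2 ∂roundLaw n p ≤
      Iᶜ.card * (I.card * (nonisolatedProb n p / (n - 1) + p ^ 2)) +
        (Iᶜ.card : ℝ) ^ 2 * (4 * (I.card : ℝ) ^ 2 * p ^ 3) := by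
  classical
  rw [integral_sub_sq, integral_card_compl_step_sq, integral_card_compl_step, sq,
    Finset.sum_mul_sum, ← Finset.sum_sub_distrib]
  simp only [← Finset.sum_sub_distrib]
  have hp0 : (0 : ℝ) ≤ p := p.2.1
  have h : ∀ v ∈ Iᶜ, ∀ v' ∈ Iᶜ, missProb p I {v, v'} - missProb p I {v} * missProb p I {v'} ≤
      (if v = v' then I.card * (nonisolatedProb n p / (n - 1) + (p : ℝ) ^ 2) else 0) +
        4 * (I.card : ℝ) ^ 2 * p ^ 3 := by
    intro v hv v' hv'
    rw [Finset.mem_compl] at hv hv'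
    split_ifs with hvv'
    · subst hvv'
      have h1 := le_missProb_singleton p hp hv
      have h2 := Real.add_one_le_exp (-(I.card * (nonisolatedProb n p / (n - 1) + (p : ℝ) ^ 2)))
      have h3 : missProb p I {v} ≤ 1 := measureReal_le_one
      have h4 : 0 ≤ missProb p I {v} := measureReal_nonneg
      have h5 : 0 ≤ 4 * (I.card : ℝ) ^ 2 * (p : ℝ) ^ 3 := by positivity
      rw [Finset.pair_eq_singleton]
      nlinarith
    · rw [zero_add]
      exact missProb_pair_le p hp hv hv' hvv'
  refine (Finset.sum_le_sum fun v hv => Finset.sum_le_sum (h v hv)).trans (le_of_eq ?_)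
  simp only [Finset.sum_add_distrib, Finset.sum_const, nsmul_eq_mul]
  have h6 : ∑ v ∈ Iᶜ, ∑ v' ∈ Iᶜ,
      (if v = v' then (I.card : ℝ) * (nonisolatedProb n p / (n - 1) + (p : ℝ) ^ 2) else 0) =
      Iᶜ.card * (I.card * (nonisolatedProb n p / (n - 1) + p ^ 2)) := by
    rw [Finset.sum_congr rfl fun v hv => by rw [Finset.sum_ite_eq, if_pos hv], Finset.sum_const,
      nsmul_eq_mul]
  rw [h6]
  ring

/-! ### The call rate compared with its limit, and the resulting one-round estimate -/

theorem abs_nonisolatedProb_sub_le {a : ℝ} (ha : 0 < a) {n : ℕ} (hn : a ≤ n) (hn2 : 2 * a ≤ n) :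
    |nonisolatedProb n (edgeProb a n ha hn) - (1 - Real.exp (-a))| ≤ (2 * a + a ^ 2) / n := by
  have hn0 : (0 : ℝ) < n := by linarith
  have hn1 : 1 ≤ n := Nat.one_le_iff_ne_zero.2 (by rintro rfl; simp at hn0)
  have hpn : (edgeProb a n ha hn : ℝ) * n = a := div_mul_cancel₀ _ hn0.ne'
  have hp : (edgeProb a n ha hn : ℝ) ≤ 1 / 2 := by
    change a / n ≤ 1 / 2
    rw [div_le_div_iff₀ hn0 two_pos]
    linarith
  have hp0 : 0 ≤ (edgeProb a n ha hn : ℝ) := (edgeProb a n ha hn).2.1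
  have hp1 : (2 * a + a ^ 2) / n = (2 + a) * (edgeProb a n ha hn : ℝ) := by
    change _ = _ * (a / n)
    ring
  rw [hp1, nonisolatedProb]
  generalize (edgeProb a n ha hn : ℝ) = p at hpn hp hp0
  have hea : Real.exp (-a) ≤ 1 := Real.exp_le_one_iff.2 (by linarith)
  have hea0 : 0 < Real.exp (-a) := Real.exp_pos _
  rw [show 1 - (1 - p) ^ (n - 1) - (1 - Real.exp (-a)) = Real.exp (-a) - (1 - p) ^ (n - 1) by ring,
    abs_le]
  have hcast : ((n - 1 : ℕ) : ℝ) = n - 1 := by push_cast [hn1]; ring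
  constructor
  · have h1 : (1 - p) ^ (n - 1) ≤ Real.exp (-a) * Real.exp p := by
      calc (1 - p) ^ (n - 1) ≤ (Real.exp (-p)) ^ (n - 1) := by
            refine pow_le_pow_left₀ (by linarith) ?_ _
            linarith [Real.add_one_le_exp (-p)]
        _ = Real.exp (-a) * Real.exp p := by
            rw [← Real.exp_nat_mul, ← Real.exp_add, hcast]
            congr 1
            linarith
    have h2 : Real.exp p ≤ 1 + 2 * p := by
      have := abs_le.1 (Real.abs_exp_sub_one_sub_id_le (x := p) (by rw [abs_of_nonneg hp0]; linarith))
      nlinarith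
    nlinarith [mul_le_mul_of_nonneg_left h2 hea0.le]
  · have h1 : Real.exp (-a) * Real.exp (-(a * p)) ≤ (1 - p) ^ (n - 1) := by
      calc Real.exp (-a) * Real.exp (-(a * p)) = (Real.exp (-(p + p ^ 2))) ^ n := by
            rw [← Real.exp_nat_mul, ← Real.exp_add]
            congr 1
            linear_combination (1 + p) * hpn
        _ ≤ (1 - p) ^ n := pow_le_pow_left₀ (Real.exp_pos _).le (exp_neg_add_sq_le hp0 hp) _
        _ ≤ _ := pow_le_pow_of_le_one (by linarith) (by linarith) (Nat.sub_le _ _)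
    have h2 := Real.add_one_le_exp (-(a * p))
    nlinarith [mul_le_mul_of_nonneg_left h2 hea0.le, mul_nonneg ha.le hp0]

theorem abs_callRate_sub_le {a : ℝ} (ha : 0 < a) {n : ℕ} (hn : a ≤ n) (hn2 : 2 * a ≤ n)
    (hn1 : 2 ≤ n) :
    |nonisolatedProb n (edgeProb a n ha hn) / (n - 1) - (1 - Real.exp (-a)) / n| ≤
      (2 * (2 * a + a ^ 2) + 2) / n ^ 2 := by
  have h := abs_nonisolatedProb_sub_le ha hn hn2
  set q := nonisolatedProb n (edgeProb a n ha hn)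
  set Q := 1 - Real.exp (-a) with hQ
  have hQ0 : 0 ≤ Q := by
    have : Real.exp (-a) ≤ 1 := Real.exp_le_one_iff.2 (by linarith)
    linarith
  have hQ1 : Q ≤ 1 := by linarith [Real.exp_pos (-a)]
  have hn' : (2 : ℝ) ≤ n := by exact_mod_cast hn1
  have hn0 : (0 : ℝ) < n := by linarith
  have hn1' : (0 : ℝ) < n - 1 := by linarith
  have h1 : q / (n - 1) - Q / n = (q - Q) / (n - 1) + Q / (n * (n - 1)) := by
    field_simp
    ring
  have h2 : 1 / ((n : ℝ) - 1) ≤ 2 / n := by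
    rw [div_le_div_iff₀ hn1' hn0]
    linarith
  rw [h1]
  refine (abs_add_le _ _).trans ?_
  rw [abs_div, abs_of_pos hn1', abs_of_nonneg (by positivity : 0 ≤ Q / (n * ((n : ℝ) - 1)))]
  calc |q - Q| / (n - 1) + Q / (n * (n - 1))
      = |q - Q| * (1 / ((n : ℝ) - 1)) + Q / n * (1 / ((n : ℝ) - 1)) := by field_simp
    _ ≤ (2 * a + a ^ 2) / n * (2 / n) + 1 / n * (2 / n) := by gcongr
    _ = _ := by field_simp

set_option maxHeartbeats 1000000 in
theorem oneStep_roundLaw {a : ℝ} (ha : 0 < a) :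
    ∃ C : ℝ, 0 < C ∧ ∀ (n : ℕ) (hn : a ≤ n), 2 * a ≤ n → 2 ≤ n →
      OneStep C (1 - Real.exp (-a)) n (roundLaw n (edgeProb a n ha hn)) := by
  set C₁ := 2 * (2 * a + a ^ 2) + 2 with hC₁
  have hC₁0 : 0 < C₁ := by positivity
  set K₁ := C₁ * Real.exp C₁ with hK₁
  set K₂ := Real.exp a * (4 * a ^ 3) with hK₂
  have hK₁0 : 0 < K₁ := by positivity
  have hK₂0 : 0 < K₂ := by positivity
  -- The constant covers three demands: `C₁ + a²` for the lower bound on the mean, the bracket in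
  -- `K₁`, `K₂` for the upper bound, and `1 + C₁ + a² + 4 a³` for the variance.
  refine ⟨C₁ + a ^ 2 + (K₁ + K₂ + K₁ * K₂) + (1 + 4 * a ^ 3), by positivity,
    fun n hn hn2 hn1 I => ?_⟩
  have hθ := abs_callRate_sub_le ha hn hn2 hn1
  have hn' : (2 : ℝ) ≤ n := by exact_mod_cast hn1
  have hn0 : (0 : ℝ) < n := by linarith
  have hp : (edgeProb a n ha hn : ℝ) = a / n := rfl
  have hp2 : (edgeProb a n ha hn : ℝ) ≤ 1 / 2 := by
    rw [hp, div_le_div_iff₀ hn0 two_pos]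
    linarith
  set p := edgeProb a n ha hn
  set θ := nonisolatedProb n p / (n - 1) with hθdef
  set Q := 1 - Real.exp (-a) with hQ
  have hQ0 : 0 ≤ Q := by
    have : Real.exp (-a) ≤ 1 := Real.exp_le_one_iff.2 (by linarith)
    linarith
  have hQ1 : Q ≤ 1 := by linarith [Real.exp_pos (-a)]
  have hk0 : (0 : ℝ) ≤ I.card := Nat.cast_nonneg _
  have hy0 : (0 : ℝ) ≤ Iᶜ.card := Nat.cast_nonneg _
  have hkn : (I.card : ℝ) ≤ n := by exact_mod_cast (by simpa using Finset.card_le_univ I)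
  have hyn : (Iᶜ.card : ℝ) ≤ n := by exact_mod_cast (by simpa using Finset.card_le_univ Iᶜ)
  set k := (I.card : ℝ)
  set y := (Iᶜ.card : ℝ)
  -- All errors in the probability of missing a node are multiples of `z ≤ 1`.
  set z := k / n ^ 2 with hz
  have hz0 : 0 ≤ z := by positivity
  have hz1 : z ≤ 1 := by
    rw [hz, div_le_one (by positivity)]
    nlinarith
  have hkθ : |k * θ - Q * k / n| ≤ C₁ * z := by
    rw [show k * θ - Q * k / n = k * (θ - Q / n) by ring, abs_mul, abs_of_nonneg hk0,
      show C₁ * z = k * (C₁ / n ^ 2) by rw [hz]; ring]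
    exact mul_le_mul_of_nonneg_left hθ hk0
  rw [abs_le] at hkθ
  set X := Q * k / n with hX
  have hX0 : 0 ≤ X := by positivity
  have hpz : k * (p : ℝ) ^ 2 = a ^ 2 * z := by
    rw [hp, hz]
    ring
  have hkp : k * (p : ℝ) ≤ a := by
    rw [hp, mul_div_assoc', div_le_iff₀ hn0]
    nlinarith
  have hkp3 : 4 * k ^ 2 * (p : ℝ) ^ 3 ≤ 4 * a ^ 3 * z := by
    have : 4 * k ^ 2 * (p : ℝ) ^ 3 = 4 * a ^ 3 * z * (k / n) := by
      rw [hp, hz]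
      field_simp
    rw [this]
    exact mul_le_of_le_one_right (by positivity) (by rwa [div_le_one hn0])
  have heX : Real.exp (-X) ≤ 1 := Real.exp_le_one_iff.2 (by linarith)
  have heX0 := Real.exp_pos (-X)
  have hlow : ∀ v ∈ Iᶜ, Real.exp (-X) - (C₁ + a ^ 2) * z ≤ missProb p I {v} := by
    intro v hv
    refine le_trans ?_ (le_missProb_singleton p hp2 (Finset.mem_compl.1 hv))
    have h1 : Real.exp (-X) * Real.exp (-((C₁ + a ^ 2) * z)) ≤
        Real.exp (-(k * (θ + (p : ℝ) ^ 2))) := by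
      rw [← Real.exp_add]
      exact Real.exp_le_exp.2 (by linarith)
    have h2 := Real.add_one_le_exp (-((C₁ + a ^ 2) * z))
    have h3 : 0 ≤ (C₁ + a ^ 2) * z := by positivity
    nlinarith
  have hupp : ∀ v ∈ Iᶜ, missProb p I {v} ≤ Real.exp (-X) + (K₁ + K₂ + K₁ * K₂) * z := by
    intro v hv
    refine (missProb_singleton_le p (Finset.mem_compl.1 hv)).trans ?_
    have h1 : Real.exp (-(k * θ)) ≤ Real.exp (-X) * (1 + K₁ * z) := by
      calc Real.exp (-(k * θ)) ≤ Real.exp (-X + C₁ * z) := Real.exp_le_exp.2 (by linarith)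
        _ = Real.exp (-X) * Real.exp (C₁ * z) := Real.exp_add _ _
        _ ≤ _ := by
          refine mul_le_mul_of_nonneg_left ?_ heX0.le
          have h2 : Real.exp (C₁ * z) ≤ Real.exp C₁ := by
            apply Real.exp_le_exp.2
            nlinarith
          have h3 : Real.exp (C₁ * z) * (1 - C₁ * z) ≤ 1 := by
            have := Real.add_one_le_exp (-(C₁ * z))
            calc _ ≤ Real.exp (C₁ * z) * Real.exp (-(C₁ * z)) :=
                  mul_le_mul_of_nonneg_left (by linarith) (Real.exp_pos _).le
              _ = 1 := by rw [← Real.exp_add]; simp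
          have h4 : 0 ≤ C₁ * z := by positivity
          rw [hK₁]
          nlinarith [mul_le_mul_of_nonneg_left h2 h4]
    have h2 : 1 + Real.exp (k * p) * (4 * k ^ 2 * (p : ℝ) ^ 3) ≤ 1 + K₂ * z := by
      have : Real.exp (k * p) * (4 * k ^ 2 * (p : ℝ) ^ 3) ≤ Real.exp a * (4 * a ^ 3 * z) := by
        have hp0 : (0 : ℝ) ≤ p := p.2.1
        gcongr
      rw [hK₂]
      linarith
    have hp0 : (0 : ℝ) ≤ p := p.2.1
    calc _ ≤ Real.exp (-X) * (1 + K₁ * z) * (1 + K₂ * z) := by gcongr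
      _ = Real.exp (-X) + Real.exp (-X) * ((K₁ + K₂ + K₁ * K₂ * z) * z) := by ring
      _ ≤ Real.exp (-X) + 1 * ((K₁ + K₂ + K₁ * K₂ * 1) * z) := by gcongr
      _ = _ := by ring
  constructor
  · rw [integral_card_compl_step]
    have h1 := Finset.card_nsmul_le_sum _ _ _ hlow
    have h2 := Finset.sum_le_card_nsmul _ _ _ hupp
    rw [nsmul_eq_mul] at h1 h2
    change y * _ ≤ _ at h1
    change _ ≤ y * _ at h2
    have h3 : (C₁ + a ^ 2 + (K₁ + K₂ + K₁ * K₂) + (1 + 4 * a ^ 3)) * y * k / n ^ 2 =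
        (C₁ + a ^ 2 + (K₁ + K₂ + K₁ * K₂) + (1 + 4 * a ^ 3)) * (y * z) := by
      rw [hz]
      ring
    rw [h3, abs_le]
    have hyz : 0 ≤ y * z := by positivity
    have h4 : 0 ≤ (C₁ + a ^ 2) * (y * z) := by positivity
    have h5 : 0 ≤ (K₁ + K₂ + K₁ * K₂) * (y * z) := by positivity
    have h6 : 0 ≤ (1 + 4 * a ^ 3) * (y * z) := by positivity
    constructor <;> linarith
  · refine (variance_card_compl_step_le p hp2 I).trans ?_
    have hzkn : z ≤ k / n := by
      rw [hz]
      gcongr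
      nlinarith
    have h1 : k * (θ + (p : ℝ) ^ 2) ≤ (1 + C₁ + a ^ 2) * (k / n) := by
      have : X ≤ k / n := by
        rw [hX]
        gcongr
        nlinarith
      have h3 : (C₁ + a ^ 2) * z ≤ (C₁ + a ^ 2) * (k / n) := by gcongr
      linarith
    have h2 : y ^ 2 * (4 * k ^ 2 * (p : ℝ) ^ 3) ≤ y * (4 * a ^ 3 * (k / n)) := by
      calc y ^ 2 * (4 * k ^ 2 * (p : ℝ) ^ 3) ≤ y ^ 2 * (4 * a ^ 3 * z) := by gcongr
        _ = y * (4 * a ^ 3 * (k / n)) * (y / n) := by rw [hz]; field_simp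
        _ ≤ _ := mul_le_of_le_one_right (by positivity) (by rwa [div_le_one hn0])
    calc _ ≤ y * ((1 + C₁ + a ^ 2) * (k / n)) + y * (4 * a ^ 3 * (k / n)) :=
          add_le_add (mul_le_mul_of_nonneg_left h1 hy0) h2
      _ = (C₁ + a ^ 2 + 0 + (1 + 4 * a ^ 3)) * (y * (k / n)) := by ring
      _ ≤ (C₁ + a ^ 2 + (K₁ + K₂ + K₁ * K₂) + (1 + 4 * a ^ 3)) * (y * (k / n)) := by
          gcongr
          positivity
      _ = _ := by ring

/-- In every round the expected number of newly informed nodes is bounded below. -/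
theorem integral_card_compl_step_le_sub {a : ℝ} (ha : 0 < a) {n : ℕ} (hn : a ≤ n)
    {I : Finset (Fin n)} (h0 : I.Nonempty) (h1 : I ≠ Finset.univ) :
    ∫ c, ((I ∪ I.image c)ᶜ.card : ℝ) ∂roundLaw n (edgeProb a n ha hn) ≤
      Iᶜ.card - a / (n : ℝ) ^ 2 := by
  classical
  obtain ⟨u, hu⟩ := h0
  obtain ⟨v, hv⟩ : ∃ v, v ∉ I := by
    by_contra! h
    exact h1 (Finset.eq_univ_iff_forall.2 h)
  have huv : v ≠ u := fun h => hv (h ▸ hu)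
  have hn1 : 2 ≤ n := by
    have := u.2; have := v.2
    by_contra hn
    exact huv (Fin.ext (by omega))
  have hn' : (2 : ℝ) ≤ n := by exact_mod_cast hn1
  rw [integral_card_compl_step]
  set p := edgeProb a n ha hn with hp
  have hpa : (p : ℝ) = a / n := rfl
  have h2 : ∀ w, missProb p I {w} ≤ 1 := fun w => measureReal_le_one
  have h3 : missProb p I {v} ≤ 1 - a / (n : ℝ) ^ 2 := by
    have h4 : missProb p I {v} ≤ (roundLaw n p).real {c | c u = v}ᶜ := by
      refine measureReal_mono fun c hc => ?_
      simpa using hc u hu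
    refine h4.trans ?_
    rw [probReal_compl_eq_one_sub .of_discrete, roundLaw_real_call, integral_partnerLaw p huv]
    have h5 : (p : ℝ) ≤ nonisolatedProb n p := by
      have : (1 - (p : ℝ)) ^ (n - 1) ≤ (1 - (p : ℝ)) ^ 1 :=
        pow_le_pow_of_le_one (by linarith [p.2.2]) (by linarith [p.2.1]) (by omega)
      rw [nonisolatedProb]
      linarith
    have h6 : a / (n : ℝ) ^ 2 ≤ nonisolatedProb n p / (n - 1) := by
      calc a / (n : ℝ) ^ 2 = (p : ℝ) / n := by rw [hpa]; field_simp
        _ ≤ nonisolatedProb n p / (n - 1) := by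
          have : (0 : ℝ) ≤ p := p.2.1
          gcongr <;> linarith
    linarith
  rw [← Finset.add_sum_erase _ _ (Finset.mem_compl.2 hv)]
  have h7 := Finset.sum_le_card_nsmul (Iᶜ.erase v) _ _ fun w _ => h2 w
  rw [Finset.card_erase_of_mem (Finset.mem_compl.2 hv), nsmul_eq_mul, mul_one,
    Nat.cast_sub (Finset.card_pos.2 ⟨v, Finset.mem_compl.2 hv⟩), Nat.cast_one] at h7
  linarith

/-! ### The Markov operator -/

/-- The expectation of `f` at the informed set after one more round. -/
noncomputable def stepMean {n : ℕ} (μ : Measure (Fin n → Fin n)) (f : Finset (Fin n) → ℝ)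
    (I : Finset (Fin n)) : ℝ := ∫ c, f (I ∪ I.image c) ∂μ

section Operator

variable {n : ℕ} (μ : Measure (Fin n → Fin n)) [IsProbabilityMeasure μ]

theorem stepMean_mono {f g : Finset (Fin n) → ℝ} {I : Finset (Fin n)}
    (h : ∀ J, I ⊆ J → f J ≤ g J) : stepMean μ f I ≤ stepMean μ g I :=
  integral_mono .of_finite .of_finite fun _ => h _ Finset.subset_union_left

theorem stepMean_const (r : ℝ) (I : Finset (Fin n)) : stepMean μ (fun _ => r) I = r := by
  simp [stepMean]

theorem stepMean_mul_add (r s : ℝ) (f : Finset (Fin n) → ℝ) (I : Finset (Fin n)) :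
    stepMean μ (fun J => r * f J + s) I = r * stepMean μ f I + s := by
  unfold stepMean
  rw [integral_add .of_finite .of_finite, integral_const_mul]
  simp

theorem stepMean_iterate_mono {f g : Finset (Fin n) → ℝ} (t : ℕ) {I : Finset (Fin n)}
    (h : ∀ J, I ⊆ J → f J ≤ g J) : (stepMean μ)^[t] f I ≤ (stepMean μ)^[t] g I := by
  induction t generalizing I with
  | zero => exact h I subset_rfl
  | succ t ih =>
    rw [Function.iterate_succ_apply', Function.iterate_succ_apply']
    exact stepMean_mono μ fun J hJ => ih fun J' hJ' => h J' (hJ.trans hJ')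

theorem stepMean_iterate_mul_add (r s : ℝ) (f : Finset (Fin n) → ℝ) (t : ℕ) (I : Finset (Fin n)) :
    (stepMean μ)^[t] (fun J => r * f J + s) I = r * (stepMean μ)^[t] f I + s := by
  induction t generalizing I with
  | zero => rfl
  | succ t ih =>
    rw [Function.iterate_succ_apply', Function.iterate_succ_apply',
      show (stepMean μ)^[t] (fun J => r * f J + s) = fun J => r * (stepMean μ)^[t] f J + s from
        funext ih, stepMean_mul_add]

/-- The informed set only grows, so the condition `l ≤ J.card` persists and the one-step inequality
can be iterated. -/
theorem stepMean_iterate_le {g : Finset (Fin n) → ℝ} {ρ l : ℝ} (hρ : 0 ≤ ρ)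
    (hg : ∀ J : Finset (Fin n), l ≤ J.card → stepMean μ g J ≤ ρ * g J) (t : ℕ)
    {I : Finset (Fin n)} (hI : l ≤ I.card) : (stepMean μ)^[t] g I ≤ ρ ^ t * g I := by
  induction t generalizing I with
  | zero => simp
  | succ t ih =>
    rw [Function.iterate_succ_apply']
    calc stepMean μ ((stepMean μ)^[t] g) I ≤ stepMean μ (fun J => ρ ^ t * g J + 0) I := by
          refine stepMean_mono μ fun J hJ => ?_
          rw [add_zero]
          exact ih (hI.trans (by exact_mod_cast Finset.card_le_card hJ))
      _ = ρ ^ t * stepMean μ g I := by rw [stepMean_mul_add, add_zero]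
      _ ≤ ρ ^ t * (ρ * g I) := by
          have := hg I hI
          gcongr
      _ = _ := by ring

/-- The probability that fewer than `m` nodes are informed `t` rounds after `I` was informed. -/
noncomputable def slowProb (m : ℝ) (t : ℕ) (I : Finset (Fin n)) : ℝ :=
  (stepMean μ)^[t] (fun J => if (J.card : ℝ) < m then 1 else 0) I

theorem slowProb_le_one (m : ℝ) (t : ℕ) (I : Finset (Fin n)) : slowProb μ m t I ≤ 1 := by
  have h : (stepMean μ)^[t] (fun _ => (1 : ℝ)) I = 1 := by
    simpa using stepMean_iterate_mul_add μ 0 1 (fun _ => 0) t I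
  refine (stepMean_iterate_mono μ t fun J _ => ?_).trans h.le
  split_ifs <;> norm_num

/-- The potential is set to 0 once `m` nodes are informed. It then contracts in expectation forever,
and it is at least `δ` as long as the target is missed, so Markov's inequality applies. -/
theorem slowProb_le_of_drift {l m ρ δ : ℝ} (hρ : 0 ≤ ρ) (hδ : 0 < δ) (h : Finset (Fin n) → ℝ)
    (hh : ∀ J : Finset (Fin n), l ≤ J.card → (J.card : ℝ) < m → δ ≤ h J)
    (hstep : ∀ J : Finset (Fin n), l ≤ J.card → (J.card : ℝ) < m →
      stepMean μ (fun J' => if (J'.card : ℝ) < m then h J' else 0) J ≤ ρ * h J)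
    {I : Finset (Fin n)} (hI : l ≤ I.card) {K : ℝ} (hK : 0 ≤ K)
    (hIK : (I.card : ℝ) < m → h I ≤ K) (t : ℕ) :
    slowProb μ m t I ≤ ρ ^ t * (K / δ) := by
  set g : Finset (Fin n) → ℝ := fun J => if (J.card : ℝ) < m then h J else 0 with hg
  have hcard : ∀ {J J' : Finset (Fin n)}, J ⊆ J' → (J.card : ℝ) ≤ J'.card := fun hJ => by
    exact_mod_cast Finset.card_le_card hJ
  have h1 : ∀ J : Finset (Fin n), l ≤ J.card → stepMean μ g J ≤ ρ * g J := by
    intro J hJ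
    by_cases hm : (J.card : ℝ) < m
    · rw [show ρ * g J = ρ * h J by simp [hg, hm]]
      exact hstep J hJ hm
    · have h2 : stepMean μ g J ≤ stepMean μ (fun _ => 0) J := by
        refine stepMean_mono μ fun J' hJ' => ?_
        rw [hg]
        simp only
        rw [if_neg]
        linarith [hcard hJ', not_lt.1 hm]
      rw [stepMean_const] at h2
      simpa [hg, hm] using h2
  have h3 := stepMean_iterate_le μ hρ h1 t hI
  have h4 : slowProb μ m t I ≤ (stepMean μ)^[t] (fun J => δ⁻¹ * g J + 0) I := by
    refine stepMean_iterate_mono μ t fun J hJ => ?_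
    rw [add_zero]
    by_cases hm : (J.card : ℝ) < m
    · simp only [hg, hm, if_true]
      rw [inv_mul_eq_div, one_le_div hδ]
      exact hh J (hI.trans (hcard hJ)) hm
    · simp [hg, hm]
  rw [stepMean_iterate_mul_add, add_zero] at h4
  have h5 : g I ≤ K := by
    by_cases hm : (I.card : ℝ) < m
    · simpa [hg, hm] using hIK hm
    · simpa [hg, hm] using hK
  calc slowProb μ m t I ≤ δ⁻¹ * (ρ ^ t * g I) := h4.trans (by gcongr)
    _ ≤ δ⁻¹ * (ρ ^ t * K) := by gcongr
    _ = _ := by ring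

/-- Markov property at time `s`: either the intermediate target `m` is missed, or the second stage
starts from a set of size at least `m`. -/
theorem slowProb_add_le {m m' B : ℝ} (s t : ℕ) {I : Finset (Fin n)} (hB : 0 ≤ B)
    (h : ∀ J : Finset (Fin n), I ⊆ J → m ≤ J.card → slowProb μ m' t J ≤ B) :
    slowProb μ m' (s + t) I ≤ slowProb μ m s I + B := by
  have h1 : slowProb μ m' (s + t) I = (stepMean μ)^[s] (slowProb μ m' t) I := by
    rw [slowProb, Function.iterate_add_apply]
    rfl
  have h2 := stepMean_iterate_mul_add μ 1 B (fun J => if (J.card : ℝ) < m then 1 else 0) s I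
  rw [one_mul] at h2
  rw [h1, slowProb, ← h2]
  refine stepMean_iterate_mono μ s fun J hJ => ?_
  split_ifs with hm
  · linarith [slowProb_le_one μ m' t J]
  · linarith [h J hJ (not_lt.1 hm)]

/-! ### Potentials that contract up to a relative error -/

theorem integral_sqrt_le (μ : Measure (Fin n → Fin n)) [IsProbabilityMeasure μ]
    (f : (Fin n → Fin n) → ℝ) (hf : ∀ c, 0 ≤ f c) :
    ∫ c, √(f c) ∂μ ≤ √(∫ c, f c ∂μ) := by
  apply Real.le_sqrt_of_sq_le
  have h := integral_sub_sq μ fun c => √(f c)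
  have h0 : 0 ≤ ∫ x, (√(f x) - ∫ y, √(f y) ∂μ) ^ 2 ∂μ := integral_nonneg fun _ => sq_nonneg _
  simp only [Real.sq_sqrt (hf _)] at h
  linarith

/-- A nonnegative function `w` that contracts by a factor `ρ (1 + C w)` per round, while at most
`w₀`, becomes small at rate `√ρ`. -/
theorem exists_slowProb_le_of_contraction {C ρ : ℝ} (hC : 0 < C) (hρ : 0 < ρ) (hρ1 : ρ < 1) :
    ∃ w₀ : ℝ, 0 < w₀ ∧ w₀ ≤ 1 ∧ ∀ (n : ℕ) (μ : Measure (Fin n → Fin n)) [IsProbabilityMeasure μ]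
      (l m δ : ℝ) (w : Finset (Fin n) → ℝ), 0 < δ →
      (∀ J : Finset (Fin n), l ≤ J.card → (J.card : ℝ) < m →
        δ ≤ w J ∧ w J ≤ w₀ ∧ (∀ c, 0 ≤ w (J ∪ J.image c)) ∧
        stepMean μ w J ≤ ρ * w J * (1 + C * w J)) →
      ∀ I : Finset (Fin n), l ≤ I.card → ∀ t, slowProb μ m t I ≤ √ρ ^ t * (2 / √δ) := by
  have hr0 : 0 < √ρ := Real.sqrt_pos.2 hρ
  have hr2 : √ρ ^ 2 = ρ := Real.sq_sqrt hρ.le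
  have hr1 : √ρ < 1 := by
    rw [Real.sqrt_lt' one_pos]
    simpa using hρ1
  set r := √ρ
  set d := min 1 ((1 - r) / (2 * C)) with hd
  have hd0 : 0 < d := lt_min one_pos (div_pos (by linarith) (by linarith))
  have hd1 : d ≤ 1 := min_le_left _ _
  have hdC : 2 * C * d ≤ 1 - r := by
    have : d ≤ (1 - r) / (2 * C) := min_le_right _ _
    rw [le_div_iff₀ (by linarith)] at this
    linarith
  refine ⟨d ^ 2, by positivity, by nlinarith, fun n μ _ l m δ w hδ hw I hI t => ?_⟩
  -- By Jensen, `√w` contracts by `r = √ρ` with relative error of order `w`. The summand `w`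
  -- contracts by the smaller factor `r²`, and for small `w` the slack `(r - r²) w` pays for the
  -- errors of both summands. The sum thus contracts by `r` exactly.
  refine slowProb_le_of_drift μ (l := l) hr0.le (Real.sqrt_pos.2 hδ) (fun J => √(w J) + w J)
    (fun J hJ hm => ?_) (fun J hJ hm => ?_) hI zero_le_two (fun hm => ?_) t
  · obtain ⟨h1, -⟩ := hw J hJ hm
    have := Real.sqrt_le_sqrt h1
    linarith
  · obtain ⟨h1, h2, h3, h4⟩ := hw J hJ hm
    have hwJ : 0 < w J := hδ.trans_le h1
    have h5 : stepMean μ (fun J' => if (J'.card : ℝ) < m then √(w J') + w J' else 0) J ≤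
        ∫ c, (√(w (J ∪ J.image c)) + w (J ∪ J.image c)) ∂μ := by
      refine integral_mono .of_finite .of_finite fun c => ?_
      have := h3 c
      dsimp only
      split_ifs
      · exact le_rfl
      · positivity
    refine h5.trans ?_
    rw [integral_add .of_finite .of_finite]
    have h6 := integral_sqrt_le μ _ h3
    change stepMean μ w J ≤ _ at h4
    have h7 : √(stepMean μ w J) ≤ r * √(w J) * (1 + C * w J) := by
      apply Real.sqrt_le_iff.2 ⟨by positivity, ?_⟩
      rw [mul_pow, mul_pow, Real.sq_sqrt hwJ.le, hr2]
      refine h4.trans (mul_le_mul_of_nonneg_left ?_ (by positivity))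
      nlinarith [mul_pos hC hwJ]
    change ∫ c, √(w (J ∪ J.image c)) ∂μ ≤ √(stepMean μ w J) at h6
    change _ + stepMean μ w J ≤ _
    have hs0 : 0 < √(w J) := Real.sqrt_pos.2 hwJ
    have hs2 : √(w J) ^ 2 = w J := Real.sq_sqrt hwJ.le
    have hsd : √(w J) ≤ d := by
      rw [← Real.sqrt_sq hd0.le]
      exact Real.sqrt_le_sqrt h2
    generalize √(w J) = σ at *
    rw [← hs2] at h4 h7 ⊢
    have h8 : C * σ * (1 + r * σ) ≤ 1 - r := by
      calc C * σ * (1 + r * σ) ≤ C * d * (1 + 1 * 1) := by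
            gcongr
            exact hsd.trans hd1
        _ ≤ 1 - r := by linarith
    have h9 : r * σ * (1 + C * σ ^ 2) + r ^ 2 * σ ^ 2 * (1 + C * σ ^ 2) ≤ r * (σ + σ ^ 2) := by
      have : 0 ≤ r * σ ^ 2 * (1 - r - C * σ * (1 + r * σ)) :=
        mul_nonneg (by positivity) (by linarith)
      nlinarith
    rw [hr2] at h9
    linarith
  · obtain ⟨h1, h2, -⟩ := hw I hI hm
    have h3 : w I ≤ 1 := h2.trans (by nlinarith)
    have h4 : √(w I) ≤ 1 := Real.sqrt_le_one.2 h3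
    change √(w I) + w I ≤ 2
    linarith

end Operator

/-! ### Consequences of the one-round estimates -/

section OneStep

variable {n : ℕ}

theorem card_add_card_compl_real (I : Finset (Fin n)) : (I.card : ℝ) + Iᶜ.card = n := by
  exact_mod_cast (by simp : I.card + Iᶜ.card = n)

theorem card_step_le (I : Finset (Fin n)) (c : Fin n → Fin n) :
    ((I ∪ I.image c).card : ℝ) ≤ 2 * I.card := by
  have h1 := Finset.card_union_le I (I.image c)
  have h2 : (I.image c).card ≤ I.card := Finset.card_image_le
  exact_mod_cast (by omega : (I ∪ I.image c).card ≤ 2 * I.card)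

theorem le_card_step (I : Finset (Fin n)) (c : Fin n → Fin n) :
    (I.card : ℝ) ≤ (I ∪ I.image c).card := by
  exact_mod_cast Finset.card_le_card Finset.subset_union_left

variable {μ : Measure (Fin n → Fin n)} {C Q : ℝ}

theorem OneStep.mean_le (h : OneStep C Q n μ) (hC : 0 ≤ C) (hQ1 : Q ≤ 1)
    (hn : 0 < n) (I : Finset (Fin n)) :
    ∫ c, ((I ∪ I.image c)ᶜ.card : ℝ) ∂μ ≤
      Real.exp (-Q) * Iᶜ.card * (1 + (2 + 3 * C) * (Iᶜ.card / n)) := by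
  have h1 := (abs_le.1 (h I).1).2
  have hn0 : (0 : ℝ) < n := by exact_mod_cast hn
  have hk := card_add_card_compl_real I
  have hk0 : (0 : ℝ) ≤ I.card := Nat.cast_nonneg _
  set k := (I.card : ℝ)
  -- The error `C y k / n²` is to be absorbed into a multiple of `y² / n`, which uses that `y ≥ 1`
  -- unless `y = 0`.
  rcases Nat.eq_zero_or_pos Iᶜ.card with hy | hy
  · rw [hy] at h1 ⊢
    simp only [Nat.cast_zero] at h1 ⊢
    ring_nf at h1 ⊢
    exact h1
  have hy1 : (1 : ℝ) ≤ Iᶜ.card := by exact_mod_cast hy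
  set y := (Iᶜ.card : ℝ)
  have he : Real.exp (-(Q * k / n)) ≤ Real.exp (-Q) * (1 + 2 * (y / n)) := by
    have e1 : -(Q * k / n) = -Q + Q * (y / n) := by
      rw [← hk]
      field_simp
      ring
    have hyn : y / n ≤ 1 := by rw [div_le_one hn0]; linarith
    have hyn0 : 0 ≤ y / n := by positivity
    rw [e1, Real.exp_add]
    refine mul_le_mul_of_nonneg_left ?_ (Real.exp_pos _).le
    have h2 : Q * (y / n) ≤ y / n := mul_le_of_le_one_left hyn0 hQ1
    have h3 := abs_le.1 (Real.abs_exp_sub_one_sub_id_le (x := y / n) (by rwa [abs_of_nonneg hyn0]))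
    have h4 := Real.exp_le_exp.2 h2
    nlinarith
  have hm : C * y * k / n ^ 2 ≤ Real.exp (-Q) * y * (3 * C * (y / n)) := by
    have h5 : 1 ≤ Real.exp (-Q) * 3 := by
      have : Real.exp Q ≤ 3 := by
        have := Real.exp_le_exp.2 hQ1
        linarith [Real.exp_one_lt_d9]
      calc 1 = Real.exp (-Q) * Real.exp Q := by rw [← Real.exp_add]; simp
        _ ≤ _ := by gcongr
    calc C * y * k / n ^ 2 = C * y / n * (k / n) := by field_simp
      _ ≤ C * y / n * 1 := by
          gcongr
          rw [div_le_one hn0]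
          linarith
      _ ≤ C * y / n * ((Real.exp (-Q) * 3) * y) := by
          gcongr
          nlinarith
      _ = _ := by ring
  calc _ ≤ y * Real.exp (-(Q * k / n)) + C * y * k / n ^ 2 := by linarith
    _ ≤ y * (Real.exp (-Q) * (1 + 2 * (y / n))) + Real.exp (-Q) * y * (3 * C * (y / n)) := by
      gcongr
    _ = _ := by ring

theorem OneStep.le_mean (h : OneStep C Q n μ) (hC : 0 ≤ C) (hQ0 : 0 ≤ Q) (hQ1 : Q ≤ 1)
    (hn : 0 < n) (I : Finset (Fin n)) :
    Real.exp (-Q) * Iᶜ.card * (1 - 3 * C / n) ≤ ∫ c, ((I ∪ I.image c)ᶜ.card : ℝ) ∂μ := by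
  have h1 := (abs_le.1 (h I).1).1
  have hn0 : (0 : ℝ) < n := by exact_mod_cast hn
  have hk := card_add_card_compl_real I
  have hk0 : (0 : ℝ) ≤ I.card := Nat.cast_nonneg _
  have hy0 : (0 : ℝ) ≤ Iᶜ.card := Nat.cast_nonneg _
  set k := (I.card : ℝ)
  set y := (Iᶜ.card : ℝ)
  have hkn : k / n ≤ 1 := by rw [div_le_one hn0]; linarith
  have he : Real.exp (-Q) ≤ Real.exp (-(Q * k / n)) := by
    apply Real.exp_le_exp.2
    rw [mul_div_assoc]
    nlinarith
  have hm : C * y * k / n ^ 2 ≤ Real.exp (-Q) * y * (3 * C / n) := by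
    have h5 : 1 ≤ Real.exp (-Q) * 3 := by
      have : Real.exp Q ≤ 3 := by
        have := Real.exp_le_exp.2 hQ1
        linarith [Real.exp_one_lt_d9]
      calc 1 = Real.exp (-Q) * Real.exp Q := by rw [← Real.exp_add]; simp
        _ ≤ _ := by gcongr
    calc C * y * k / n ^ 2 = C * y / n * (k / n) := by field_simp
      _ ≤ C * y / n * 1 := by gcongr
      _ ≤ C * y / n * (Real.exp (-Q) * 3) := by gcongr
      _ = _ := by ring
  have := mul_le_mul_of_nonneg_left he hy0
  linarith

theorem OneStep.mean_le_of_le_card (h : OneStep C Q n μ) (hC : 0 ≤ C) (hQ0 : 0 ≤ Q)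
    (hn : 0 < n) {ε : ℝ} (I : Finset (Fin n)) (hε : ε * n ≤ I.card) :
    ∫ c, ((I ∪ I.image c)ᶜ.card : ℝ) ∂μ ≤ (Real.exp (-(Q * ε)) + C / n) * Iᶜ.card := by
  have h1 := (abs_le.1 (h I).1).2
  have hn0 : (0 : ℝ) < n := by exact_mod_cast hn
  have hk := card_add_card_compl_real I
  have hk0 : (0 : ℝ) ≤ I.card := Nat.cast_nonneg _
  have hy0 : (0 : ℝ) ≤ Iᶜ.card := Nat.cast_nonneg _
  set k := (I.card : ℝ)
  set y := (Iᶜ.card : ℝ)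
  have hkn : k / n ≤ 1 := by rw [div_le_one hn0]; linarith
  have he : Real.exp (-(Q * k / n)) ≤ Real.exp (-(Q * ε)) := by
    apply Real.exp_le_exp.2
    rw [mul_div_assoc]
    have : ε ≤ k / n := by rwa [le_div_iff₀ hn0]
    nlinarith
  have hm : C * y * k / n ^ 2 ≤ C / n * y := by
    calc C * y * k / n ^ 2 = C / n * y * (k / n) := by field_simp
      _ ≤ C / n * y * 1 := by gcongr
      _ = _ := by ring
  have := mul_le_mul_of_nonneg_left he hy0
  linarith

/-- Linearization of the exponential, useful when `k` is small compared with `n`: the informed set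
grows by the factor `1 + Q`. -/
theorem OneStep.abs_mean_card_sub_le (h : OneStep C Q n μ) (hC : 0 ≤ C) (hQ0 : 0 ≤ Q)
    (hQ1 : Q ≤ 1) (hn : 0 < n) (I : Finset (Fin n)) :
    n - ∫ c, ((I ∪ I.image c)ᶜ.card : ℝ) ∂μ ≤ (1 + Q) * I.card + C * I.card / n ∧
    (1 + Q) * I.card - C * I.card / n - 2 * (I.card : ℝ) ^ 2 / n ≤
      n - ∫ c, ((I ∪ I.image c)ᶜ.card : ℝ) ∂μ := by
  have h1 := abs_le.1 (h I).1
  have hn0 : (0 : ℝ) < n := by exact_mod_cast hn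
  have hk := card_add_card_compl_real I
  have hk0 : (0 : ℝ) ≤ I.card := Nat.cast_nonneg _
  have hy0 : (0 : ℝ) ≤ Iᶜ.card := Nat.cast_nonneg _
  set k := (I.card : ℝ)
  set y := (Iᶜ.card : ℝ)
  have hkn : k / n ≤ 1 := by rw [div_le_one hn0]; linarith
  have hm : C * y * k / n ^ 2 ≤ C * k / n := by
    have hyn : y / n ≤ 1 := by rw [div_le_one hn0]; linarith
    calc C * y * k / n ^ 2 = C * k / n * (y / n) := by field_simp
      _ ≤ C * k / n * 1 := by gcongr
      _ = _ := by ring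
  set x := Q * k / n with hx
  have hx0 : 0 ≤ x := by positivity
  have hxk : x ≤ k / n := by
    rw [hx]
    gcongr
    exact mul_le_of_le_one_left hk0 hQ1
  have hx1 : x ≤ 1 := hxk.trans hkn
  have hxn : x * n = Q * k := by rw [hx]; field_simp
  have e1 := Real.add_one_le_exp (-x)
  have e2 := abs_le.1 (Real.abs_exp_sub_one_sub_id_le (x := -x) (by rwa [abs_neg, abs_of_nonneg hx0]))
  constructor
  · have h3 := mul_le_mul_of_nonneg_left e1 hy0
    have h4 : y * x ≤ n * x := mul_le_mul_of_nonneg_right (by linarith) hx0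
    linarith
  · have h3 := mul_le_mul_of_nonneg_left e2.2 hy0
    have h4 : y * x ^ 2 ≤ n * x ^ 2 := mul_le_mul_of_nonneg_right (by linarith) (sq_nonneg _)
    have h5 : k * x ≤ k ^ 2 / n := by
      calc k * x ≤ k * (k / n) := by gcongr
        _ = _ := by ring
    have h6 : (n : ℝ) * x ^ 2 ≤ k ^ 2 / n := by
      calc (n : ℝ) * x ^ 2 ≤ n * (k / n) ^ 2 := by gcongr
        _ = _ := by field_simp
    have h7 : y * x = n * x - k * x := by rw [← hk]; ring
    have h8 : 2 * k ^ 2 / n = k ^ 2 / n + k ^ 2 / n := by ring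
    linarith

variable [IsProbabilityMeasure μ]

theorem integral_card_step (I : Finset (Fin n)) :
    ∫ c, ((I ∪ I.image c).card : ℝ) ∂μ = n - ∫ c, ((I ∪ I.image c)ᶜ.card : ℝ) ∂μ := by
  have : ∀ c, ((I ∪ I.image c).card : ℝ) = n - ((I ∪ I.image c)ᶜ.card : ℝ) := fun c => by
    linarith [card_add_card_compl_real (I ∪ I.image c)]
  simp only [this]
  rw [integral_sub .of_finite .of_finite]
  simp

/-- The cross term with coefficient `F` vanishes because a deviation from the mean integrates to 0.
-/
theorem integral_quadratic (f : (Fin n → Fin n) → ℝ) (A B D F G H : ℝ) :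
    ∫ c, (A - (f c - B) / D + ((f c - ∫ c', f c' ∂μ) ^ 2 + F * (f c - ∫ c', f c' ∂μ) + G) / H) ∂μ =
      A - (∫ c, f c ∂μ - B) / D + (∫ c, (f c - ∫ c', f c' ∂μ) ^ 2 ∂μ + G) / H := by
  rw [integral_add .of_finite .of_finite, integral_sub .of_finite .of_finite, integral_div,
    integral_div, integral_add .of_finite .of_finite, integral_add .of_finite .of_finite,
    integral_sub .of_finite .of_finite, integral_const_mul, integral_sub .of_finite .of_finite]
  simp

/-- The second-order expansion of the inverse has the exact remainder `(x - m)² / (m² x)`. -/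
theorem inv_le_quadratic {x m k : ℝ} (hm : 0 < m) (hk : 0 < k) (hx : k ≤ x) :
    x⁻¹ ≤ m⁻¹ - (x - m) / m ^ 2 + (x - m) ^ 2 / (m ^ 2 * k) := by
  have hx0 : 0 < x := hk.trans_le hx
  have h1 : x⁻¹ = m⁻¹ - (x - m) / m ^ 2 + (x - m) ^ 2 / (m ^ 2 * x) := by
    field_simp
    ring
  rw [h1]
  gcongr

/-- The expected inverse of the number of informed nodes. -/
theorem OneStep.integral_inv_card_le (h : OneStep C Q n μ) (hC : 0 ≤ C) (hQ0 : 0 ≤ Q)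
    (hQ1 : Q ≤ 1) {I : Finset (Fin n)} (hI : I.Nonempty) :
    ∫ c, ((I ∪ I.image c).card : ℝ)⁻¹ ∂μ ≤
      (1 + Q)⁻¹ * ((I.card : ℝ)⁻¹ + ((C + 2) + (C + 2) ^ 2) / n + C / (I.card : ℝ) ^ 2) := by
  have hk1 : (1 : ℝ) ≤ I.card := by exact_mod_cast hI.card_pos
  have hkn := card_add_card_compl_real I
  have hy0 : (0 : ℝ) ≤ Iᶜ.card := Nat.cast_nonneg _
  obtain ⟨h1, h2⟩ := h.abs_mean_card_sub_le hC hQ0 hQ1 (Fin.pos hI.choose) I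
  have hV := (h I).2
  have hU : ∀ c, ((I ∪ I.image c)ᶜ.card : ℝ) = n - ((I ∪ I.image c).card : ℝ) := fun c => by
    linarith [card_add_card_compl_real (I ∪ I.image c)]
  have hX := integral_card_step (μ := μ) I
  rw [← hX] at h1 h2
  have hVX : ∫ c, (((I ∪ I.image c).card : ℝ) - ∫ c', ((I ∪ I.image c').card : ℝ) ∂μ) ^ 2 ∂μ ≤
      C * I.card := by
    calc _ = ∫ c, (((I ∪ I.image c)ᶜ.card : ℝ) - ∫ c', ((I ∪ I.image c')ᶜ.card : ℝ) ∂μ) ^ 2 ∂μ := by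
          congr 1 with c
          rw [hX, hU c]
          ring
      _ ≤ C * I.card * Iᶜ.card / n := hV
      _ ≤ _ := by
          rw [mul_div_assoc]
          refine mul_le_of_le_one_right (by positivity) ?_
          rw [div_le_one (by linarith)]
          linarith
  set E := ∫ c, ((I ∪ I.image c).card : ℝ) ∂μ with hE
  set k := (I.card : ℝ)
  have hk0 : 0 < k := by linarith
  have hn0 : (0 : ℝ) < n := by linarith
  set L := 1 + Q with hL
  have hL1 : 1 ≤ L := by linarith
  have hL0 : 0 < L := by linarith
  set D := C + 2 with hD
  have hD0 : 0 ≤ D := by positivity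
  have hb : |E - L * k| ≤ D * k ^ 2 / n := by
    have h3 : C * k / n ≤ C * k ^ 2 / n := by
      gcongr
      nlinarith
    have h4 : D * k ^ 2 / n = C * k ^ 2 / n + 2 * k ^ 2 / n := by rw [hD]; ring
    have h5 : 0 ≤ 2 * k ^ 2 / n := by positivity
    rw [abs_le]
    constructor <;> linarith
  have hb2 : (E - L * k) ^ 2 ≤ D ^ 2 * k ^ 3 / n := by
    calc (E - L * k) ^ 2 ≤ (D * k ^ 2 / n) ^ 2 := by
          rw [← sq_abs]
          gcongr
      _ = D ^ 2 * k ^ 3 / n * (k / n) := by field_simp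
      _ ≤ _ := by
          refine mul_le_of_le_one_right (by positivity) ?_
          rw [div_le_one hn0]
          linarith
  -- The expansion is around `L k = (1 + Q) k`, not around the true mean `E`; the square is then
  -- rewritten around `E` so that variance and squared bias separate.
  have h6 : ∫ c, ((I ∪ I.image c).card : ℝ)⁻¹ ∂μ ≤
      ∫ c, ((L * k)⁻¹ - (((I ∪ I.image c).card : ℝ) - L * k) / (L * k) ^ 2 +
        (((((I ∪ I.image c).card : ℝ) - E) ^ 2 + 2 * (E - L * k) * (((I ∪ I.image c).card : ℝ) - E)
        + (E - L * k) ^ 2) / ((L * k) ^ 2 * k))) ∂μ := by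
    refine integral_mono .of_finite .of_finite fun c => ?_
    have := inv_le_quadratic (m := L * k) (by positivity) hk0 (le_card_step I c)
    refine this.trans (le_of_eq ?_)
    ring
  refine h6.trans ?_
  rw [integral_quadratic]
  have h7 : -((E - L * k) / (L * k) ^ 2) ≤ D / (L ^ 2 * n) := by
    rw [← neg_div]
    calc -(E - L * k) / (L * k) ^ 2 ≤ (D * k ^ 2 / n) / (L * k) ^ 2 := by
          gcongr
          exact (neg_le_abs _).trans hb
      _ = _ := by field_simp
  have h8 : (∫ c, (((I ∪ I.image c).card : ℝ) - E) ^ 2 ∂μ + (E - L * k) ^ 2) / ((L * k) ^ 2 * k) ≤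
      C / (L ^ 2 * k ^ 2) + D ^ 2 / (L ^ 2 * n) := by
    calc _ ≤ (C * k + D ^ 2 * k ^ 3 / n) / ((L * k) ^ 2 * k) := by gcongr
      _ = _ := by field_simp
  have h9 : ∀ r : ℝ, 0 ≤ r → r / L ^ 2 ≤ L⁻¹ * r := by
    intro r hr
    rw [inv_mul_eq_div]
    gcongr
    nlinarith
  have h10 := h9 ((D + D ^ 2) / n + C / k ^ 2) (by positivity)
  have h11 : ((D + D ^ 2) / n + C / k ^ 2) / L ^ 2 =
      D / (L ^ 2 * n) + (C / (L ^ 2 * k ^ 2) + D ^ 2 / (L ^ 2 * n)) := by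
    field_simp
    ring
  rw [mul_inv]
  linarith

end OneStep

/-! ### Upper tail -/

/-- Uniformly in `n`, the time to grow from at least `l n` to at least `m n` informed nodes exceeds
`τ n` only with exponentially small probabilities. -/
def TailBound (C Q : ℝ) (l m τ : ℕ → ℝ) : Prop :=
  ∃ A α : ℝ, 0 < A ∧ 0 < α ∧ ∃ n₀ : ℕ, ∀ n ≥ n₀, ∀ μ : Measure (Fin n → Fin n),
    IsProbabilityMeasure μ → OneStep C Q n μ → ∀ I : Finset (Fin n), I.Nonempty → l n ≤ I.card →
      ∀ t : ℕ, slowProb μ (m n) t I ≤ A * Real.exp (-α * (t - τ n))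

theorem TailBound.trans {C Q : ℝ} {l m m' τ τ' : ℕ → ℝ} (h : TailBound C Q l m τ)
    (h' : TailBound C Q m m' τ') (hτ : ∀ n, 0 ≤ τ n) (hτ' : ∀ n, 0 ≤ τ' n) :
    TailBound C Q l m' (fun n => τ n + τ' n) := by
  obtain ⟨A, α, hA, hα, n₀, h⟩ := h
  obtain ⟨A', α', hA', hα', n₁, h'⟩ := h'
  set β := min α α' / 2 with hβ
  have hβ0 : 0 < β := by rw [hβ]; positivity
  have hβα : 2 * β ≤ α := by rw [hβ]; linarith [min_le_left α α']
  have hβα' : 2 * β ≤ α' := by rw [hβ]; linarith [min_le_right α α']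
  refine ⟨A * Real.exp α + A' + 1, β, by positivity, hβ0, max n₀ n₁, fun n hn μ _ hμ I hI hl t => ?_⟩
  set r : ℝ := t - (τ n + τ' n) with hr
  have hEr := Real.exp_pos (-β * r)
  by_cases hr0 : r < 0
  · refine (slowProb_le_one μ _ t I).trans ?_
    have h1 : 1 ≤ Real.exp (-β * r) := Real.one_le_exp (by nlinarith)
    have h2 : 0 < A * Real.exp α + A' := by positivity
    nlinarith
  rw [not_lt] at hr0
  have hτn := hτ n
  have hτn' := hτ' n
  -- The surplus `r` over both expected durations is shared equally, which halves the rate; rounding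
  -- down costs the factor `exp α`.
  set s := ⌊τ n + r / 2⌋₊ with hs
  have hs1 : (s : ℝ) ≤ τ n + r / 2 := Nat.floor_le (by positivity)
  have hs2 : τ n + r / 2 < s + 1 := Nat.lt_floor_add_one _
  have hst : s ≤ t := by
    have : (s : ℝ) ≤ t := by linarith
    exact_mod_cast this
  clear_value s r
  obtain ⟨u, rfl⟩ := Nat.exists_eq_add_of_le hst
  push_cast at hr
  have h1 := h n (le_of_max_le_left hn) μ inferInstance hμ I hI hl s
  have h2 := slowProb_add_le μ (m := m n) (m' := m' n) (B := A' * Real.exp (-α' * (u - τ' n))) s u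
    (I := I) (by positivity) fun J hJ hmJ =>
      h' n (le_of_max_le_right hn) μ inferInstance hμ J (hI.mono hJ) hmJ u
  have h3 : Real.exp (-α * (s - τ n)) ≤ Real.exp α * Real.exp (-β * r) := by
    rw [← Real.exp_add]
    apply Real.exp_le_exp.2
    nlinarith
  have h4 : Real.exp (-α' * (u - τ' n)) ≤ Real.exp (-β * r) := by
    apply Real.exp_le_exp.2
    nlinarith
  calc _ ≤ A * Real.exp (-α * (s - τ n)) + A' * Real.exp (-α' * (u - τ' n)) := by linarith
    _ ≤ A * (Real.exp α * Real.exp (-β * r)) + A' * Real.exp (-β * r) := by gcongr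
    _ ≤ _ := by linarith

/-- The square roots on the contraction rate and on the final value `δ / n` match: the bound becomes
1 up to a constant at `t = log n / σ`, so the square roots cost only in the decay rate of the tail,
not in its location. -/
theorem sqrt_exp_pow_mul {σ δ : ℝ} (hσ : 0 < σ) (hδ : 0 < δ) {n : ℕ} (hn : 0 < n) (t : ℕ) :
    √(Real.exp (-σ)) ^ t * (2 / √(δ / n)) =
      2 / √δ * Real.exp (-(σ / 2) * (t - Real.log n / σ)) := by
  have hn0 : (0 : ℝ) < n := by exact_mod_cast hn
  have h1 : √(n : ℝ) = Real.exp (Real.log n / 2) := by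
    rw [Real.exp_half, Real.exp_log hn0]
  rw [← Real.exp_half, ← Real.exp_nat_mul, Real.sqrt_div hδ.le, h1,
    show -(σ / 2) * (t - Real.log n / σ) = t * (-σ / 2) + Real.log n / 2 by field_simp; ring,
    Real.exp_add]
  have := Real.sqrt_pos.2 hδ
  field_simp

/-! ### The early, growth, middle and late phases -/

theorem exp_mul_le_of_log {ρ A : ℝ} (hρ : 0 < ρ) (t : ℕ) :
    ρ ^ t * A ≤ A * Real.exp (-(-Real.log ρ) * (t - 0)) := by
  rw [neg_neg, sub_zero, mul_comm (Real.log ρ), Real.exp_nat_mul, Real.exp_log hρ, mul_comm]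

/-- For bounded `k` there is no concentration, so the potential `2^(-k)` is used: a single new node
halves it. With `j ≤ k` new nodes it falls at least to `2^(-k) (1 - j / (2k))`, and the mean of `j`
is at least `Q k / 2`, whence the factor `1 - Q / 4`. -/
theorem tailBound_early {C Q : ℝ} (hC : 0 < C) (hQ0 : 0 < Q) (hQ1 : Q < 1) (K : ℕ) (hK : 0 < K) :
    TailBound C Q (fun _ => 1) (fun _ => K) (fun _ => 0) := by
  have hK' : (0 : ℝ) < K := by exact_mod_cast hK
  set ρ := 1 - Q / 4 with hρ
  have hρ0 : 0 < ρ := by linarith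
  refine ⟨1 / 2⁻¹ ^ K, -Real.log ρ, by positivity, neg_pos.2 (Real.log_neg hρ0 (by linarith)),
    ⌈2 * (C + 2 * K) / Q⌉₊ + 1, fun n hn μ _ hμ I hI hl t => ?_⟩
  refine le_trans ?_ (exp_mul_le_of_log hρ0 t)
  have hn0 : 0 < n := by omega
  have hn0' : (0 : ℝ) < n := by exact_mod_cast hn0
  have hnQ : 2 * (C + 2 * K) ≤ Q * n := by
    have h1 : 2 * (C + 2 * K) / Q ≤ n := (Nat.le_ceil _).trans (Nat.cast_le.2 (by omega))
    rw [div_le_iff₀ hQ0] at h1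
    linarith
  refine slowProb_le_of_drift μ (l := 1) hρ0.le (by positivity) (fun J => (2⁻¹ : ℝ) ^ J.card)
    (fun J _ hm => ?_) (fun J hJ hm => ?_) hl zero_le_one
    (fun _ => pow_le_one₀ (by norm_num) (by norm_num)) t
  · have hm' : (J.card : ℝ) < K := hm
    have : J.card ≤ K := by exact_mod_cast hm'.le
    exact pow_le_pow_of_le_one (by norm_num) (by norm_num) this
  · have hpt : ∀ c, (if ((J ∪ J.image c).card : ℝ) < K then (2⁻¹ : ℝ) ^ (J ∪ J.image c).card else 0) ≤
        2⁻¹ ^ J.card * (1 - (((J ∪ J.image c).card : ℝ) - J.card) / (2 * J.card)) := by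
      intro c
      have hJ0 : (0 : ℝ) < J.card := by linarith
      have h1 : J.card ≤ (J ∪ J.image c).card := Finset.card_le_card Finset.subset_union_left
      have h2 := card_step_le J c
      have h3 : (2⁻¹ : ℝ) ^ (J ∪ J.image c).card ≤
          2⁻¹ ^ J.card * (1 - (((J ∪ J.image c).card : ℝ) - J.card) / (2 * J.card)) := by
        rcases h1.eq_or_lt with h1 | h1
        · rw [← h1]
          simp
        · have h4 : (2⁻¹ : ℝ) ^ (J ∪ J.image c).card ≤ 2⁻¹ ^ (J.card + 1) :=
            pow_le_pow_of_le_one (by norm_num) (by norm_num) h1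
          have h5 : (((J ∪ J.image c).card : ℝ) - J.card) / (2 * J.card) ≤ 2⁻¹ := by
            rw [div_le_iff₀ (by positivity)]
            linarith
          rw [pow_succ] at h4
          refine h4.trans (mul_le_mul_of_nonneg_left ?_ (by positivity))
          linarith
      split_ifs
      · exact h3
      · exact le_trans (by positivity) h3
    have h1 : stepMean μ (fun J' => if (J'.card : ℝ) < K then (2⁻¹ : ℝ) ^ J'.card else 0) J ≤
        ∫ c, 2⁻¹ ^ J.card * (1 - (((J ∪ J.image c).card : ℝ) - J.card) / (2 * J.card)) ∂μ :=
      integral_mono .of_finite .of_finite hpt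
    refine h1.trans ?_
    rw [integral_const_mul, integral_sub .of_finite .of_finite, integral_div,
      integral_sub .of_finite .of_finite, integral_card_step]
    simp only [integral_const, probReal_univ, one_smul]
    have h2 := (hμ.abs_mean_card_sub_le hC.le hQ0.le hQ1.le hn0 J).2
    set E := (n : ℝ) - ∫ c, ((J ∪ J.image c)ᶜ.card : ℝ) ∂μ
    have hJ0 : (0 : ℝ) < J.card := by linarith
    rw [mul_comm ρ]
    refine mul_le_mul_of_nonneg_left ?_ (by positivity)
    have h3 : Q / 4 ≤ (E - J.card) / (2 * J.card) := by
      rw [le_div_iff₀ (by positivity)]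
      have h4 : C * J.card / n + 2 * (J.card : ℝ) ^ 2 / n ≤ Q / 2 * J.card := by
        rw [← add_div, div_le_iff₀ hn0']
        have : 2 * (J.card : ℝ) ^ 2 ≤ 2 * K * J.card := by nlinarith
        nlinarith
      nlinarith
    linarith

theorem tailBound_growth {C Q : ℝ} (hC : 0 < C) (hQ0 : 0 < Q) (hQ1 : Q < 1) :
    ∃ (K : ℕ) (ε : ℝ), 0 < K ∧ 0 < ε ∧
      TailBound C Q (fun _ => K) (fun n => ε * n) (fun n => Real.log n / Real.log (1 + Q)) := by
  have hL1 : 1 < 1 + Q := by linarith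
  have hL0 : 0 < 1 + Q := by linarith
  have hlog : 0 < Real.log (1 + Q) := Real.log_pos hL1
  have hexp : Real.exp (-Real.log (1 + Q)) = (1 + Q)⁻¹ := by
    rw [Real.exp_neg, Real.exp_log hL0]
  obtain ⟨w₀, hw₀, hw₁, hmain⟩ := exists_slowProb_le_of_contraction (C := 4 * C) (by positivity)
    (inv_pos.2 hL0) (inv_lt_one_of_one_lt₀ hL1)
  -- `B` solves the fixed-point equation `B = (1 + Q)⁻¹ (B + (C + 2) + (C + 2)²)`, so that
  -- subtracting `B / n` from the inverse size removes the additive error of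
  -- `OneStep.integral_inv_card_le`.
  set B := ((C + 2) + (C + 2) ^ 2) / Q with hB
  have hB0 : 0 < B := by positivity
  -- `K ≥ 1 / w₀` makes `w = 1/k - B/n` at most `w₀`. The choice `ε = 1 / (4 B)` makes `B / n` at
  -- most a quarter of `1/k`, so `w` stays nonnegative even if `k` doubles, and `1/k ≤ 2 w`, which
  -- is the source of the constant `4 C`.
  refine ⟨⌈1 / w₀⌉₊, 1 / (4 * B), Nat.ceil_pos.2 (by positivity), by positivity,
    2 / √(1 / 2), Real.log (1 + Q) / 2, by positivity, by positivity, 1,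
    fun n hn μ _ hμ I hI hl t => ?_⟩
  have hn0 : 0 < n := by omega
  have hn0' : (0 : ℝ) < n := by exact_mod_cast hn0
  rw [← sqrt_exp_pow_mul hlog (by norm_num) hn0, hexp]
  refine hmain n μ ⌈1 / w₀⌉₊ (1 / (4 * B) * n) (1 / 2 / n) (fun J => (J.card : ℝ)⁻¹ - B / n)
    (by positivity) (fun J hJ hm => ?_) I hl t
  have hkw : 1 / w₀ ≤ J.card := (Nat.le_ceil _).trans hJ
  have hk0 : (0 : ℝ) < J.card := (by positivity : 0 < 1 / w₀).trans_le hkw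
  have hJne : J.Nonempty := Finset.card_pos.1 (by exact_mod_cast hk0)
  have hBk : 4 * B * J.card < n := by
    rw [div_mul_eq_mul_div, one_mul, lt_div_iff₀ (by positivity)] at hm
    linarith
  have hBn : B / n ≤ (J.card : ℝ)⁻¹ / 4 := by
    rw [div_le_iff₀ hn0', div_mul_eq_mul_div, inv_mul_eq_div, div_div, le_div_iff₀ (by positivity)]
    linarith
  have hinv : 0 < (J.card : ℝ)⁻¹ := inv_pos.2 hk0
  have hkn : (J.card : ℝ) ≤ n := by
    have := card_add_card_compl_real J
    linarith [(Nat.cast_nonneg _ : (0 : ℝ) ≤ Jᶜ.card)]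
  refine ⟨?_, ?_, fun c => ?_, ?_⟩
  · have : (1 : ℝ) / n ≤ (J.card : ℝ)⁻¹ := by
      rw [one_div]
      gcongr
    have h2 : (1 : ℝ) / 2 / n = 1 / n / 2 := by ring
    rw [h2]
    linarith
  · have : (J.card : ℝ)⁻¹ ≤ w₀ := by
      rw [inv_le_comm₀ hk0 hw₀, ← one_div]
      exact hkw
    have : 0 < B / n := by positivity
    linarith
  · have h1 := card_step_le J c
    have h2 := le_card_step J c
    have h3 : (2 * (J.card : ℝ))⁻¹ ≤ ((J ∪ J.image c).card : ℝ)⁻¹ := by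
      have := hk0.trans_le h2
      gcongr
    rw [mul_inv] at h3
    linarith
  · have h1 := hμ.integral_inv_card_le hC.le hQ0.le hQ1.le hJne
    unfold stepMean
    rw [integral_sub .of_finite .of_finite]
    simp only [integral_const, probReal_univ, one_smul]
    have h2 : C / (J.card : ℝ) ^ 2 ≤ 4 * C * ((J.card : ℝ)⁻¹ - B / n) ^ 2 := by
      have h3 : (J.card : ℝ)⁻¹ / 2 ≤ (J.card : ℝ)⁻¹ - B / n := by linarith
      have h4 := pow_le_pow_left₀ (by positivity) h3 2
      calc C / (J.card : ℝ) ^ 2 = 4 * C * ((J.card : ℝ)⁻¹ / 2) ^ 2 := by field_simp; ring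
        _ ≤ _ := by gcongr
    have h5 : B / n = (1 + Q)⁻¹ * (B / n + ((C + 2) + (C + 2) ^ 2) / n) := by
      rw [hB]
      field_simp
    calc _ ≤ (1 + Q)⁻¹ * ((J.card : ℝ)⁻¹ + ((C + 2) + (C + 2) ^ 2) / n + C / (J.card : ℝ) ^ 2) -
          (1 + Q)⁻¹ * (B / n + ((C + 2) + (C + 2) ^ 2) / n) := by linarith
      _ = (1 + Q)⁻¹ * (((J.card : ℝ)⁻¹ - B / n) + C / (J.card : ℝ) ^ 2) := by ring
      _ ≤ (1 + Q)⁻¹ * (((J.card : ℝ)⁻¹ - B / n) + 4 * C * ((J.card : ℝ)⁻¹ - B / n) ^ 2) := by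
        gcongr
      _ = _ := by ring

theorem card_compl_lt_of_slow {n : ℕ} {J : Finset (Fin n)} {m : ℝ} (h : (J.card : ℝ) < m) :
    n - m < (Jᶜ.card : ℝ) := by
  linarith [card_add_card_compl_real J]

/-- With at least `ε n` informed nodes, the expected number of uninformed ones falls by a constant
factor below 1 per round. It only has to fall from `n` to `w n`, hence the duration 0 up to
constants. -/
theorem tailBound_middle {C Q ε w : ℝ} (hC : 0 < C) (hQ0 : 0 < Q) (hε : 0 < ε)
    (hw : 0 < w) : TailBound C Q (fun n => ε * n) (fun n => (1 - w) * n) (fun _ => 0) := by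
  have he : Real.exp (-(Q * ε)) < 1 := Real.exp_lt_one_iff.2 (by nlinarith)
  have he0 := Real.exp_pos (-(Q * ε))
  set ρ := (1 + Real.exp (-(Q * ε))) / 2 with hρ
  have hρ0 : 0 < ρ := by positivity
  have hρ1 : ρ < 1 := by linarith
  refine ⟨1 / w, -Real.log ρ, by positivity, neg_pos.2 (Real.log_neg hρ0 hρ1),
    ⌈C / (ρ - Real.exp (-(Q * ε)))⌉₊ + 1, fun n hn μ _ hμ I hI hl t => ?_⟩
  refine le_trans ?_ (exp_mul_le_of_log hρ0 t)
  have hn0 : 0 < n := by omega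
  have hn0' : (0 : ℝ) < n := by exact_mod_cast hn0
  have hnC : C / n ≤ ρ - Real.exp (-(Q * ε)) := by
    have h1 : C / (ρ - Real.exp (-(Q * ε))) ≤ n :=
      (Nat.le_ceil _).trans (Nat.cast_le.2 (by omega))
    rw [div_le_iff₀ (by linarith)] at h1
    rw [div_le_iff₀ hn0']
    linarith
  have hconst : 1 / w = n / (w * n) := by field_simp
  rw [hconst]
  refine slowProb_le_of_drift μ (l := ε * n) hρ0.le (by positivity) (fun J => (Jᶜ.card : ℝ))
    (fun J _ hm => ?_) (fun J hJ hm => ?_) hl hn0'.le (fun _ => ?_) t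
  · linarith [card_compl_lt_of_slow hm]
  · have h1 : stepMean μ (fun J' => if (J'.card : ℝ) < (1 - w) * n then (J'ᶜ.card : ℝ) else 0) J ≤
        stepMean μ (fun J' => (J'ᶜ.card : ℝ)) J := by
      refine stepMean_mono μ fun J' _ => ?_
      split_ifs
      · exact le_rfl
      · positivity
    refine h1.trans ((hμ.mean_le_of_le_card hC.le hQ0.le hn0 J hJ).trans ?_)
    gcongr
    linarith
  · linarith [card_add_card_compl_real I, (Nat.cast_nonneg _ : (0 : ℝ) ≤ I.card)]

theorem tailBound_late {C Q : ℝ} (hC : 0 < C) (hQ0 : 0 < Q) (hQ1 : Q < 1) :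
    ∃ w : ℝ, 0 < w ∧
      TailBound C Q (fun n => (1 - w) * n) (fun n => n) (fun n => Real.log n / Q) := by
  obtain ⟨w₀, hw₀, hw₁, hmain⟩ := exists_slowProb_le_of_contraction (C := 2 + 3 * C)
    (by positivity) (Real.exp_pos (-Q)) (Real.exp_lt_one_iff.2 (by linarith))
  refine ⟨w₀, hw₀, 2 / √1, Q / 2, by positivity, by positivity, 1, fun n hn μ _ hμ I hI hl t => ?_⟩
  have hn0 : 0 < n := by omega
  have hn0' : (0 : ℝ) < n := by exact_mod_cast hn0
  rw [← sqrt_exp_pow_mul hQ0 one_pos hn0]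
  -- The fraction of uninformed nodes is at least `1 / n` until everybody is informed.
  refine hmain n μ ((1 - w₀) * n) n (1 / n) (fun J => (Jᶜ.card : ℝ) / n) (by positivity)
    (fun J hJ hm => ⟨?_, ?_, fun c => by positivity, ?_⟩) I hl t
  · have h1 := card_compl_lt_of_slow hm
    rw [sub_self] at h1
    have : (1 : ℝ) ≤ Jᶜ.card := by exact_mod_cast h1
    gcongr
  · rw [div_le_iff₀ hn0']
    linarith [card_add_card_compl_real J]
  · unfold stepMean
    rw [integral_div]
    have := hμ.mean_le hC.le hQ1.le hn0 J
    calc _ ≤ Real.exp (-Q) * Jᶜ.card * (1 + (2 + 3 * C) * (Jᶜ.card / n)) / n := by gcongr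
      _ = _ := by ring

theorem tailBound_full {C Q : ℝ} (hC : 0 < C) (hQ0 : 0 < Q) (hQ1 : Q < 1) :
    TailBound C Q (fun _ => 1) (fun n => n)
      (fun n => Real.log n / Real.log (1 + Q) + Real.log n / Q) := by
  obtain ⟨K, ε, hK, hε, h1⟩ := tailBound_growth hC hQ0 hQ1
  obtain ⟨w, hw, h3⟩ := tailBound_late hC hQ0 hQ1
  have hlog : ∀ n : ℕ, 0 ≤ Real.log n := fun n => Real.log_natCast_nonneg n
  have hl : 0 < Real.log (1 + Q) := Real.log_pos (by linarith)
  have h := (((tailBound_early hC hQ0 hQ1 K hK).trans h1 (fun _ => le_rfl)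
    fun n => div_nonneg (hlog n) hl.le).trans (tailBound_middle hC hQ0 hε hw)
      (fun n => add_nonneg le_rfl (div_nonneg (hlog n) hl.le)) fun _ => le_rfl).trans h3
      (fun n => add_nonneg (add_nonneg le_rfl (div_nonneg (hlog n) hl.le)) le_rfl)
      (fun n => div_nonneg (hlog n) hQ0.le)
  simpa only [zero_add, add_zero] using h

/-! ### Lower tail -/

/-- The function `x ↦ x ^ (-1/4)`. -/
noncomputable def invFourthRoot (x : ℝ) : ℝ := √((√x)⁻¹)

theorem invFourthRoot_eq_exp {x : ℝ} (hx : 0 < x) :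
    invFourthRoot x = Real.exp (-(Real.log x / 4)) := by
  have h1 : √x = Real.exp (Real.log x / 2) := by rw [Real.exp_half, Real.exp_log hx]
  rw [invFourthRoot, h1, ← Real.exp_neg, ← Real.exp_half]
  congr 1
  ring

theorem invFourthRoot_sq (x : ℝ) : invFourthRoot x ^ 2 = (√x)⁻¹ :=
  Real.sq_sqrt (inv_nonneg.2 (Real.sqrt_nonneg x))

theorem invFourthRoot_pow_four {x : ℝ} (hx : 0 ≤ x) : invFourthRoot x ^ 4 = x⁻¹ := by
  rw [show 4 = 2 * 2 from rfl, pow_mul, invFourthRoot_sq, inv_pow, Real.sq_sqrt hx]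

theorem invFourthRoot_nonneg (x : ℝ) : 0 ≤ invFourthRoot x := Real.sqrt_nonneg _

theorem invFourthRoot_anti {x y : ℝ} (hx : 0 < x) (hxy : x ≤ y) :
    invFourthRoot y ≤ invFourthRoot x := by
  rw [invFourthRoot_eq_exp hx, invFourthRoot_eq_exp (hx.trans_le hxy)]
  apply Real.exp_le_exp.2
  linarith [Real.log_le_log hx hxy]

theorem invFourthRoot_exp_mul (σ : ℝ) {x : ℝ} (hx : 0 < x) :
    invFourthRoot (Real.exp (-σ) * x) = Real.exp (σ / 4) * invFourthRoot x := by
  rw [invFourthRoot_eq_exp hx, invFourthRoot_eq_exp (mul_pos (Real.exp_pos _) hx),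
    Real.log_mul (Real.exp_pos _).ne' hx.ne', Real.log_exp, ← Real.exp_add]
  congr 1
  ring

/-- With variance of order `m`, the quadratic error is of order `1 / m`, which is small relative to
the main term `1 / √m`. For the inverse itself, error and main term would be of the same order. -/
theorem inv_sqrt_le_quadratic {z m : ℝ} (hz : 1 ≤ z) (hm : 0 < m) :
    (√z)⁻¹ ≤ (√m)⁻¹ - (z - m) / (2 * m * √m) + (z - m) ^ 2 / m ^ 2 := by
  have hu1 : 1 ≤ √z := Real.one_le_sqrt.2 hz
  have hw : 0 < √m := Real.sqrt_pos.2 hm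
  have hz2 : z = √z ^ 2 := (Real.sq_sqrt (by linarith)).symm
  have hm2 : m = √m ^ 2 := (Real.sq_sqrt hm.le).symm
  generalize √z = u at *
  generalize √m = w at *
  subst hz2 hm2
  have hu : 0 < u := by linarith
  have h1 : w⁻¹ - (u ^ 2 - w ^ 2) / (2 * w ^ 2 * w) + (u ^ 2 - w ^ 2) ^ 2 / (w ^ 2) ^ 2 - u⁻¹ =
      (u - w) ^ 2 * (2 * u * (u + w) ^ 2 - w * (u + 2 * w)) / (2 * w ^ 4 * u) := by
    field_simp
    ring
  have h2 : 0 ≤ 2 * u * (u + w) ^ 2 - w * (u + 2 * w) := by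
    nlinarith [mul_pos hu hw, mul_nonneg (by linarith : 0 ≤ u - 1) (sq_nonneg (u + w))]
  have h3 : 0 ≤ (u - w) ^ 2 * (2 * u * (u + w) ^ 2 - w * (u + 2 * w)) / (2 * w ^ 4 * u) := by
    positivity
  linarith

theorem le_inv_sqrt_linear {z m : ℝ} (hz : 0 < z) (hm : 0 < m) :
    (√m)⁻¹ - (z - m) / (2 * m * √m) ≤ (√z)⁻¹ := by
  have hu : 0 < √z := Real.sqrt_pos.2 hz
  have hw : 0 < √m := Real.sqrt_pos.2 hm
  have hz2 : z = √z ^ 2 := (Real.sq_sqrt hz.le).symm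
  have hm2 : m = √m ^ 2 := (Real.sq_sqrt hm.le).symm
  generalize √z = u at *
  generalize √m = w at *
  subst hz2 hm2
  have h1 : u⁻¹ - (w⁻¹ - (u ^ 2 - w ^ 2) / (2 * w ^ 2 * w)) =
      (u - w) ^ 2 * (u + 2 * w) / (2 * w ^ 3 * u) := by
    field_simp
    ring
  have h3 : 0 ≤ (u - w) ^ 2 * (u + 2 * w) / (2 * w ^ 3 * u) := by positivity
  linarith

theorem integral_inv_sqrt_bounds {n : ℕ} (μ : Measure (Fin n → Fin n)) [IsProbabilityMeasure μ]
    (f : (Fin n → Fin n) → ℝ) (hf : ∀ c, 1 ≤ f c) {m : ℝ} (hm : ∫ c, f c ∂μ = m) (hm0 : 0 < m) :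
    (√m)⁻¹ ≤ ∫ c, (√(f c))⁻¹ ∂μ ∧
      ∫ c, (√(f c))⁻¹ ∂μ ≤ (√m)⁻¹ + (∫ c, (f c - m) ^ 2 ∂μ) / m ^ 2 := by
  have hlin : ∫ c, ((√m)⁻¹ - (f c - m) / (2 * m * √m)) ∂μ = (√m)⁻¹ := by
    rw [integral_sub .of_finite .of_finite, integral_div, integral_sub .of_finite .of_finite, hm]
    simp
  constructor
  · rw [← hlin]
    exact integral_mono .of_finite .of_finite fun c =>
      le_inv_sqrt_linear (by linarith [hf c]) hm0
  · have h1 : ∫ c, (√(f c))⁻¹ ∂μ ≤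
        ∫ c, ((√m)⁻¹ - (f c - m) / (2 * m * √m) + (f c - m) ^ 2 / m ^ 2) ∂μ :=
      integral_mono .of_finite .of_finite fun c => inv_sqrt_le_quadratic (hf c) hm0
    rwa [integral_add .of_finite .of_finite, hlin, integral_div] at h1

/-- The potential function for the last part of the process: the number of uninformed nodes,
shifted by `D`, to the power `-1/4`, with a correction of lower order. -/
noncomputable def latePotential {n : ℕ} (D : ℝ) (J : Finset (Fin n)) : ℝ :=
  invFourthRoot (D + Jᶜ.card) - invFourthRoot (D + Jᶜ.card) ^ 2

/-- The subtracted square grows by `κ²` while only `κ` is allowed, and the gain `κ (κ - 1) ξ²`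
exceeds the cubic error `4 C κ³ ξ³` for small `ξ`. Monotonicity of `x - x²` below `1/2` permits
replacing `μ` by `ν`. -/
theorem sub_sq_add_cube_le {C μ ν κ ξ : ℝ} (hC : 0 < C) (hμ : 0 ≤ μ) (hμν : μ ≤ ν)
    (hν : ν = κ * ξ) (hκ1 : 1 ≤ κ) (hν2 : ν ≤ 1 / 2) (h : 4 * C * κ ^ 2 * ξ ≤ κ - 1) :
    μ + 4 * C * μ ^ 3 - μ ^ 2 ≤ κ * (ξ - ξ ^ 2) := by
  have h1 : μ + 4 * C * μ ^ 3 - μ ^ 2 ≤ ν + 4 * C * ν ^ 3 - ν ^ 2 := by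
    have h2 : 0 ≤ (ν - μ) * (1 - (ν + μ)) := mul_nonneg (by linarith) (by linarith)
    have h3 : μ ^ 3 ≤ ν ^ 3 := by gcongr
    nlinarith
  refine h1.trans ?_
  subst hν
  have h4 := mul_le_mul_of_nonneg_left h (by positivity : 0 ≤ κ * ξ ^ 2)
  nlinarith

/-- Here `x` is the shifted number of uninformed nodes, `m` its mean after one round and `b` the
mean of its power `-1/2`. With `ν = m^(-1/4)` one has `ν² ≤ b ≤ ν² + 8 C ν⁴`, hence `√b - b ≤ ν + 4
C ν³ - ν²`. -/
theorem sqrt_sub_self_le {C Q σ x m b ξ₀ : ℝ} (hC : 0 < C) (hQ0 : 0 < Q) (hQσ : Q ≤ σ)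
    (hσ2 : σ ≤ 2) (hx : 0 < x) (hmx : Real.exp (-σ) * x ≤ m) (hb1 : (√m)⁻¹ ≤ b)
    (hb2 : b ≤ (√m)⁻¹ + C * x / m ^ 2) (hξ4 : ξ₀ ≤ 1 / 4) (hξC : 64 * C * ξ₀ ≤ Q)
    (hξξ : invFourthRoot x ≤ ξ₀) :
    √b - b ≤ Real.exp (σ / 4) * (invFourthRoot x - invFourthRoot x ^ 2) := by
  have hm0 : 0 < m := (mul_pos (Real.exp_pos _) hx).trans_le hmx
  have hx8 : x ≤ 8 * m := by
    have h1 : Real.exp σ ≤ 8 := by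
      have h2 : Real.exp σ ≤ Real.exp (1 + 1) := Real.exp_le_exp.2 (by linarith)
      rw [Real.exp_add 1 1] at h2
      nlinarith [Real.exp_one_lt_d9, Real.exp_one_gt_d9]
    calc x = Real.exp σ * (Real.exp (-σ) * x) := by
          rw [← mul_assoc, ← Real.exp_add]
          simp
      _ ≤ 8 * m := by gcongr
  have hb2' : b ≤ invFourthRoot m ^ 2 + 8 * C * invFourthRoot m ^ 4 := by
    rw [invFourthRoot_sq, invFourthRoot_pow_four hm0.le]
    refine hb2.trans (add_le_add le_rfl ?_)
    calc _ ≤ C * (8 * m) / m ^ 2 := by gcongr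
      _ = _ := by field_simp
  rw [← invFourthRoot_sq] at hb1
  have hμν : invFourthRoot m ≤ Real.exp (σ / 4) * invFourthRoot x := by
    rw [← invFourthRoot_exp_mul σ hx]
    exact invFourthRoot_anti (mul_pos (Real.exp_pos _) hx) hmx
  have hμ0 := invFourthRoot_nonneg m
  have hξ0 := invFourthRoot_nonneg x
  generalize invFourthRoot m = ν at *
  generalize invFourthRoot x = ξ at *
  have hsb : √b ≤ ν + 4 * C * ν ^ 3 := by
    apply Real.sqrt_le_iff.2 ⟨by positivity, hb2'.trans ?_⟩
    nlinarith [sq_nonneg (4 * C * ν ^ 3)]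
  have hκ1 : 1 + σ / 4 ≤ Real.exp (σ / 4) := by linarith [Real.add_one_le_exp (σ / 4)]
  have hκ2 : Real.exp (σ / 4) ≤ 2 := by
    have h2 : Real.exp (σ / 4) ≤ Real.exp (1 / 2) := Real.exp_le_exp.2 (by linarith)
    have h3 := abs_le.1 (Real.abs_exp_sub_one_sub_id_le (x := 1 / 2) (by norm_num [abs_of_nonneg]))
    linarith
  have h12 : Real.exp (σ / 4) * ξ ≤ 1 / 2 := by
    calc Real.exp (σ / 4) * ξ ≤ 2 * (1 / 4) := by
          gcongr
          linarith
      _ = 1 / 2 := by norm_num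
  have hκξ : 4 * C * Real.exp (σ / 4) ^ 2 * ξ ≤ Real.exp (σ / 4) - 1 := by
    calc 4 * C * Real.exp (σ / 4) ^ 2 * ξ ≤ 4 * C * 2 ^ 2 * ξ₀ := by gcongr
      _ ≤ Q / 4 := by linarith
      _ ≤ _ := by linarith
  have hfin := sub_sq_add_cube_le hC hμ0 hμν rfl (by linarith) h12 hκξ
  linarith

theorem exists_stepMean_latePotential_le {C Q : ℝ} (hC : 0 < C) (hQ0 : 0 < Q) (hQ1 : Q < 1) :
    ∃ D ξ₀ : ℝ, 1 ≤ D ∧ 0 < ξ₀ ∧ ξ₀ ≤ 1 / 4 ∧ invFourthRoot D = ξ₀ ∧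
      ∀ n : ℕ, 6 * C < n → ∀ μ : Measure (Fin n → Fin n), IsProbabilityMeasure μ →
        OneStep C Q n μ → ∀ J : Finset (Fin n),
          stepMean μ (latePotential D) J ≤
            Real.exp ((Q + 6 * C / n) / 4) * latePotential D J := by
  obtain ⟨ξ₀, hξ0, hξ4, hξC⟩ : ∃ ξ₀ : ℝ, 0 < ξ₀ ∧ ξ₀ ≤ 1 / 4 ∧ 64 * C * ξ₀ ≤ Q := by
    refine ⟨min (1 / 4) (Q / (64 * C)), by positivity, min_le_left _ _, ?_⟩
    have : min (1 / 4) (Q / (64 * C)) ≤ Q / (64 * C) := min_le_right _ _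
    rw [le_div_iff₀ (by positivity)] at this
    linarith
  -- The shift by `D` keeps the fourth root term at most `ξ₀` for every number of uninformed nodes,
  -- including 0, so the drift inequality holds without a restriction on the set.
  obtain ⟨D, hD1, hDξ⟩ : ∃ D : ℝ, 1 ≤ D ∧ invFourthRoot D = ξ₀ := by
    refine ⟨(ξ₀ ^ 4)⁻¹, ?_, ?_⟩
    · rw [one_le_inv₀ (by positivity)]
      exact pow_le_one₀ hξ0.le (by linarith)
    · rw [invFourthRoot, Real.sqrt_inv, Real.sqrt_inv, Real.sqrt_inv, inv_inv,
        show ξ₀ ^ 4 = (ξ₀ ^ 2) ^ 2 by ring, Real.sqrt_sq (by positivity), Real.sqrt_sq hξ0.le]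
  refine ⟨D, ξ₀, hD1, hξ0, hξ4, hDξ, fun n hn μ _ hμ J => ?_⟩
  have hn0' : (0 : ℝ) < n := (by positivity : 0 < 6 * C).trans hn
  have hn0 : 0 < n := by exact_mod_cast hn0'
  have hCn : 6 * C / n ≤ 1 := by rw [div_le_one hn0']; exact hn.le
  have hCn0 : 0 ≤ 6 * C / n := by positivity
  have hM := hμ.le_mean hC.le hQ0.le hQ1.le hn0 J
  have hV := (hμ J).2
  have hkn := card_add_card_compl_real J
  have hk0 : (0 : ℝ) ≤ J.card := Nat.cast_nonneg _
  have hy0 : (0 : ℝ) ≤ Jᶜ.card := Nat.cast_nonneg _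
  have hV' : C * J.card * Jᶜ.card / n ≤ C * Jᶜ.card := by
    calc C * J.card * Jᶜ.card / n = C * Jᶜ.card * (J.card / n) := by ring
      _ ≤ C * Jᶜ.card * 1 := by
        gcongr
        rw [div_le_one hn0']
        linarith
      _ = _ := by ring
  have hexp : Real.exp (-(Q + 6 * C / n)) ≤ Real.exp (-Q) * (1 - 3 * C / n) := by
    rw [neg_add, Real.exp_add]
    refine mul_le_mul_of_nonneg_left ?_ (Real.exp_pos _).le
    have h2 : 3 * C / n = (6 * C / n) / 2 := by ring
    rw [h2, Real.exp_neg, inv_le_comm₀ (Real.exp_pos _) (by linarith)]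
    refine le_trans ?_ (Real.add_one_le_exp _)
    rw [inv_le_iff_one_le_mul₀ (by linarith)]
    nlinarith
  obtain ⟨M, hMdef⟩ : ∃ M, M = ∫ c, ((J ∪ J.image c)ᶜ.card : ℝ) ∂μ := ⟨_, rfl⟩
  rw [← hMdef] at hM hV
  have hmx : Real.exp (-(Q + 6 * C / n)) * (D + Jᶜ.card) ≤ D + M := by
    have h1 : Real.exp (-(Q + 6 * C / n)) ≤ 1 := Real.exp_le_one_iff.2 (by linarith)
    have h2 := mul_le_mul_of_nonneg_right hexp hy0
    have h3 : Real.exp (-(Q + 6 * C / n)) * D ≤ 1 * D := by gcongr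
    rw [mul_add]
    linarith
  have hm0 : 0 < D + M := (mul_pos (Real.exp_pos _) (by linarith)).trans_le hmx
  have hz1 : ∀ c, 1 ≤ D + ((J ∪ J.image c)ᶜ.card : ℝ) := fun c => by
    linarith [(Nat.cast_nonneg _ : (0 : ℝ) ≤ (J ∪ J.image c)ᶜ.card)]
  have hDM : ∫ c, (D + ((J ∪ J.image c)ᶜ.card : ℝ)) ∂μ = D + M := by
    rw [integral_add .of_finite .of_finite, integral_const, probReal_univ, one_smul, ← hMdef]
  obtain ⟨hb1, hb2⟩ := integral_inv_sqrt_bounds μ _ hz1 hDM hm0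
  simp only [add_sub_add_left_eq_sub] at hb2
  have hb3 : ∫ c, (√(D + ((J ∪ J.image c)ᶜ.card : ℝ)))⁻¹ ∂μ ≤
      (√(D + M))⁻¹ + C * (D + Jᶜ.card) / (D + M) ^ 2 := by
    refine hb2.trans (add_le_add le_rfl ?_)
    refine div_le_div_of_nonneg_right ?_ (sq_nonneg _)
    have : 0 ≤ C * D := by positivity
    linarith
  -- Jensen for the square root reduces the powers `-1/4` and `-1/2` to the single integral of the
  -- power `-1/2`.
  have hE : stepMean μ (latePotential D) J ≤ √(∫ c, (√(D + ((J ∪ J.image c)ᶜ.card : ℝ)))⁻¹ ∂μ) -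
      ∫ c, (√(D + ((J ∪ J.image c)ᶜ.card : ℝ)))⁻¹ ∂μ := by
    unfold stepMean latePotential
    rw [integral_sub .of_finite .of_finite]
    simp only [invFourthRoot_sq]
    have h1 := integral_sqrt_le μ (fun c => (√(D + ((J ∪ J.image c)ᶜ.card : ℝ)))⁻¹)
      fun c => inv_nonneg.2 (Real.sqrt_nonneg _)
    exact sub_le_sub_right h1 _
  refine hE.trans (sqrt_sub_self_le hC hQ0 (by linarith) (by linarith) (by linarith) hmx hb1 hb3
    hξ4 hξC ?_)
  rw [← hDξ]
  exact invFourthRoot_anti (by linarith) (by linarith)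

/-- The probability that everybody is informed after `t` more rounds. -/
noncomputable def doneProb {n : ℕ} (μ : Measure (Fin n → Fin n)) (t : ℕ) (I : Finset (Fin n)) : ℝ :=
  (stepMean μ)^[t] (fun J => if (J.card : ℝ) < n then 0 else 1) I

theorem doneProb_eq {n : ℕ} (μ : Measure (Fin n → Fin n)) [IsProbabilityMeasure μ] (t : ℕ)
    (I : Finset (Fin n)) : doneProb μ t I = 1 - slowProb μ n t I := by
  have h := stepMean_iterate_mul_add μ (-1) 1 (fun J => if (J.card : ℝ) < n then 1 else 0) t I
  have h2 : doneProb μ t I =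
      (stepMean μ)^[t] (fun J => -1 * (if (J.card : ℝ) < n then 1 else 0) + 1) I := by
    rw [doneProb]
    refine congrFun (congrArg _ (funext fun J => ?_)) I
    split_ifs <;> norm_num
  rw [h2, h, slowProb]
  ring

/-- The potential is at most `2 n^(-1/4)` when at least `3n/4` nodes are uninformed, is at least `ξ₀
/ 2` when none is, and grows in expectation by about `exp(Q / 4)` per round; Markov's inequality
concludes. -/
theorem exists_doneProb_late_le {C Q : ℝ} (hC : 0 < C) (hQ0 : 0 < Q) (hQ1 : Q < 1) :
    ∃ A : ℝ, 0 < A ∧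
      ∀ n : ℕ, 6 * C < n → ∀ μ : Measure (Fin n → Fin n), IsProbabilityMeasure μ →
        OneStep C Q n μ → ∀ J : Finset (Fin n), 4 * (J.card : ℝ) ≤ n → ∀ t : ℕ,
          doneProb μ t J ≤ A * Real.exp ((Q + 6 * C / n) / 4 * t - Real.log n / 4) := by
  obtain ⟨D, ξ₀, hD, hξ0, hξ4, hDξ, h⟩ := exists_stepMean_latePotential_le hC hQ0 hQ1
  refine ⟨4 / ξ₀, by positivity, fun n hn μ _ hμ J hJ t => ?_⟩
  have hn0 : (0 : ℝ) < n := (by positivity : 0 < 6 * C).trans hn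
  have hle : ∀ J : Finset (Fin n), invFourthRoot (D + Jᶜ.card) ≤ ξ₀ := fun J => by
    rw [← hDξ]
    exact invFourthRoot_anti (by linarith)
      (by linarith [(Nat.cast_nonneg _ : (0 : ℝ) ≤ Jᶜ.card)])
  have hpos : ∀ J : Finset (Fin n), 0 ≤ latePotential D J := fun J => by
    have h1 := hle J
    have h2 := invFourthRoot_nonneg (D + (Jᶜ.card : ℝ))
    unfold latePotential
    nlinarith
  have h1 := stepMean_iterate_le μ (g := latePotential D) (l := 0) (Real.exp_pos _).le
    (fun J _ => h n hn μ inferInstance hμ J) t (I := J) (Nat.cast_nonneg _)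
  have h2 : doneProb μ t J ≤ 2 / ξ₀ * (stepMean μ)^[t] (latePotential D) J + 0 := by
    rw [← stepMean_iterate_mul_add]
    refine stepMean_iterate_mono μ t fun J' _ => ?_
    have h3 := hpos J'
    rw [add_zero]
    split_ifs with hc
    · positivity
    · have h4 : (J'ᶜ.card : ℝ) = 0 := by
        have := card_add_card_compl_real J'
        have h5 : (0 : ℝ) ≤ J'ᶜ.card := Nat.cast_nonneg _
        linarith
      rw [latePotential, h4, add_zero, hDξ, div_mul_eq_mul_div, one_le_div hξ0]
      nlinarith
  have h6 : latePotential D J ≤ 2 * Real.exp (-(Real.log n / 4)) := by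
    have h7 : invFourthRoot (D + Jᶜ.card) ≤ invFourthRoot (n / 16) := by
      refine invFourthRoot_anti (by positivity) ?_
      linarith [card_add_card_compl_real J]
    have h8 : invFourthRoot ((n : ℝ) / 16) = 2 * Real.exp (-(Real.log n / 4)) := by
      rw [← invFourthRoot_eq_exp hn0, invFourthRoot, Real.sqrt_div hn0.le,
        show (16 : ℝ) = 4 ^ 2 by norm_num, Real.sqrt_sq (by norm_num), inv_div,
        div_eq_mul_inv, show (4 : ℝ) = 2 ^ 2 by norm_num, Real.sqrt_mul (by norm_num),
        Real.sqrt_sq (by norm_num)]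
      rfl
    unfold latePotential
    linarith [sq_nonneg (invFourthRoot (D + (Jᶜ.card : ℝ)))]
  rw [← Real.exp_nat_mul] at h1
  calc doneProb μ t J ≤ 2 / ξ₀ * (Real.exp (t * ((Q + 6 * C / n) / 4)) *
        (2 * Real.exp (-(Real.log n / 4)))) := by
        rw [add_zero] at h2
        refine h2.trans ?_
        gcongr
        exact h1.trans (by gcongr)
    _ = 4 / ξ₀ * (Real.exp (t * ((Q + 6 * C / n) / 4)) * Real.exp (-(Real.log n / 4))) := by ring
    _ = _ := by
      rw [← Real.exp_add]
      ring_nf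

/-- Finishing in time requires either more than `n/4` informed nodes after `s` rounds, bounded by
Markov's inequality, or a fast finish from at most `n/4`. -/
theorem doneProb_add_le {n : ℕ} (μ : Measure (Fin n → Fin n)) [IsProbabilityMeasure μ] (s t : ℕ)
    {B : ℝ} (hB : 0 ≤ B) (h : ∀ J : Finset (Fin n), 4 * (J.card : ℝ) ≤ n → doneProb μ t J ≤ B)
    (hn : 0 < n) (I : Finset (Fin n)) :
    doneProb μ (s + t) I ≤ 4 / n * (stepMean μ)^[s] (fun J => (J.card : ℝ)) I + B := by
  have h1 : doneProb μ (s + t) I = (stepMean μ)^[s] (doneProb μ t) I := by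
    rw [doneProb, Function.iterate_add_apply]
    rfl
  have hn0 : (0 : ℝ) < n := by exact_mod_cast hn
  rw [h1, ← stepMean_iterate_mul_add]
  refine stepMean_iterate_mono μ s fun J _ => ?_
  by_cases hJ : 4 * (J.card : ℝ) ≤ n
  · have : 0 ≤ 4 / (n : ℝ) * J.card := by positivity
    linarith [h J hJ]
  · have h2 : 1 ≤ 4 / (n : ℝ) * J.card := by
      rw [div_mul_eq_mul_div, one_le_div hn0]
      exact (not_le.1 hJ).le
    have h3 : doneProb μ t J ≤ 1 := by
      have h4 : (stepMean μ)^[t] (fun _ => (1 : ℝ)) J = 1 := by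
        simpa using stepMean_iterate_mul_add μ 0 1 (fun _ => 0) t J
      refine (stepMean_iterate_mono μ t fun J _ => ?_).trans h4.le
      split_ifs <;> norm_num
    linarith

theorem stepMean_iterate_card_le {C Q : ℝ} (hC : 0 < C) (hQ0 : 0 < Q) (hQ1 : Q < 1) {n : ℕ}
    (hn : 0 < n) {μ : Measure (Fin n → Fin n)} [IsProbabilityMeasure μ] (hμ : OneStep C Q n μ)
    (t : ℕ) (I : Finset (Fin n)) :
    (stepMean μ)^[t] (fun J => (J.card : ℝ)) I ≤
      Real.exp (t * (Real.log (1 + Q) + C / n)) * I.card := by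
  rw [Real.exp_nat_mul]
  refine stepMean_iterate_le μ (l := 0) (Real.exp_pos _).le (fun J _ => ?_) t (Nat.cast_nonneg _)
  unfold stepMean
  rw [integral_card_step, Real.exp_add, Real.exp_log (by linarith)]
  refine (hμ.abs_mean_card_sub_le hC.le hQ0.le hQ1.le hn J).1.trans ?_
  have h1 := Real.add_one_le_exp (C / n)
  have hk0 : (0 : ℝ) ≤ J.card := Nat.cast_nonneg _
  have h2 : 0 ≤ Q * (C / n) * J.card := by positivity
  calc (1 + Q) * J.card + C * J.card / n ≤ (1 + Q) * (C / n + 1) * J.card := by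
        have : C * J.card / n = C / n * J.card := by ring
        rw [this]
        linarith
    _ ≤ _ := by gcongr

theorem exists_doneProb_le {C Q : ℝ} (hC : 0 < C) (hQ0 : 0 < Q) (hQ1 : Q < 1) :
    ∃ A α : ℝ, 0 < A ∧ 0 < α ∧ ∃ n₀ : ℕ, ∀ n ≥ n₀, ∀ μ : Measure (Fin n → Fin n),
      IsProbabilityMeasure μ → OneStep C Q n μ → ∀ I : Finset (Fin n), I.card = 1 → ∀ t : ℕ,
        doneProb μ t I ≤
          A * Real.exp (-α * (Real.log n / Real.log (1 + Q) + Real.log n / Q - t)) := by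
  obtain ⟨A, hA, h⟩ := exists_doneProb_late_le hC hQ0 hQ1
  have hl : 0 < Real.log (1 + Q) := Real.log_pos (by linarith)
  set lam := Real.log (1 + Q) with hlam
  -- The share of the growth phase in the total estimate. Splitting `t` in this proportion gives
  -- each phase its share of the deficit `r`.
  set κ := (1 / lam) / (1 / lam + 1 / Q) with hκ
  have hκ0 : 0 < κ := by positivity
  have hκ1 : κ < 1 := by
    rw [hκ, div_lt_one (by positivity)]
    have : 0 < 1 / Q := by positivity
    linarith
  set α := min (lam * κ) (Q * (1 - κ) / 4) with hα
  have hα0 : 0 < α := lt_min (by positivity) (by nlinarith)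
  -- The exponentials in `A₁` and `A₂` absorb the relative errors of order `1 / n` per round: the
  -- number of rounds is `O(log n)`, and `log n ≤ n`.
  set A₁ := 4 * Real.exp (C / lam) with hA₁
  set A₂ := A * Real.exp ((Q + 6 * C * (1 / Q + 1)) / 4) with hA₂
  refine ⟨A₁ + A₂ + 1, α, by positivity, hα0, ⌈6 * C⌉₊ + 1, fun n hn μ _ hμ I hI t => ?_⟩
  have hn0 : 0 < n := by omega
  have hn1 : (1 : ℝ) ≤ n := by exact_mod_cast hn0
  have hnC : 6 * C < n := by
    have h1 : ((⌈6 * C⌉₊ + 1 : ℕ) : ℝ) ≤ n := Nat.cast_le.2 hn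
    push_cast at h1
    linarith [Nat.le_ceil (6 * C)]
  set ℓ := Real.log n with hℓ
  have hℓ0 : 0 ≤ ℓ := Real.log_nonneg hn1
  have hℓn : ℓ ≤ n := (Real.log_le_sub_one_of_pos (by linarith)).trans (by linarith)
  set r := ℓ / lam + ℓ / Q - t with hr
  have hEr := Real.exp_pos (-α * r)
  by_cases hr0 : r < 0
  · have h1 : doneProb μ t I ≤ 1 := by
      rw [doneProb_eq]
      have : 0 ≤ slowProb μ n t I := by
        have h4 : (stepMean μ)^[t] (fun _ => (0 : ℝ)) I = 0 := by
          simpa using stepMean_iterate_mul_add μ 0 0 (fun _ => 0) t I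
        refine h4.ge.trans (stepMean_iterate_mono μ t fun J _ => ?_)
        split_ifs <;> norm_num
      linarith
    have h2 : 1 ≤ Real.exp (-α * r) := Real.one_le_exp (by nlinarith)
    have h3 : 0 < A₁ + A₂ := by positivity
    nlinarith
  rw [not_lt] at hr0
  have ht0 : (0 : ℝ) ≤ t := Nat.cast_nonneg _
  set s := ⌊κ * t⌋₊ with hs
  have hs1 : (s : ℝ) ≤ κ * t := Nat.floor_le (by positivity)
  have hs2 : κ * t < s + 1 := Nat.lt_floor_add_one _
  have hst : s ≤ t := by
    have : (s : ℝ) ≤ t := hs1.trans (mul_le_of_le_one_left ht0 hκ1.le)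
    exact_mod_cast this
  have htr : (t : ℝ) = ℓ * (1 / lam + 1 / Q) - r := by rw [hr]; ring
  have hκt : κ * t = ℓ / lam - κ * r := by
    rw [htr, hκ]
    field_simp
  have hκt' : (1 - κ) * t = ℓ / Q - (1 - κ) * r := by
    have : (1 - κ) * t = t - κ * t := by ring
    rw [this, hκt, htr]
    ring
  clear_value s r
  obtain ⟨u, rfl⟩ := Nat.exists_eq_add_of_le hst
  push_cast at *
  have hs3 : (s : ℝ) ≤ ℓ / lam - κ * r := by linarith
  have hu3 : (u : ℝ) ≤ ℓ / Q - (1 - κ) * r + 1 := by linarith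
  have hκr : 0 ≤ κ * r := by positivity
  have hκr' : 0 ≤ (1 - κ) * r := mul_nonneg (by linarith) hr0
  have h1 := doneProb_add_le μ s u (B := A * Real.exp ((Q + 6 * C / n) / 4 * u - ℓ / 4))
    (by positivity) (fun J hJ => h n hnC μ inferInstance hμ J hJ u) hn0 I
  have h2 := stepMean_iterate_card_le hC hQ0 hQ1 hn0 hμ s I
  rw [hI, Nat.cast_one, mul_one] at h2
  have h3 : 4 / n * Real.exp (s * (lam + C / n)) ≤ A₁ * Real.exp (-α * r) := by
    have hnexp : (4 : ℝ) / n = 4 * Real.exp (-ℓ) := by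
      rw [Real.exp_neg, hℓ, Real.exp_log (by linarith)]
      ring
    rw [hnexp, hA₁, mul_assoc, mul_assoc, ← Real.exp_add, ← Real.exp_add]
    refine mul_le_mul_of_nonneg_left (Real.exp_le_exp.2 ?_) (by norm_num)
    have h4 : s * lam ≤ ℓ - lam * κ * r := by
      calc s * lam ≤ (ℓ / lam - κ * r) * lam := by gcongr
        _ = _ := by field_simp
    have h5 : s * (C / n) ≤ C / lam := by
      calc s * (C / n) ≤ (n / lam) * (C / n) := by
            gcongr
            have : ℓ / lam ≤ n / lam := by gcongr
            linarith
        _ = _ := by field_simp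
    have h6 : α * r ≤ lam * κ * r := by
      gcongr
      exact min_le_left _ _
    linarith
  have h7 : A * Real.exp ((Q + 6 * C / n) / 4 * u - ℓ / 4) ≤ A₂ * Real.exp (-α * r) := by
    rw [hA₂, mul_assoc, ← Real.exp_add]
    refine mul_le_mul_of_nonneg_left (Real.exp_le_exp.2 ?_) hA.le
    have h8 : Q * u ≤ ℓ - Q * (1 - κ) * r + Q := by
      calc Q * u ≤ Q * (ℓ / Q - (1 - κ) * r + 1) := by gcongr
        _ = _ := by field_simp
    have h9 : 6 * C / n * u ≤ 6 * C * (1 / Q + 1) := by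
      calc 6 * C / n * u ≤ 6 * C / n * (n / Q + n) := by
            gcongr
            have : ℓ / Q ≤ n / Q := by gcongr
            linarith
        _ = _ := by field_simp
    have h10 : α * r ≤ Q * (1 - κ) / 4 * r := by
      gcongr
      exact min_le_right _ _
    linarith
  have h11 : 4 / (n : ℝ) * (stepMean μ)^[s] (fun J => (J.card : ℝ)) I ≤
      4 / n * Real.exp (s * (lam + C / n)) := by gcongr
  linarith

/-! ### The process -/

/-- The informed set after `t` rounds depends on the choices with indices below `t` only, a finite
discrete space. This gives both measurability and independence from the next round. -/
theorem exists_informed_eq_restrict {n : ℕ} (s : Fin n) (t : ℕ) :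
    ∃ φ : (Finset.range t → Fin n → Fin n) → Finset (Fin n),
      ∀ ω : ℕ → Fin n → Fin n, informed s t ω = φ fun i => ω i := by
  induction t with
  | zero => exact ⟨fun _ => {s}, fun _ => rfl⟩
  | succ t ih =>
    obtain ⟨φ, hφ⟩ := ih
    refine ⟨fun x => φ (fun i => x ⟨i, Finset.mem_range.2 (by have := Finset.mem_range.1 i.2; omega)⟩) ∪
      (φ (fun i => x ⟨i, Finset.mem_range.2 (by have := Finset.mem_range.1 i.2; omega)⟩)).image
        (x ⟨t, Finset.self_mem_range_succ t⟩), fun ω => ?_⟩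
    rw [informed, hφ]

instance (n : ℕ) (p : unitInterval) : IsProbabilityMeasure (processLaw n p) := by
  unfold processLaw
  infer_instance

/-- The Markov property, obtained by Fubini from the independence of the past and the choices of the
current round. -/
theorem integral_informed_succ {n : ℕ} (p : unitInterval) (s : Fin n) (t : ℕ)
    (f : Finset (Fin n) → ℝ) :
    ∫ ω, f (informed s (t + 1) ω) ∂processLaw n p =
      ∫ ω, stepMean (roundLaw n p) f (informed s t ω) ∂processLaw n p := by
  obtain ⟨φ, hφ⟩ := exists_informed_eq_restrict s t
  set X : (ℕ → Fin n → Fin n) → (Finset.range t → Fin n → Fin n) := fun ω i => ω i with hX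
  have hXm : Measurable X := by fun_prop
  have hYm : Measurable fun ω : ℕ → Fin n → Fin n => ω t := by fun_prop
  have hind : IndepFun X (fun ω => ω t) (processLaw n p) := by
    have h := (iIndepFun_infinitePi (P := fun _ : ℕ => roundLaw n p) (X := fun _ x => x)
      fun _ => measurable_id).indepFun_finset (Finset.range t) {t} (by simp)
        fun i => by fun_prop
    exact h.comp measurable_id (measurable_pi_apply (⟨t, Finset.mem_singleton_self t⟩ : ({t} : Finset ℕ)))
  have hmap := (indepFun_iff_map_prod_eq_prod_map_map hXm.aemeasurable hYm.aemeasurable).1 hind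
  have hY : (processLaw n p).map (fun ω => ω t) = roundLaw n p :=
    Measure.infinitePi_map_eval (μ := fun _ : ℕ => roundLaw n p) t
  have : IsProbabilityMeasure ((processLaw n p).map X) :=
    Measure.isProbabilityMeasure_map hXm.aemeasurable
  rw [hY] at hmap
  calc ∫ ω, f (informed s (t + 1) ω) ∂processLaw n p
      = ∫ ω, f (φ (X ω) ∪ (φ (X ω)).image (ω t)) ∂processLaw n p := by
        simp only [informed, hφ, hX]
    _ = ∫ x, f (φ x.1 ∪ (φ x.1).image x.2) ∂(processLaw n p).map fun ω => (X ω, ω t) := by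
        rw [integral_map (hXm.prodMk hYm).aemeasurable .of_discrete]
    _ = ∫ x, stepMean (roundLaw n p) f (φ x) ∂(processLaw n p).map X := by
        rw [hmap, integral_prod _ .of_finite]
        rfl
    _ = _ := by
        rw [integral_map hXm.aemeasurable .of_discrete]
        simp only [hφ, hX]

theorem integral_informed {n : ℕ} (p : unitInterval) (s : Fin n) (t : ℕ)
    (f : Finset (Fin n) → ℝ) :
    ∫ ω, f (informed s t ω) ∂processLaw n p = (stepMean (roundLaw n p))^[t] f {s} := by
  induction t generalizing f with
  | zero => simp [informed]
  | succ t ih => rw [integral_informed_succ, ih, Function.iterate_succ_apply]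

theorem measurableSet_informed {n : ℕ} (s : Fin n) (t : ℕ) (A : Set (Finset (Fin n))) :
    MeasurableSet {ω | informed s t ω ∈ A} := by
  obtain ⟨φ, hφ⟩ := exists_informed_eq_restrict s t
  have : {ω | informed s t ω ∈ A} =
      (fun (ω : ℕ → Fin n → Fin n) (i : Finset.range t) => ω i) ⁻¹' (φ ⁻¹' A) := by
    ext ω
    simp [hφ]
  rw [this]
  exact (by fun_prop : Measurable fun (ω : ℕ → Fin n → Fin n) (i : Finset.range t) => ω i)
    (MeasurableSet.of_discrete)

theorem processLaw_real_informed_ne {n : ℕ} (p : unitInterval) (s : Fin n) (t : ℕ) :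
    (processLaw n p).real {ω | informed s t ω ≠ Finset.univ} = slowProb (roundLaw n p) n t {s} := by
  have hm : MeasurableSet {ω | informed s t ω ≠ Finset.univ} :=
    measurableSet_informed s t {J | J ≠ Finset.univ}
  rw [← integral_indicator_one hm, slowProb, ← integral_informed]
  congr 1 with ω
  by_cases h : informed s t ω = Finset.univ
  · simp [h]
  · have : (informed s t ω).card < n := by
      simpa using (Finset.card_lt_iff_ne_univ _).2 h
    simp [h, this]

theorem processLaw_real_informed_eq {n : ℕ} (p : unitInterval) (s : Fin n) (t : ℕ) :
    (processLaw n p).real {ω | informed s t ω = Finset.univ} = doneProb (roundLaw n p) t {s} := by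
  have hm : MeasurableSet {ω | informed s t ω ≠ Finset.univ} :=
    measurableSet_informed s t {J | J ≠ Finset.univ}
  rw [doneProb_eq, ← processLaw_real_informed_ne, ← probReal_compl_eq_one_sub hm]
  congr 1
  ext ω
  simp

theorem informed_mono {n : ℕ} (s : Fin n) (ω : ℕ → Fin n → Fin n) :
    Monotone fun t => informed s t ω :=
  monotone_nat_of_le_succ fun _ => Finset.subset_union_left

theorem spreadingTime_le_iff {n : ℕ} (s : Fin n) (ω : ℕ → Fin n → Fin n) (t : ℕ) :
    spreadingTime s ω ≤ t ↔ informed s t ω = Finset.univ := by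
  change hittingAfter (informed s) {Finset.univ} 0 ω ≤ WithTop.some t ↔ _
  rw [hittingAfter_le_iff]
  constructor
  · rintro ⟨j, hj, h⟩
    have := informed_mono s ω hj.2
    rw [Set.mem_singleton_iff] at h
    simpa [h] using this
  · exact fun h => ⟨t, ⟨Nat.zero_le t, le_rfl⟩, h⟩

/-! ### Concentration from exponential tails -/

/-- Summing the tails bounds the first absolute moment of `X - f` by the geometric series `c`. Hence
the mean is within `c` of `f`, and centering at the mean instead of `f` shifts the tail by `c`, plus
1 for rounding. -/
theorem concentration_of_tails {Ω : Type*} [MeasurableSpace Ω] (P : Measure Ω)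
    [IsProbabilityMeasure P] {X : Ω → ℝ} (hX : Measurable X) {f A α : ℝ} (hA : 0 < A)
    (hα : 0 < α) (h : ∀ j : ℕ, P.real {ω | (j : ℝ) ≤ |X ω - f|} ≤ A * Real.exp (-α * j)) :
    Integrable X P ∧ |∫ ω, X ω ∂P - f| ≤ A / (1 - Real.exp (-α)) ∧
      ∀ r : ℕ, P.real {ω | (r : ℝ) ≤ |X ω - ∫ ω', X ω' ∂P|} ≤
        A * Real.exp (α * (A / (1 - Real.exp (-α)) + 1)) * Real.exp (-α * r) := by
  set c := A / (1 - Real.exp (-α)) with hc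
  have he : Real.exp (-α) < 1 := by simpa using hα
  have hc0 : 0 < c := div_pos hA (by linarith)
  have hgeom : HasSum (fun j : ℕ => A * Real.exp (-α * j)) c := by
    have e : (fun j : ℕ => A * Real.exp (-α * j)) = fun j : ℕ => A * Real.exp (-α) ^ j := by
      funext j
      rw [← Real.exp_nat_mul, mul_comm (j : ℝ)]
    rw [e, hc, div_eq_mul_inv]
    exact (hasSum_geometric_of_lt_one (Real.exp_pos (-α)).le he).mul_left A
  have hm : ∀ j : ℕ, MeasurableSet {ω | (j : ℝ) ≤ |X ω - f|} := fun j =>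
    measurableSet_le measurable_const (by fun_prop)
  have hpt : ∀ ω, ‖X ω - f‖ₑ ≤
      ∑' j : ℕ, ({ω | (j : ℝ) ≤ |X ω - f|} : Set Ω).indicator (1 : Ω → ENNReal) ω := fun ω => by
    refine le_trans ?_ (ENNReal.sum_le_tsum (Finset.range (⌊|X ω - f|⌋₊ + 1)))
    have : ∀ j ∈ Finset.range (⌊|X ω - f|⌋₊ + 1),
        ({ω | (j : ℝ) ≤ |X ω - f|} : Set Ω).indicator (1 : Ω → ENNReal) ω = 1 := fun j hj => by
      have hj' : j ≤ ⌊|X ω - f|⌋₊ := Nat.lt_succ_iff.1 (Finset.mem_range.1 hj)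
      have hmem : ω ∈ {ω | (j : ℝ) ≤ |X ω - f|} := (Nat.le_floor_iff (abs_nonneg _)).1 hj'
      rw [Set.indicator_of_mem hmem, Pi.one_apply]
    rw [Finset.sum_congr rfl this, Finset.sum_const, Finset.card_range, nsmul_one,
      Real.enorm_eq_ofReal_abs, ← ENNReal.ofReal_natCast]
    refine ENNReal.ofReal_le_ofReal ?_
    push_cast
    exact (Nat.lt_floor_add_one _).le
  have hlint : ∫⁻ ω, ‖X ω - f‖ₑ ∂P ≤ ENNReal.ofReal c := by
    calc ∫⁻ ω, ‖X ω - f‖ₑ ∂P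
        ≤ ∫⁻ ω, ∑' j : ℕ, ({ω | (j : ℝ) ≤ |X ω - f|} : Set Ω).indicator (1 : Ω → ENNReal) ω ∂P :=
          lintegral_mono hpt
      _ = ∑' j : ℕ, P {ω | (j : ℝ) ≤ |X ω - f|} := by
          rw [lintegral_tsum fun j => (measurable_one.indicator (hm j)).aemeasurable]
          exact tsum_congr fun j => lintegral_indicator_one (hm j)
      _ ≤ ∑' j : ℕ, ENNReal.ofReal (A * Real.exp (-α * j)) :=
          ENNReal.tsum_le_tsum fun j => by
            rw [← ofReal_measureReal]
            exact ENNReal.ofReal_le_ofReal (h j)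
      _ = ENNReal.ofReal c := by
          rw [← ENNReal.ofReal_tsum_of_nonneg (fun j => by positivity) hgeom.summable,
            hgeom.tsum_eq]
  have hint : Integrable (fun ω => X ω - f) P :=
    ⟨by fun_prop, hlint.trans_lt ENNReal.ofReal_lt_top⟩
  have hintX : Integrable X P :=
    (hint.add (integrable_const f)).congr (.of_forall fun ω => sub_add_cancel (X ω) f)
  have hmean : |∫ ω, X ω ∂P - f| ≤ c := by
    have e : ∫ ω, X ω ∂P - f = ∫ ω, (X ω - f) ∂P := by
      rw [integral_sub hintX (integrable_const f)]
      simp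
    rw [e, ← Real.norm_eq_abs]
    refine (norm_integral_le_integral_norm _).trans ?_
    rw [← ENNReal.ofReal_le_ofReal_iff hc0.le, ofReal_integral_norm_eq_lintegral_enorm hint]
    exact hlint
  refine ⟨hintX, hmean, fun r => ?_⟩
  have hsub : {ω | (r : ℝ) ≤ |X ω - ∫ ω', X ω' ∂P|} ⊆
      {ω | ((⌊(r : ℝ) - c⌋₊ : ℕ) : ℝ) ≤ |X ω - f|} := fun ω hω => by
    have h1 : (r : ℝ) - c ≤ |X ω - f| := by
      have h2 : (r : ℝ) ≤ |X ω - ∫ ω', X ω' ∂P| := hω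
      have h3 := abs_sub_le (X ω) f (∫ ω', X ω' ∂P)
      rw [abs_sub_comm f] at h3
      linarith
    exact (Nat.cast_le.2 (Nat.floor_le_floor h1)).trans (Nat.floor_le (abs_nonneg _))
  refine (measureReal_mono hsub).trans ((h _).trans ?_)
  rw [mul_assoc, ← Real.exp_add]
  refine mul_le_mul_of_nonneg_left (Real.exp_le_exp.2 ?_) hA.le
  have := Nat.sub_one_lt_floor ((r : ℝ) - c)
  nlinarith

/-! ### Both tails of the spreading time -/

/-- The approximate value of the expected spreading time. -/
noncomputable def spreadingEstimate (a : ℝ) (n : ℕ) : ℝ :=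
  Real.logb (2 - Real.exp (-a)) n + 1 / (1 - Real.exp (-a)) * Real.log n

theorem spreadingEstimate_eq (a : ℝ) (n : ℕ) :
    spreadingEstimate a n = Real.log n / Real.log (1 + (1 - Real.exp (-a))) +
      Real.log n / (1 - Real.exp (-a)) := by
  rw [spreadingEstimate, Real.logb, one_div_mul_eq_div]
  congr 4
  ring

theorem spreadingEstimate_mono {a : ℝ} (ha : 0 < a) {n N : ℕ} (hn : 1 ≤ n) (hnN : n ≤ N) :
    spreadingEstimate a n ≤ spreadingEstimate a N := by
  have he : Real.exp (-a) < 1 := by simpa using ha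
  have hl : Real.log n ≤ Real.log N :=
    Real.log_le_log (by exact_mod_cast hn) (by exact_mod_cast hnN)
  rw [spreadingEstimate_eq, spreadingEstimate_eq]
  have := Real.log_pos (show 1 < 1 + (1 - Real.exp (-a)) by linarith)
  have : 0 < 1 - Real.exp (-a) := by linarith
  gcongr

theorem spreadingEstimate_nonneg {a : ℝ} (ha : 0 < a) (n : ℕ) : 0 ≤ spreadingEstimate a n := by
  have he : Real.exp (-a) < 1 := by simpa using ha
  have := Real.log_pos (show 1 < 1 + (1 - Real.exp (-a)) by linarith)
  have : 0 < 1 - Real.exp (-a) := by linarith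
  have := Real.log_natCast_nonneg n
  rw [spreadingEstimate_eq]
  positivity

/-- Meant for the finitely many `n ≤ N`: the expected number of uninformed nodes drops by at least
`a / n²` per round, hence by a factor uniform in `n`. The maximum with `1/2` keeps the base
positive, so that its logarithm can serve as a rate. -/
theorem slowProb_le_of_progress {a : ℝ} (ha : 0 < a) {n N : ℕ} (hn : a ≤ n) (hnN : n ≤ N)
    (s : Fin n) (t : ℕ) :
    slowProb (roundLaw n (edgeProb a n ha hn)) n t {s} ≤
      max (1 / 2) (1 - a / (N : ℝ) ^ 3) ^ t * N := by
  set ρ := max (1 / 2) (1 - a / (N : ℝ) ^ 3) with hρ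
  have hρ0 : 0 ≤ ρ := le_max_of_le_left (by norm_num)
  have hn0 : (0 : ℝ) < n := ha.trans_le hn
  have hnN' : (n : ℝ) ≤ N := by exact_mod_cast hnN
  have hK : ∀ J : Finset (Fin n), (Jᶜ.card : ℝ) ≤ n := fun J => by
    have := card_add_card_compl_real J
    have : (0 : ℝ) ≤ J.card := Nat.cast_nonneg _
    linarith
  refine (slowProb_le_of_drift (roundLaw n (edgeProb a n ha hn)) (l := 1) (m := n) hρ0 one_pos
    (fun J => (Jᶜ.card : ℝ)) ?_ ?_ ?_ hn0.le (fun _ => hK _) t).trans ?_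
  · intro J _ hJ
    have h1 := card_add_card_compl_real J
    have h2 : J.card < n := by exact_mod_cast hJ
    have h3 : (J.card : ℝ) + 1 ≤ n := by exact_mod_cast h2
    linarith
  · intro J hJ0 hJ
    have hJn : J.Nonempty := by
      rw [← Finset.card_pos]
      exact_mod_cast one_pos.trans_le hJ0
    have hJu : J ≠ Finset.univ := fun h => by simp [h] at hJ
    refine le_trans (stepMean_mono _ (g := fun J => (Jᶜ.card : ℝ)) (fun J' _ => ?_))
      ((integral_card_compl_step_le_sub ha hn hJn hJu).trans ?_)
    · split_ifs
      · exact le_rfl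
      · positivity
    · have h1 := hK J
      have h2 : a / (N : ℝ) ^ 3 * (Jᶜ.card : ℝ) ≤ a / (n : ℝ) ^ 2 := by
        calc a / (N : ℝ) ^ 3 * (Jᶜ.card : ℝ) ≤ a / (n : ℝ) ^ 3 * n := by gcongr
          _ = _ := by field_simp
      have h3 : (1 - a / (N : ℝ) ^ 3) * (Jᶜ.card : ℝ) ≤ ρ * Jᶜ.card := by
        gcongr
        exact le_max_right _ _
      linarith
  · simp
  · rw [div_one]
    gcongr

theorem le_mul_exp_of_le {p A α A' α' x : ℝ} (hp : p ≤ 1) (h : p ≤ A * Real.exp (-α * x))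
    (hA0 : 0 ≤ A) (hA : A ≤ A') (hA' : 1 ≤ A') (hα0 : 0 ≤ α') (hα : α' ≤ α) :
    p ≤ A' * Real.exp (-α' * x) := by
  rcases le_total 0 x with hx | hx
  · refine h.trans (mul_le_mul hA (Real.exp_le_exp.2 ?_) (Real.exp_pos _).le (hA0.trans hA))
    nlinarith
  · have : 1 ≤ Real.exp (-α' * x) := Real.one_le_exp (by nlinarith)
    nlinarith

theorem tails {a : ℝ} (ha : 0 < a) :
    ∃ A α : ℝ, 0 < A ∧ 0 < α ∧ ∀ (n : ℕ) (hn : a ≤ n) (s : Fin n) (t : ℕ),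
      (processLaw n (edgeProb a n ha hn)).real {ω | informed s t ω ≠ Finset.univ} ≤
        A * Real.exp (-α * (t - spreadingEstimate a n)) ∧
      (processLaw n (edgeProb a n ha hn)).real {ω | informed s t ω = Finset.univ} ≤
        A * Real.exp (-α * (spreadingEstimate a n - t)) := by
  have he : Real.exp (-a) < 1 := by simpa using ha
  have hQ0 : 0 < 1 - Real.exp (-a) := by linarith
  have hQ1 : 1 - Real.exp (-a) < 1 := by linarith [Real.exp_pos (-a)]
  obtain ⟨C, hC, hstep⟩ := oneStep_roundLaw ha
  obtain ⟨A₁, α₁, hA₁, hα₁, n₁, h₁⟩ := tailBound_full hC hQ0 hQ1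
  obtain ⟨A₂, α₂, hA₂, hα₂, n₂, h₂⟩ := exists_doneProb_le hC hQ0 hQ1
  set N := max (max n₁ n₂) (max ⌈2 * a⌉₊ 2) with hN
  have hN0 : (0 : ℝ) < N := by
    have : 2 ≤ N := (le_max_right _ _).trans (le_max_right _ _)
    exact_mod_cast (by omega : 0 < N)
  set ρ := max (1 / 2) (1 - a / (N : ℝ) ^ 3) with hρ
  have hρ0 : 0 < ρ := lt_max_of_lt_left (by norm_num)
  have hρ1 : ρ < 1 := max_lt (by norm_num) (by linarith [div_pos ha (pow_pos hN0 3)])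
  have hβ : 0 < -Real.log ρ := neg_pos.2 (Real.log_neg hρ0 hρ1)
  set α := min (min α₁ α₂) (-Real.log ρ) with hα
  have hα0 : 0 < α := lt_min (lt_min hα₁ hα₂) hβ
  set A := A₁ + A₂ + N + Real.exp (α * spreadingEstimate a N) + 1 with hA
  have hE : 0 < Real.exp (α * spreadingEstimate a N) := Real.exp_pos _
  refine ⟨A, α, by positivity, hα0, fun n hn s t => ?_⟩
  have hprob : IsProbabilityMeasure (processLaw n (edgeProb a n ha hn)) := inferInstance
  rcases le_total N n with hNn | hnN
  · have hon := hstep n hn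
      ((Nat.le_ceil _).trans (by
        exact_mod_cast ((le_max_left _ _).trans (le_max_right _ _)).trans hNn))
      (((le_max_right _ _).trans (le_max_right _ _)).trans hNn)
    constructor
    · refine le_mul_exp_of_le measureReal_le_one ?_ hA₁.le (by linarith) (by linarith) hα0.le
        ((min_le_left _ _).trans (min_le_left _ _))
      rw [processLaw_real_informed_ne, spreadingEstimate_eq]
      exact h₁ n (((le_max_left _ _).trans (le_max_left _ _)).trans hNn) _ inferInstance hon {s}
        (Finset.singleton_nonempty s) (by simp) t
    · refine le_mul_exp_of_le measureReal_le_one ?_ hA₂.le (by linarith) (by linarith) hα0.le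
        ((min_le_left _ _).trans (min_le_right _ _))
      rw [processLaw_real_informed_eq, spreadingEstimate_eq]
      exact h₂ n (((le_max_right _ _).trans (le_max_left _ _)).trans hNn) _ inferInstance hon {s}
        (Finset.card_singleton s) t
  · have hf0 := spreadingEstimate_nonneg ha n
    have hfN := spreadingEstimate_mono ha (Fin.pos s) hnN
    have ht : (0 : ℝ) ≤ t := t.cast_nonneg
    constructor
    · refine le_mul_exp_of_le measureReal_le_one (A := N) (α := -Real.log ρ) ?_ hN0.le
        (by linarith) (by linarith) hα0.le (min_le_right _ _)
      rw [processLaw_real_informed_ne]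
      refine (slowProb_le_of_progress ha hn hnN s t).trans ?_
      rw [← hρ, mul_comm, ← Real.rpow_natCast, Real.rpow_def_of_pos hρ0]
      refine mul_le_mul_of_nonneg_left (Real.exp_le_exp.2 ?_) hN0.le
      nlinarith
    -- For `n ≤ N` the lower tail is trivial: the estimate is bounded by its value at `N`, and `A`
    -- contains the corresponding exponential.
    · have h1 : 1 ≤ Real.exp (α * spreadingEstimate a N) *
          Real.exp (-α * (spreadingEstimate a n - t)) := by
        rw [← Real.exp_add]
        exact Real.one_le_exp (by nlinarith)
      refine measureReal_le_one.trans (h1.trans ?_)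
      gcongr
      linarith

/-! ### The spreading time -/

theorem spreadingTimeReal_le_iff {n : ℕ} {s : Fin n} {ω : ℕ → Fin n → Fin n}
    (h : spreadingTime s ω ≠ ⊤) (t : ℕ) :
    spreadingTimeReal s ω ≤ t ↔ informed s t ω = Finset.univ := by
  obtain ⟨k, hk⟩ := WithTop.ne_top_iff_exists.1 h
  rw [← spreadingTime_le_iff, spreadingTimeReal, ← hk, WithTop.untopD_coe, Nat.cast_le]
  exact WithTop.coe_le_coe.symm

theorem spreadingTimeReal_le {n : ℕ} {s : Fin n} {ω : ℕ → Fin n → Fin n} {t : ℕ}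
    (h : informed s t ω = Finset.univ) : spreadingTimeReal s ω ≤ t := by
  refine (spreadingTimeReal_le_iff (fun h' => ?_) t).2 h
  have := (spreadingTime_le_iff s ω t).2 h
  rw [h', top_le_iff] at this
  exact WithTop.coe_ne_top this

theorem measurable_spreadingTimeReal {n : ℕ} (s : Fin n) : Measurable (spreadingTimeReal s) := by
  have hle : ∀ t : ℕ, MeasurableSet {ω | spreadingTime s ω ≤ t} := fun t => by
    simp only [spreadingTime_le_iff]
    exact measurableSet_informed s t {Finset.univ}
  have htop : MeasurableSet {ω | spreadingTime s ω = ⊤} := by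
    have : {ω | spreadingTime s ω = ⊤} = ⋂ t : ℕ, {ω | spreadingTime s ω ≤ t}ᶜ := by
      ext ω
      simp only [Set.mem_ofPred_eq, Set.mem_iInter, Set.mem_compl_iff, not_le]
      exact WithTop.eq_top_iff_forall_gt
    rw [this]
    exact MeasurableSet.iInter fun t => (hle t).compl
  have hN : Measurable fun ω => (spreadingTime s ω).untopD 0 := by
    refine measurable_of_Iic fun t => ?_
    have : (fun ω => (spreadingTime s ω).untopD 0) ⁻¹' Set.Iic t =
        {ω | spreadingTime s ω = ⊤} ∪ {ω | spreadingTime s ω ≤ t} := by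
      ext ω
      simp only [Set.mem_preimage, Set.mem_Iic, Set.mem_union, Set.mem_ofPred_eq]
      cases h : spreadingTime s ω with
      | top => simp
      | coe k =>
        simp only [WithTop.untopD_coe, WithTop.coe_ne_top, false_or]
        exact WithTop.coe_le_coe.symm
    rw [this]
    exact htop.union (hle t)
  exact measurable_from_nat.comp hN

theorem ae_spreadingTime_ne_top {n : ℕ} (P : Measure (ℕ → Fin n → Fin n)) [IsProbabilityMeasure P]
    (s : Fin n) {f A α : ℝ} (hα : 0 < α)
    (h : ∀ t : ℕ, P.real {ω | informed s t ω ≠ Finset.univ} ≤ A * Real.exp (-α * (t - f))) :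
    ∀ᵐ ω ∂P, spreadingTime s ω ≠ ⊤ := by
  have h0 : P.real {ω | ¬ spreadingTime s ω ≠ ⊤} = 0 := by
    refine le_antisymm (ge_of_tendsto' (f := fun t : ℕ => A * Real.exp (-α * (t - f)))
      (x := Filter.atTop) ?_ fun t => (measureReal_mono fun ω hω => ?_).trans (h t)) measureReal_nonneg
    · rw [← mul_zero A]
      refine Filter.Tendsto.const_mul A (Real.tendsto_exp_atBot.comp ?_)
      refine Filter.Tendsto.const_mul_atTop_of_neg (neg_lt_zero.2 hα) ?_
      exact Filter.tendsto_atTop_add_const_right _ (-f) tendsto_natCast_atTop_atTop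
    · intro h'
      have := (spreadingTime_le_iff s ω t).2 h'
      rw [not_not.1 hω, top_le_iff] at this
      exact WithTop.coe_ne_top this
  exact (measureReal_eq_zero_iff).1 h0

theorem spreadingTimeReal_tail {n : ℕ} (P : Measure (ℕ → Fin n → Fin n)) [IsProbabilityMeasure P]
    (s : Fin n) {f A α : ℝ} (hf : 0 ≤ f) (hA : 0 ≤ A) (hα : 0 < α)
    (h : ∀ t : ℕ, P.real {ω | informed s t ω ≠ Finset.univ} ≤ A * Real.exp (-α * (t - f)))
    (h' : ∀ t : ℕ, P.real {ω | informed s t ω = Finset.univ} ≤ A * Real.exp (-α * (f - t)))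
    (j : ℕ) :
    P.real {ω | (j : ℝ) ≤ |spreadingTimeReal s ω - f|} ≤
      (A * Real.exp (2 * α) + A + 1) * Real.exp (-α * j) := by
  have hup : P.real {ω | f + j ≤ spreadingTimeReal s ω} ≤
      (A * Real.exp (2 * α) + 1) * Real.exp (-α * j) := by
    rcases j with _ | k
    · have : 0 ≤ A * Real.exp (2 * α) := by positivity
      simpa using measureReal_le_one.trans (by linarith : 1 ≤ A * Real.exp (2 * α) + 1)
    · have hk : 0 ≤ f + k := by positivity
      calc P.real {ω | f + (k + 1 : ℕ) ≤ spreadingTimeReal s ω}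
          -- With `j = k + 1` the spare unit makes `⌊f + k⌋₊` strictly smaller than the spreading
          -- time.
          ≤ P.real {ω | informed s ⌊f + k⌋₊ ω ≠ Finset.univ} := by
            refine measureReal_mono fun ω hω hu => ?_
            have h1 := spreadingTimeReal_le hu
            have h2 := Nat.floor_le hk
            have h3 : f + (k + 1 : ℕ) ≤ spreadingTimeReal s ω := hω
            push_cast at h3
            linarith
        _ ≤ A * Real.exp (-α * (⌊f + k⌋₊ - f)) := h _
        _ ≤ A * Real.exp (2 * α) * Real.exp (-α * (k + 1 : ℕ)) := by
            rw [mul_assoc, ← Real.exp_add]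
            refine mul_le_mul_of_nonneg_left (Real.exp_le_exp.2 ?_) hA
            have := Nat.sub_one_lt_floor (f + k)
            push_cast
            nlinarith
        _ ≤ _ := by
            gcongr
            linarith
  have hlow : P.real {ω | spreadingTimeReal s ω ≤ f - j} ≤ A * Real.exp (-α * j) := by
    rcases lt_or_ge (f - j) 0 with hj | hj
    · have : {ω | spreadingTimeReal s ω ≤ f - j} = ∅ := by
        refine Set.eq_empty_of_forall_notMem fun ω hω => ?_
        have h1 : (0 : ℝ) ≤ spreadingTimeReal s ω := Nat.cast_nonneg _
        have h2 : spreadingTimeReal s ω ≤ f - j := hω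
        linarith
      rw [this, measureReal_empty]
      positivity
    · calc P.real {ω | spreadingTimeReal s ω ≤ f - j}
          ≤ P.real {ω | informed s ⌊f - j⌋₊ ω = Finset.univ} := by
            refine ENNReal.toReal_mono (measure_ne_top _ _) (measure_mono_ae ?_)
            -- The inclusion holds only almost surely: where the spreading time is infinite, its
            -- real version takes the default value 0.
            filter_upwards [ae_spreadingTime_ne_top P s hα h] with ω hω hle
            refine (spreadingTimeReal_le_iff hω _).1 ?_
            exact Nat.cast_le.2 (Nat.le_floor hle)
        _ ≤ A * Real.exp (-α * (f - ⌊f - j⌋₊)) := h' _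
        _ ≤ _ := by
            refine mul_le_mul_of_nonneg_left (Real.exp_le_exp.2 ?_) hA
            have := Nat.floor_le hj
            nlinarith
  calc P.real {ω | (j : ℝ) ≤ |spreadingTimeReal s ω - f|}
      ≤ P.real ({ω | f + j ≤ spreadingTimeReal s ω} ∪ {ω | spreadingTimeReal s ω ≤ f - j}) := by
        refine measureReal_mono fun ω hω => ?_
        rcases le_abs.1 (show (j : ℝ) ≤ |spreadingTimeReal s ω - f| from hω) with h1 | h1
        · left
          change f + j ≤ spreadingTimeReal s ω
          linarith
        · right
          change spreadingTimeReal s ω ≤ f - j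
          linarith
    _ ≤ _ := (measureReal_union_le _ _).trans (by linarith)

end PushDynamic

theorem mainTheorem4 (a : ℝ) (ha : 0 < a) :
    ∃ C A' α' : ℝ, 0 < A' ∧ 0 < α' ∧
      ∀ (n : ℕ) (hn : a ≤ n) (s : Fin n),
        (∀ᵐ ω ∂(PushDynamic.processLaw n (PushDynamic.edgeProb a n ha hn)),
          PushDynamic.spreadingTime s ω ≠ ⊤) ∧
        MeasureTheory.Integrable (PushDynamic.spreadingTimeReal s)
          (PushDynamic.processLaw n (PushDynamic.edgeProb a n ha hn)) ∧
        |(∫ ω, PushDynamic.spreadingTimeReal s ω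
              ∂(PushDynamic.processLaw n (PushDynamic.edgeProb a n ha hn)))
            - (Real.logb (2 - Real.exp (-a)) n + 1 / (1 - Real.exp (-a)) * Real.log n)| ≤ C ∧
        ∀ r : ℕ,
          (PushDynamic.processLaw n (PushDynamic.edgeProb a n ha hn)).real
            {ω | (r : ℝ) ≤ |PushDynamic.spreadingTimeReal s ω
              - ∫ ω', PushDynamic.spreadingTimeReal s ω'
                  ∂(PushDynamic.processLaw n (PushDynamic.edgeProb a n ha hn))|}
            ≤ A' * Real.exp (-α' * r) := by
  obtain ⟨A, α, hA, hα, h⟩ := PushDynamic.tails ha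
  set B := A * Real.exp (2 * α) + A + 1 with hB
  have hB0 : 0 < B := by positivity
  refine ⟨B / (1 - Real.exp (-α)), B * Real.exp (α * (B / (1 - Real.exp (-α)) + 1)), α,
    by positivity, hα, fun n hn s =>
      ⟨PushDynamic.ae_spreadingTime_ne_top _ s hα fun t => (h n hn s t).1,
      PushDynamic.concentration_of_tails _ (PushDynamic.measurable_spreadingTimeReal s) hB0 hα
        (PushDynamic.spreadingTimeReal_tail _ s (PushDynamic.spreadingEstimate_nonneg ha n) hA.le hα
          (fun t => (h n hn s t).1) fun t => (h n hn s t).2)⟩⟩
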